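/- \textbf{Theorem (The Submodule Theorem).} Let $R$ be a field, let $q,Q\in R$ be invertible, and let $n\ge r\ge 0$ be integers. \emph{Hecke algebra.} Let $W_r$ be the group of permutations $w$ of $\{\pm1,\dots,\pm r\}$ with $(-i)w=-(iw)$, acting on the right, with generators $s_0=(1,-1)$, $s_i=(i,i+1)(-i,-i-1)$ ($1\le i\le r-1$) and length function $\ell$. Let $\mathcal H$ be the Hecke algebra of type $B_r$: it has $R$-basis $\{T_w : w\in W_r\}$, $T_w=T_{v_1}\cdots T_{v_l}$ for every reduced expression $w=v_1\cdots v_l$, $T_{s_0}^2=Q+(Q-1)T_{s_0}$, and $T_{s_i}^2=q+(q-1)T_{s_i}$ for $i\ge1$. If a reduced expression of $w$ has $b$ factors $s_0$ and $c$ other factors, put $q_w=q^{c}Q^{b}$. Put $s_{i,j}=s_is_{i+1}\cdots s_{j-1}$ if $i\le j$, $s_{i,j}=s_{i-1}s_{i-2}\cdots s_j$ if $i>j$, and $T_{i,j}=T_{s_{i,j}}$. For $0\le a\le r$ let $h_{a,r-a}=T_{w_{a,r-a}}$ with $w_{a,r-a}=(s_{1,r})^a$, and $$u_a^+=\prod_{i=1}^a\bigl(q^{i-1}+T_{i,1}T_{s_0}T_{1,i}\bigr),\qquad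 u_a^-=\prod_{i=1}^a\bigl(Qq^{i-1}-T_{i,1}T_{s_0}T_{1,i}\bigr).$$ \emph{Bicompositions.} Let $\Lambda(n,r)$ be the set of pairs $\lambda=(\lambda^{(1)},\lambda^{(2)})$ of compositions (zero parts allowed) with $n$ parts and sum $r$ altogether; let $a=|\lambda^{(1)}|$. Let $\mathfrak t^\lambda$ be the $\lambda$-bitableau with $1,\dots,a$ in order by rows in the first component and $a+1,\dots,r$ in order by rows in the second; let $\hat{\mathfrak t}^\lambda$ (resp. $\hat{\mathfrak t}_\lambda$) be the one with $1,\dots,r-a$ in order by rows (resp. columns) in the second component and $r-a+1,\dots,r$ in order by rows (resp. columns) in the first. Let $\hat\pi_\lambda\in W_r$ be given by $\hat{\mathfrak t}^\lambda\hat\pi_\lambda=\hat{\mathfrak t}_\lambda$. Let $x_\lambda=\sum T_w$ over all $w\in W_r$ that stabilize the rows of $\mathfrak t^\lambda$, and $\hat y_\lambda=\sum(-q)^{-\ell(w)}T_w$ over all $w\in W_r$ that stabilize the columns of $\hat{\mathfrak t}_\lambda$. Let $\omega\in\Lambda(n,r)$ be the bicomposition $((-),(1^r))$, whose first component is empty and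 whose second component is $1^r$ followed by $n-r$ zeros. \emph{Schur algebra and modules.} Let $M^\lambda=u_a^+x_\lambda\mathcal H$ (so $M^\omega=\mathcal H$), $\mathcal E=\bigoplus_{\lambda\in\Lambda(n,r)}M^\lambda$ and $\mathcal S=\operatorname{End}_{\mathcal H}(\mathcal E)$. For $\lambda\in\Lambda(n,r)$ let $$z_\lambda=u_a^+x_\lambda h_{a,r-a}T_{\hat\pi_\lambda}u_{r-a}^-\hat y_\lambda\in M^\lambda\subseteq\mathcal E,\qquad W^\lambda=\mathcal S z_\lambda,\qquad L^\lambda=\mathcal S\,u_{r-a}^-\hat y_\lambda,$$ where $u_{r-a}^-\hat y_\lambda\in\mathcal H=M^\omega\subseteq\mathcal E$; then $W^\lambda\subseteq L^\lambda$. \emph{Forms.} A bitableau is row standard if its entries increase along rows and the entries of its first component are positive. There is a unique bilinear form $\langle\ ,\ \rangle$ on $\mathcal E$ such that, for all $\lambda,\mu\in\Lambda(n,r)$, with $a=|\lambda^{(1)}|$ and $b=|\mu^{(1)}|$, and all $v,w\in W_r$ with $\mathfrak t^\lambda v$ and $\mathfrak t^\mu w$ row standard, $\langle u_a^+x_\lambda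 T_v,\,u_b^+x_\mu T_w\rangle$ equals $q_w$ if $\lambda=\mu$ and $v=w$, and $0$ otherwise. For each $\lambda\in\Lambda(n,r)$ there is a unique bilinear form $\ll\ ,\ \gg$ on $L^\lambda$ (the contracted form) with $$\ll s_1u_{r-a}^-\hat y_\lambda\,,\,s_2u_{r-a}^-\hat y_\lambda\gg\;=\;\langle s_1(1)\,,\,s_2u_{r-a}^-\hat y_\lambda\rangle\qquad(s_1,s_2\in\mathcal S),$$ where $1\in\mathcal H=M^\omega\subseteq\mathcal E$. Let $\lambda\in\Lambda(n,r)$, and let $W^{\lambda\perp}$ be the orthogonal complement of $W^\lambda$ in $L^\lambda$ with respect to $\ll\ ,\ \gg$. Then for every $\mathcal S$-submodule $U$ of $L^\lambda$, $$W^\lambda\subseteq U\qquad\text{or}\qquad U\subseteq W^{\lambda\perp}.$$ -/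

import Mathlib

/-- The Weyl group `W_r` of type `B_r`: permutations `w` of `{±1, …, ±r}` with `(-i)w = -(iw)`,
extended to all of `ℤ` by fixing `0` and every integer of absolute value greater than `r`. -/
@[ext] structure SignedPerm (r : ℕ) where
  toEquiv : ℤ ≃ ℤ
  map_neg' : ∀ z, toEquiv (-z) = -toEquiv z
  map_of_lt' : ∀ z, (r : ℤ) < |z| → toEquiv z = z

namespace SignedPerm

variable {r : ℕ}

instance : CoeFun (SignedPerm r) (fun _ => ℤ → ℤ) := ⟨fun w => w.toEquiv⟩

@[simp] theorem map_neg (w : SignedPerm r) (z : ℤ) : w (-z) = -w z := w.map_neg' z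

theorem map_of_lt (w : SignedPerm r) {z : ℤ} (h : (r : ℤ) < |z|) : w z = z := w.map_of_lt' z h

@[simp] theorem map_zero (w : SignedPerm r) : w 0 = 0 := by
  have := w.map_neg 0
  simp only [neg_zero] at this
  omega

theorem injective (w : SignedPerm r) : Function.Injective w := w.toEquiv.injective

theorem ext_apply {v w : SignedPerm r} (h : ∀ z, v z = w z) : v = w :=
  SignedPerm.ext (Equiv.ext h)

theorem abs_le (w : SignedPerm r) {z : ℤ} (h : |z| ≤ r) : |w z| ≤ r := by
  by_contra hc
  have h1 := w.map_of_lt (not_le.mp hc)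
  have h2 := w.injective h1
  rw [h2] at hc
  exact hc h

/-- Elements act on the right: `i(vw) = (iv)w`. -/
instance : Mul (SignedPerm r) := ⟨fun v w =>
  { toEquiv := v.toEquiv.trans w.toEquiv
    map_neg' := fun z => by simp [v.map_neg', w.map_neg']
    map_of_lt' := fun z h => by simp [v.map_of_lt' z h, w.map_of_lt' z h] }⟩

instance : One (SignedPerm r) := ⟨⟨Equiv.refl ℤ, fun _ => rfl, fun _ _ => rfl⟩⟩

instance : Inv (SignedPerm r) := ⟨fun w =>
  { toEquiv := w.toEquiv.symm
    map_neg' := fun z => by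
      rw [Equiv.symm_apply_eq, w.map_neg', Equiv.apply_symm_apply]
    map_of_lt' := fun z h => by
      rw [Equiv.symm_apply_eq, w.map_of_lt' z h] }⟩

@[simp] theorem mul_apply (v w : SignedPerm r) (z : ℤ) : (v * w) z = w (v z) := rfl
@[simp] theorem one_apply (z : ℤ) : (1 : SignedPerm r) z = z := rfl
theorem inv_apply (w : SignedPerm r) (z : ℤ) : w⁻¹ z = w.toEquiv.symm z := rfl
@[simp] theorem inv_apply_self (w : SignedPerm r) (z : ℤ) : w⁻¹ (w z) = z :=
  w.toEquiv.symm_apply_apply z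
@[simp] theorem apply_inv_self (w : SignedPerm r) (z : ℤ) : w (w⁻¹ z) = z :=
  w.toEquiv.apply_symm_apply z

instance : Group (SignedPerm r) := Group.ofLeftAxioms
  (fun _ _ _ => rfl) (fun _ => rfl) (fun w => ext_apply fun z => by simp)

instance : Finite (SignedPerm r) := by
  let f : SignedPerm r → (Set.Icc (-(r : ℤ)) r → Set.Icc (-(r : ℤ)) r) := fun w z =>
    ⟨w z.1, _root_.abs_le.mp (w.abs_le (_root_.abs_le.mpr z.2))⟩
  refine Finite.of_injective f fun v w h => ext_apply fun z => ?_
  by_cases hz : |z| ≤ r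
  · have := congrFun h ⟨z, _root_.abs_le.mp hz⟩
    exact congrArg Subtype.val this
  · rw [v.map_of_lt (not_le.mp hz), w.map_of_lt (not_le.mp hz)]

noncomputable instance : Fintype (SignedPerm r) := Fintype.ofFinite _
noncomputable instance : DecidableEq (SignedPerm r) := Classical.decEq _

/-- The generators `s_0 = (1,-1)` and `s_i = (i,i+1)(-i,-i-1)` for `1 ≤ i ≤ r-1`. -/
def gen (i : Fin r) : SignedPerm r where
  toEquiv := if (i : ℕ) = 0 then Equiv.swap 1 (-1)
    else (Equiv.swap (i : ℤ) (i + 1)).trans (Equiv.swap (-(i : ℤ)) (-(i : ℤ) - 1))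
  map_neg' z := by
    split_ifs
    · simp only [Equiv.swap_apply_def]; split_ifs <;> omega
    · simp only [Equiv.trans_apply, Equiv.swap_apply_def]; split_ifs <;> omega
  map_of_lt' z h := by
    have hi := i.2
    rw [lt_abs] at h
    split_ifs
    · simp only [Equiv.swap_apply_def]; split_ifs <;> omega
    · simp only [Equiv.trans_apply, Equiv.swap_apply_def]; split_ifs <;> omega

/-- The length of `w`: the least number of factors in an expression of `w` as a product of
generators. -/
noncomputable def len (w : SignedPerm r) : ℕ :=
  sInf {k | ∃ l : List (Fin r), (l.map gen).prod = w ∧ l.length = k}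

/-- `l` spells a reduced expression for `w`. -/
def IsReduced (l : List (Fin r)) (w : SignedPerm r) : Prop :=
  (l.map gen).prod = w ∧ l.length = w.len

/-- `s_i` exchanges `lo i` with `hi i` and `-lo i` with `-hi i`. -/
def lo (i : Fin r) : ℤ := if (i : ℕ) = 0 then -1 else i
/-- See `lo`. -/
def hi (i : Fin r) : ℤ := i + 1

theorem gen_apply (i : Fin r) (z : ℤ) : gen i z =
    if z = lo i then hi i else if z = hi i then lo i else
    if z = -lo i then -hi i else if z = -hi i then -lo i else z := by
  show (if (i : ℕ) = 0 then Equiv.swap 1 (-1)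
    else (Equiv.swap (i : ℤ) (i + 1)).trans (Equiv.swap (-(i : ℤ)) (-(i : ℤ) - 1))) z = _
  unfold lo hi
  by_cases h : (i : ℕ) = 0
  · simp only [h, if_true, Equiv.swap_apply_def]; split_ifs <;> omega
  · simp only [h, if_false, Equiv.trans_apply, Equiv.swap_apply_def]
    split_ifs <;> omega

theorem lo_lt_hi (i : Fin r) : lo i < hi i := by unfold lo hi; split_ifs <;> omega
theorem lo_ne (i : Fin r) : lo i ≠ 0 := by unfold lo; split_ifs <;> omega
theorem hi_ne (i : Fin r) : hi i ≠ 0 := by unfold hi; omega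
theorem gen_lo (i : Fin r) : gen i (lo i) = hi i := by rw [gen_apply]; simp
theorem gen_hi (i : Fin r) : gen i (hi i) = lo i := by
  rw [gen_apply]; have := lo_lt_hi i; rw [if_neg (by omega), if_pos rfl]

theorem gen_gen (i : Fin r) (z : ℤ) : gen i (gen i z) = z := by
  have h1 := lo_lt_hi i
  have h2 : hi i = -lo i ∨ 0 < lo i := by unfold lo hi; split_ifs <;> omega
  simp only [gen_apply]
  split_ifs <;> omega

@[simp] theorem gen_mul_self (i : Fin r) : gen i * gen i = 1 := ext_apply (gen_gen i)
@[simp] theorem gen_mul_cancel (i : Fin r) (w : SignedPerm r) : gen i * (gen i * w) = w := by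
  rw [← mul_assoc, gen_mul_self, one_mul]
@[simp] theorem mul_gen_cancel (i : Fin r) (w : SignedPerm r) : w * gen i * gen i = w := by
  rw [mul_assoc, gen_mul_self, mul_one]
@[simp] theorem gen_inv (i : Fin r) : (gen i)⁻¹ = gen i := inv_eq_of_mul_eq_one_left (gen_mul_self i)

/-- A generator reverses the order of a pair only if it exchanges the pair. -/
theorem flip {j : Fin r} {a b : ℤ} (ha : a ≠ 0) (hb : b ≠ 0) (hab : a < b)
    (h : gen j b < gen j a) : (a = lo j ∧ b = hi j) ∨ (a = -hi j ∧ b = -lo j) := by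
  rw [gen_apply, gen_apply] at h
  unfold lo hi at *
  split_ifs at * <;> omega

theorem conj_of_map {i j : Fin r} {v : SignedPerm r}
    (h : (v (lo i) = lo j ∧ v (hi i) = hi j) ∨ (v (lo i) = -hi j ∧ v (hi i) = -lo j)) :
    gen i * v = v * gen j := by
  refine ext_apply fun z => ?_
  simp only [mul_apply]
  have inj : ∀ x, v z = v x ↔ z = x := fun x => v.injective.eq_iff
  have h1 := inj (lo i)
  have h2 := inj (hi i)
  have h3 := inj (-lo i)
  have h4 := inj (-hi i)
  rw [map_neg] at h3 h4
  have hl := lo_lt_hi i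
  have hl' := lo_lt_hi j
  have hh : hi i = -lo i ∨ 0 < lo i := by unfold lo hi; split_ifs <;> omega
  have hh' : hi j = -lo j ∨ 0 < lo j := by unfold lo hi; split_ifs <;> omega
  rw [gen_apply i z, gen_apply j (v z)]
  by_cases c1 : z = lo i
  · rw [if_pos c1]; have := h1.mpr c1; split_ifs <;> omega
  by_cases c2 : z = hi i
  · rw [if_neg c1, if_pos c2]; have := h2.mpr c2; split_ifs <;> omega
  by_cases c3 : z = -lo i
  · rw [if_neg c1, if_neg c2, if_pos c3, map_neg]; have := h3.mpr c3; split_ifs <;> omega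
  by_cases c4 : z = -hi i
  · rw [if_neg c1, if_neg c2, if_neg c3, if_pos c4, map_neg]
    have := h4.mpr c4; split_ifs <;> omega
  rw [if_neg c1, if_neg c2, if_neg c3, if_neg c4]
  have n1 := mt h1.mp c1
  have n2 := mt h2.mp c2
  have n3 := mt h3.mp c3
  have n4 := mt h4.mp c4
  split_ifs <;> omega

theorem ne_zero (w : SignedPerm r) {z : ℤ} (h : z ≠ 0) : w z ≠ 0 := fun hz =>
  h (w.injective (hz.trans w.map_zero.symm))

/-- If `w` does not preserve the order of `lo i`, `hi i`, then a factor can be exchanged. -/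
theorem exchange {i : Fin r} : ∀ {l : List (Fin r)} {v : SignedPerm r},
    v (lo i) < v (hi i) → (v * (l.map gen).prod) (hi i) < (v * (l.map gen).prod) (lo i) →
    ∃ l' : List (Fin r), l'.length + 1 = l.length ∧
      gen i * (v * (l.map gen).prod) = v * (l'.map gen).prod
  | [], v, h1, h2 => by simp at h2; omega
  | j :: l, v, h1, h2 => by
    by_cases h : (v * gen j) (lo i) < (v * gen j) (hi i)
    · obtain ⟨l', hl, he⟩ := exchange (l := l) (v := v * gen j) h (by
        simpa [mul_assoc] using h2)
      refine ⟨j :: l', by simpa using hl, ?_⟩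
      simpa [mul_assoc] using he
    · have hne : (v * gen j) (lo i) ≠ (v * gen j) (hi i) := fun hc => by
        have := (v * gen j).injective hc
        have := lo_lt_hi i
        omega
      have hlt : (v * gen j) (hi i) < (v * gen j) (lo i) := by omega
      have := conj_of_map (flip (v.ne_zero (lo_ne i)) (v.ne_zero (hi_ne i)) h1 hlt)
      refine ⟨l, by simp, ?_⟩
      rw [← mul_assoc, this]
      simp [mul_assoc]

/-- Without descents an element is trivial. -/
theorem eq_one_of_asc {w : SignedPerm r} (h : ∀ i : Fin r, w (lo i) < w (hi i)) : w = 1 := by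
  have h0 : ∀ k : ℕ, k < r → w (k : ℤ) < w ((k : ℤ) + 1) := by
    intro k hk
    have := h ⟨k, hk⟩
    unfold lo hi at this
    by_cases hk0 : k = 0
    · subst hk0
      simp only [if_true, map_neg] at this
      simp only [Nat.cast_zero, map_zero]
      norm_num at this ⊢
      omega
    · simpa [hk0] using this
  have hge : ∀ k : ℕ, k ≤ r → (k : ℤ) ≤ w k := by
    intro k
    induction k with
    | zero => intro _; simp
    | succ k ih =>
      intro hk
      have := h0 k (by omega)
      have := ih (by omega)
      push_cast
      omega
  have hle : ∀ m k : ℕ, k + m = r → w k ≤ k := by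
    intro m
    induction m with
    | zero =>
      intro k hk
      have : |w (k : ℤ)| ≤ r := w.abs_le (by simp; omega)
      have := (_root_.abs_le.mp this).2
      omega
    | succ m ih =>
      intro k hk
      have := h0 k (by omega)
      have := ih (k + 1) (by omega)
      push_cast at this
      omega
  have hk : ∀ k : ℕ, w (k : ℤ) = k := by
    intro k
    by_cases hkr : k ≤ r
    · exact le_antisymm (hle (r - k) k (by omega)) (hge k hkr)
    · exact w.map_of_lt (by simp; omega)
  refine ext_apply fun z => ?_
  obtain ⟨k, rfl | rfl⟩ := z.eq_nat_or_neg
  · exact hk k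
  · rw [map_neg, hk]; rfl

theorem sum_lt {w : SignedPerm r} {i : Fin r} (h : w (hi i) < w (lo i)) :
    ∑ z ∈ Finset.Icc (1 : ℤ) r, z * w z < ∑ z ∈ Finset.Icc (1 : ℤ) r, z * (gen i * w) z := by
  have hir := i.2
  by_cases hi0 : (i : ℕ) = 0
  · refine Finset.sum_lt_sum (fun z hz => ?_) ⟨1, by simp; omega, ?_⟩
    · rw [Finset.mem_Icc] at hz
      rw [mul_apply]
      have e := gen_apply i z
      unfold lo hi at h e
      simp only [hi0, if_true] at h e
      norm_num at h
      norm_num at e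
      by_cases hz1 : z = 1
      · subst hz1
        norm_num at e
        rw [e, map_neg]; omega
      · have e2 : gen i z = z := by rw [e]; split_ifs <;> omega
        rw [e2]
    · have e := gen_hi i
      unfold lo hi at h e
      simp only [hi0, if_true] at h e
      norm_num at h e
      simp only [mul_apply, e, map_neg]
      omega
  · rw [← sub_pos, ← Finset.sum_sub_distrib]
    have el : lo i = i := by simp [lo, hi0]
    have eh : hi i = i + 1 := rfl
    rw [Finset.sum_eq_add (lo i) (hi i) (by omega)]
    · simp only [mul_apply, gen_lo, gen_hi]
      rw [el, eh] at h ⊢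
      nlinarith
    · intro z hz hz2
      rw [Finset.mem_Icc] at hz
      simp only [mul_apply, gen_apply]
      rw [if_neg hz2.1, if_neg hz2.2, if_neg (by omega), if_neg (by omega)]
      ring
    · intro hc; exact absurd (Finset.mem_Icc.mpr (by omega)) hc
    · intro hc; exact absurd (Finset.mem_Icc.mpr (by omega)) hc

open Classical in
theorem exists_word (w : SignedPerm r) : ∃ l : List (Fin r), (l.map gen).prod = w := by
  by_contra hw
  let B : Finset (SignedPerm r) := Finset.univ.filter fun w => ¬ ∃ l : List (Fin r), (l.map gen).prod = w
  obtain ⟨v, hv, hmax⟩ := Finset.exists_max_image B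
    (fun w => ∑ z ∈ Finset.Icc (1 : ℤ) r, z * w z) ⟨w, by simpa [B] using hw⟩
  have hv' : ¬ ∃ l : List (Fin r), (l.map gen).prod = v := by
    simpa only [B, Finset.mem_filter, Finset.mem_univ, true_and] using hv
  by_cases h : ∀ i : Fin r, v (lo i) < v (hi i)
  · exact hv' ⟨[], by simp [eq_one_of_asc h]⟩
  · push Not at h
    obtain ⟨i, hi'⟩ := h
    have hne : v (hi i) ≠ v (lo i) := fun hc => by
      have := v.injective hc
      have := lo_lt_hi i
      omega
    have hlt := sum_lt (lt_of_le_of_ne hi' hne)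
    have hmem : gen i * v ∉ B := fun hm => absurd (hmax _ hm) (not_le.mpr hlt)
    simp only [B, Finset.mem_filter, Finset.mem_univ, true_and, not_not] at hmem
    obtain ⟨l, hl⟩ := hmem
    exact hv' ⟨i :: l, by simp [hl]⟩

theorem exists_reduced (w : SignedPerm r) : ∃ l : List (Fin r), IsReduced l w := by
  obtain ⟨l, hl⟩ := exists_word w
  exact Nat.sInf_mem (s := {k | ∃ l : List (Fin r), (l.map gen).prod = w ∧ l.length = k})
    ⟨l.length, l, hl, rfl⟩

theorem len_le (l : List (Fin r)) : len (l.map gen).prod ≤ l.length :=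
  Nat.sInf_le ⟨l, rfl, rfl⟩

theorem len_inv_le (w : SignedPerm r) : w⁻¹.len ≤ w.len := by
  obtain ⟨l, hl, hk⟩ := exists_reduced w
  rw [← hk, ← l.length_reverse]
  convert len_le l.reverse
  rw [← hl, List.prod_inv_reverse, List.map_reverse, List.map_map]
  congr 2
  exact List.map_congr_left fun i _ => gen_inv i

theorem len_inv (w : SignedPerm r) : w⁻¹.len = w.len :=
  le_antisymm (len_inv_le w) (by simpa using len_inv_le w⁻¹)

theorem len_gen_mul_le (i : Fin r) (w : SignedPerm r) : (gen i * w).len ≤ w.len + 1 := by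
  obtain ⟨l, hl, hk⟩ := exists_reduced w
  rw [← hk, ← hl]
  simpa using len_le (i :: l)

theorem len_lt_of_desc {i : Fin r} {w : SignedPerm r} (h : w (hi i) < w (lo i)) :
    (gen i * w).len < w.len := by
  obtain ⟨l, hl, hk⟩ := exists_reduced w
  obtain ⟨l', h1, h2⟩ := exchange (i := i) (l := l) (v := 1) (lo_lt_hi i) (by
    rw [one_mul, hl]; exact h)
  rw [one_mul, one_mul, hl] at h2
  have := len_le l'
  rw [← h2] at this
  omega

theorem len_gt_iff (i : Fin r) (w : SignedPerm r) :
    w.len < (gen i * w).len ↔ w (lo i) < w (hi i) := by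
  have hne : w (hi i) ≠ w (lo i) := fun hc => by
    have := w.injective hc
    have := lo_lt_hi i
    omega
  constructor
  · intro h
    by_contra hc
    have := len_lt_of_desc (i := i) (w := w) (by omega)
    omega
  · intro h
    have := len_lt_of_desc (i := i) (w := gen i * w) (by simpa [gen_lo, gen_hi] using h)
    simpa using this

theorem len_mul_gen_gt_iff (w : SignedPerm r) (j : Fin r) :
    w.len < (w * gen j).len ↔ w⁻¹ (lo j) < w⁻¹ (hi j) := by
  rw [← len_gt_iff, len_inv, ← len_inv (w * gen j), mul_inv_rev, gen_inv]

/-- Multiplying by `s_j` on the right does not affect the position of `w` relative to `s_i w`,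
unless `s_i w = w s_j`. -/
theorem asc_mul_gen {i j : Fin r} {w : SignedPerm r} (h : gen i * w ≠ w * gen j) :
    (w * gen j).len < (gen i * (w * gen j)).len ↔ w.len < (gen i * w).len := by
  rw [len_gt_iff, len_gt_iff]
  have key : ∀ v : SignedPerm r, gen i * v ≠ v * gen j → v (lo i) < v (hi i) →
      (v * gen j) (lo i) < (v * gen j) (hi i) := by
    intro v hv hlt
    by_contra hc
    have hne : (v * gen j) (lo i) ≠ (v * gen j) (hi i) := fun hc => by
      have := (v * gen j).injective hc
      have := lo_lt_hi i
      omega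
    exact hv (conj_of_map (flip (v.ne_zero (lo_ne i)) (v.ne_zero (hi_ne i)) hlt
      (by simp only [mul_apply] at hc hne; omega)))
  refine ⟨fun h1 => ?_, key w h⟩
  have := key (w * gen j) (fun hc => h (by
    have := congrArg (· * gen j) hc
    simpa [← mul_assoc] using this)) h1
  simpa using this

theorem asc_gen_mul {i j : Fin r} {w : SignedPerm r} (h : gen i * w ≠ w * gen j) :
    (gen i * w).len < (gen i * w * gen j).len ↔ w.len < (w * gen j).len := by
  have := asc_mul_gen (i := j) (j := i) (w := w⁻¹) (fun hc => h (by
    have := congrArg (·⁻¹) hc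
    simpa using this.symm))
  rw [← len_inv (gen i * w), ← len_inv (gen i * w * gen j), ← len_inv w, ← len_inv (w * gen j)]
  simpa [mul_assoc] using this

/-- `s_0` is not conjugate to any other generator. -/
theorem zero_of_conj {i j : Fin r} {w : SignedPerm r} (h : gen i * w = w * gen j)
    (hi0 : (i : ℕ) = 0) : (j : ℕ) = 0 := by
  by_contra hj
  have h1 := congrArg (fun v : SignedPerm r => v (hi i)) h
  simp only [mul_apply, gen_hi] at h1
  have e : lo i = -hi i := by simp [lo, hi, hi0]
  rw [e, map_neg] at h1
  have hz := w.ne_zero (hi_ne i)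
  rw [gen_apply] at h1
  have : lo j = j := by simp [lo, hj]
  have : hi j = j + 1 := rfl
  split_ifs at h1 <;> omega

theorem zero_iff_of_conj {i j : Fin r} {w : SignedPerm r} (h : gen i * w = w * gen j) :
    (i : ℕ) = 0 ↔ (j : ℕ) = 0 :=
  ⟨zero_of_conj h, zero_of_conj (i := j) (j := i) (w := w⁻¹) (by
    have := congrArg (·⁻¹) h
    simpa using this.symm)⟩

theorem len_one : (1 : SignedPerm r).len = 0 := by
  have := len_le ([] : List (Fin r))
  simpa using this

theorem IsReduced.tail {i : Fin r} {l : List (Fin r)} {w : SignedPerm r}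
    (h : IsReduced (i :: l) w) : IsReduced l (gen i * w) ∧ (gen i * w).len < w.len := by
  obtain ⟨h1, h2⟩ := h
  have e : (l.map gen).prod = gen i * w := by rw [← h1]; simp
  have := len_le l
  have h3 := len_gen_mul_le i (gen i * w)
  rw [gen_mul_cancel] at h3
  rw [e] at this
  simp only [List.length_cons] at h2
  exact ⟨⟨e, by omega⟩, by omega⟩

/-- The number of `k` with `1 ≤ k ≤ r` sent to a negative integer. -/
noncomputable def negCount (w : SignedPerm r) : ℕ :=
  ((Finset.Icc (1 : ℤ) r).filter fun z => w z < 0).card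

theorem negCount_gen_mul {i : Fin r} {w : SignedPerm r} (h : w.len < (gen i * w).len) :
    (gen i * w).negCount = w.negCount + if (i : ℕ) = 0 then 1 else 0 := by
  rw [len_gt_iff] at h
  have hir := i.2
  by_cases hi0 : (i : ℕ) = 0
  · have el : lo i = -1 := by simp [lo, hi0]
    have eh : hi i = 1 := by simp [hi, hi0]
    rw [el, eh, map_neg] at h
    have e1 : gen i 1 = -1 := by have := gen_hi i; rwa [el, eh] at this
    rw [if_pos hi0]
    unfold negCount
    rw [← Finset.card_insert_of_notMem (a := (1 : ℤ)) (by simp; omega)]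
    congr 1
    ext z
    simp only [Finset.mem_filter, Finset.mem_Icc, Finset.mem_insert]
    rw [mul_apply]
    by_cases hz : z = 1
    · subst hz; rw [e1, map_neg]; simp; omega
    · have : 1 ≤ z → gen i z = z := fun hz1 => by
        rw [gen_apply, el, eh]
        rw [if_neg (by omega), if_neg hz, if_neg (by omega), if_neg (by omega)]
      constructor
      · rintro ⟨h1, h2⟩; rw [this h1.1] at h2; exact Or.inr ⟨h1, h2⟩
      · rintro (h1 | ⟨h1, h2⟩)
        · exact absurd h1 hz
        · rw [this h1.1]; exact ⟨h1, h2⟩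
  · have el : lo i = i := by simp [lo, hi0]
    have eh : hi i = i + 1 := rfl
    rw [if_neg hi0, add_zero]
    have hpos : ∀ z, 1 ≤ z ∧ z ≤ (r : ℤ) → 1 ≤ gen i z ∧ gen i z ≤ (r : ℤ) := by
      intro z hz
      rw [gen_apply, el, eh]
      split_ifs <;> omega
    refine Finset.card_bij (fun z _ => gen i z) ?_ (fun _ _ _ _ h => (gen i).injective h) ?_
    · intro z hz
      simp only [Finset.mem_filter, Finset.mem_Icc] at hz ⊢
      rw [mul_apply] at hz
      exact ⟨hpos z hz.1, hz.2⟩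
    · intro z hz
      simp only [Finset.mem_filter, Finset.mem_Icc] at hz
      refine ⟨gen i z, ?_, gen_gen i z⟩
      simp only [Finset.mem_filter, Finset.mem_Icc]
      rw [mul_apply, gen_gen]
      exact ⟨hpos z hz.1, hz.2⟩

theorem count_reduced : ∀ {l : List (Fin r)} {w : SignedPerm r}, IsReduced l w →
    l.countP (fun i : Fin r => (i : ℕ) = 0) = w.negCount
  | [], w, h => by
    obtain ⟨h1, -⟩ := h
    simp only [List.map_nil, List.prod_nil] at h1
    subst h1
    symm
    simp only [List.countP_nil]
    unfold negCount
    rw [Finset.card_eq_zero, Finset.filter_eq_empty_iff]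
    intro z hz
    rw [Finset.mem_Icc] at hz
    simp only [one_apply]
    omega
  | i :: l, w, h => by
    obtain ⟨h1, h2⟩ := h.tail
    have := negCount_gen_mul (i := i) (w := gen i * w) (by simpa using h2)
    rw [gen_mul_cancel] at this
    rw [List.countP_cons, count_reduced h1, this]
    simp

/-- A chosen reduced expression. -/
noncomputable def redWord (w : SignedPerm r) : List (Fin r) := (exists_reduced w).choose

theorem redWord_spec (w : SignedPerm r) : IsReduced w.redWord w := (exists_reduced w).choose_spec

end SignedPerm

section HeckeAlgebra

variable {R : Type*} [CommRing R] {r : ℕ}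

/-- The parameter of `s_i`: `Q` for `s_0` and `q` for the others. -/
def heckeParam (q Q : Rˣ) (i : Fin r) : Rˣ := if (i : ℕ) = 0 then Q else q

/-- `q_w = q^a Q^b`, where a reduced expression of `w` has `b` factors `s_0` and `a` others. -/
noncomputable def qLen (q Q : Rˣ) (w : SignedPerm r) : Rˣ :=
  (w.redWord.map (heckeParam q Q)).prod

theorem prod_heckeParam (q Q : Rˣ) (l : List (Fin r)) : (l.map (heckeParam q Q)).prod =
    q ^ (l.length - l.countP (fun i : Fin r => (i : ℕ) = 0)) *
      Q ^ l.countP (fun i : Fin r => (i : ℕ) = 0) := by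
  induction l with
  | nil => simp
  | cons i l ih =>
    have h := l.countP_le_length (p := fun i : Fin r => decide ((i : ℕ) = 0))
    rw [List.map_cons, List.prod_cons, ih, List.countP_cons, List.length_cons, heckeParam]
    by_cases h0 : (i : ℕ) = 0
    · simp only [h0, if_true, decide_true]
      rw [Nat.add_sub_add_right, pow_succ Q]
      exact mul_left_comm _ _ _ |>.trans (by rw [mul_comm Q])
    · simp only [h0, if_false, decide_false, Bool.false_eq_true, add_zero]
      rw [Nat.succ_sub h, pow_succ' q, mul_assoc]

/-- `q_w` does not depend on the reduced expression. -/
theorem qLen_eq (q Q : Rˣ) {l : List (Fin r)} {w : SignedPerm r} (h : w.IsReduced l) :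
    qLen q Q w = (l.map (heckeParam q Q)).prod := by
  rw [qLen, prod_heckeParam, prod_heckeParam, SignedPerm.count_reduced h,
    SignedPerm.count_reduced w.redWord_spec, h.2, w.redWord_spec.2]

/-- The Hecke algebra of type `B_r` with parameters `q`, `Q`: the free `R`-module with basis
`T_w`, `w ∈ W_r`. Its multiplication is constructed below. -/
def Hecke (r : ℕ) {R : Type*} [CommRing R] (_q _Q : Rˣ) : Type _ := SignedPerm r →₀ R

namespace Hecke

open SignedPerm

variable (q Q : Rˣ)

noncomputable instance : AddCommGroup (Hecke r q Q) :=
  inferInstanceAs (AddCommGroup (SignedPerm r →₀ R))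

noncomputable instance : Module R (Hecke r q Q) :=
  inferInstanceAs (Module R (SignedPerm r →₀ R))

/-- The basis element `T_w`. -/
noncomputable def T (w : SignedPerm r) : Hecke r q Q := Finsupp.single w (1 : R)

/-- The `T_w` form a basis. -/
noncomputable def basis : Module.Basis (SignedPerm r) R (Hecke r q Q) :=
  Module.Basis.ofRepr (LinearEquiv.refl R (SignedPerm r →₀ R))

@[simp] theorem basis_apply (w : SignedPerm r) : basis q Q w = T q Q w := rfl

/-- Left multiplication by `T_{s_i}`. -/
noncomputable def leftOp (i : Fin r) : Hecke r q Q →ₗ[R] Hecke r q Q :=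
  (basis q Q).constr R fun w =>
    if w.len < (gen i * w).len then T q Q (gen i * w)
    else (heckeParam q Q i : R) • T q Q (gen i * w) + ((heckeParam q Q i : R) - 1) • T q Q w

/-- Right multiplication by `T_{s_i}`. -/
noncomputable def rightOp (i : Fin r) : Hecke r q Q →ₗ[R] Hecke r q Q :=
  (basis q Q).constr R fun w =>
    if w.len < (w * gen i).len then T q Q (w * gen i)
    else (heckeParam q Q i : R) • T q Q (w * gen i) + ((heckeParam q Q i : R) - 1) • T q Q w

theorem leftOp_T (i : Fin r) (w : SignedPerm r) : leftOp q Q i (T q Q w) =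
    if w.len < (gen i * w).len then T q Q (gen i * w)
    else (heckeParam q Q i : R) • T q Q (gen i * w) + ((heckeParam q Q i : R) - 1) • T q Q w := by
  rw [← basis_apply, leftOp, Module.Basis.constr_basis]; rfl

theorem rightOp_T (i : Fin r) (w : SignedPerm r) : rightOp q Q i (T q Q w) =
    if w.len < (w * gen i).len then T q Q (w * gen i)
    else (heckeParam q Q i : R) • T q Q (w * gen i) + ((heckeParam q Q i : R) - 1) • T q Q w := by
  rw [← basis_apply, rightOp, Module.Basis.constr_basis]; rfl

theorem leftOp_rightOp (i j : Fin r) (x : Hecke r q Q) :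
    leftOp q Q i (rightOp q Q j x) = rightOp q Q j (leftOp q Q i x) := by
  suffices h : leftOp q Q i ∘ₗ rightOp q Q j = rightOp q Q j ∘ₗ leftOp q Q i from
    LinearMap.congr_fun h x
  refine (basis q Q).ext fun w => ?_
  rw [basis_apply, LinearMap.comp_apply, LinearMap.comp_apply]
  by_cases h : gen i * w = w * gen j
  · have hp : heckeParam q Q i = heckeParam q Q j := by
      simp only [heckeParam, zero_iff_of_conj h]
    have e1 : gen i * (w * gen j) = w := by rw [← h, gen_mul_cancel]
    rw [leftOp_T, rightOp_T, hp, ← h]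
    split_ifs with c
    · rw [leftOp_T, rightOp_T, gen_mul_cancel, hp, h, mul_gen_cancel]
    · simp only [map_add, map_smul, leftOp_T, rightOp_T]
      rw [gen_mul_cancel, hp, h, mul_gen_cancel]
  · have a1 := asc_mul_gen h
    have a2 := asc_gen_mul h
    rw [mul_assoc] at a2
    rw [leftOp_T, rightOp_T]
    by_cases c1 : w.len < (gen i * w).len <;> by_cases c2 : w.len < (w * gen j).len
    · rw [if_pos c1, if_pos c2, leftOp_T, rightOp_T, if_pos (a1.mpr c1), mul_assoc,
        if_pos (a2.mpr c2)]
    · rw [if_pos c1, if_neg c2]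
      simp only [map_add, map_smul, leftOp_T, rightOp_T]
      rw [if_pos (a1.mpr c1), mul_assoc, if_neg (mt a2.mp c2), if_pos c1]
    · rw [if_neg c1, if_pos c2]
      simp only [map_add, map_smul, leftOp_T, rightOp_T]
      rw [if_neg (mt a1.mp c1), mul_assoc, if_pos (a2.mpr c2), if_pos c2]
    · rw [if_neg c1, if_neg c2]
      simp only [map_add, map_smul, leftOp_T, rightOp_T]
      rw [if_neg (mt a1.mp c1), mul_assoc, if_neg (mt a2.mp c2), if_neg c1, if_neg c2]
      simp only [smul_add, smul_smul]
      rw [mul_comm (heckeParam q Q i : R) (heckeParam q Q j : R)]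
      rw [mul_comm ((heckeParam q Q i : R) - 1) ((heckeParam q Q j : R) - 1)]
      rw [mul_comm (heckeParam q Q i : R) ((heckeParam q Q j : R) - 1)]
      rw [mul_comm ((heckeParam q Q i : R) - 1) (heckeParam q Q j : R)]
      abel

/-- Left multiplication by `x`; for `x = T_w` it is the product of the operators of a reduced
expression. -/
noncomputable def opOf : Hecke r q Q →ₗ[R] Module.End R (Hecke r q Q) :=
  (basis q Q).constr R fun w => (w.redWord.map (leftOp q Q)).prod

theorem opOf_T (w : SignedPerm r) :
    opOf q Q (T q Q w) = (w.redWord.map (leftOp q Q)).prod := by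
  rw [← basis_apply, opOf, Module.Basis.constr_basis]

theorem word_T : ∀ {l : List (Fin r)} {w : SignedPerm r}, w.IsReduced l →
    (l.map (leftOp q Q)).prod (T q Q 1) = T q Q w
  | [], w, h => by
    have := h.1
    simp only [List.map_nil, List.prod_nil] at this
    subst this
    rfl
  | i :: l, w, h => by
    obtain ⟨h1, h2⟩ := h.tail
    rw [List.map_cons, List.prod_cons, Module.End.mul_apply, word_T h1, leftOp_T, gen_mul_cancel,
      if_pos h2]

theorem opOf_one (x : Hecke r q Q) : opOf q Q x (T q Q 1) = x := by
  suffices h : (LinearMap.applyₗ (T q Q 1)) ∘ₗ opOf q Q = LinearMap.id from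
    LinearMap.congr_fun h x
  refine (basis q Q).ext fun w => ?_
  rw [basis_apply, LinearMap.comp_apply, opOf_T]
  exact word_T q Q w.redWord_spec

theorem rword_T (w : SignedPerm r) :
    ∃ l : List (Fin r), (l.map (rightOp q Q)).prod (T q Q 1) = T q Q w := by
  obtain ⟨k, hk⟩ : ∃ k, w.len = k := ⟨_, rfl⟩
  induction k using Nat.strong_induction_on generalizing w with
  | _ k ih =>
    obtain ⟨l, hl⟩ := exists_reduced w⁻¹
    cases l with
    | nil =>
      have := hl.1
      simp only [List.map_nil, List.prod_nil] at this
      rw [eq_comm, inv_eq_one] at this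
      subst this
      exact ⟨[], rfl⟩
    | cons i l =>
      obtain ⟨-, h2⟩ := hl.tail
      rw [len_inv, ← len_inv, mul_inv_rev, inv_inv, gen_inv] at h2
      obtain ⟨l', hl'⟩ := ih _ (hk ▸ h2) (w * gen i) rfl
      refine ⟨i :: l', ?_⟩
      rw [List.map_cons, List.prod_cons, Module.End.mul_apply, hl', rightOp_T, mul_gen_cancel,
        if_pos h2]

/-- Operators that commute with all right multiplications are determined by their value at
`T_1`. -/
theorem op_ext {f g : Module.End R (Hecke r q Q)}
    (hf : ∀ i x, f (rightOp q Q i x) = rightOp q Q i (f x))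
    (hg : ∀ i x, g (rightOp q Q i x) = rightOp q Q i (g x))
    (h : f (T q Q 1) = g (T q Q 1)) : f = g := by
  have key : ∀ l : List (Fin r), f ((l.map (rightOp q Q)).prod (T q Q 1)) =
      g ((l.map (rightOp q Q)).prod (T q Q 1)) := by
    intro l
    induction l with
    | nil => exact h
    | cons i l ih =>
      rw [List.map_cons, List.prod_cons, Module.End.mul_apply, hf, hg, ih]
  refine (basis q Q).ext fun w => ?_
  obtain ⟨l, hl⟩ := rword_T q Q w
  rw [basis_apply, ← hl, key]

theorem word_comm (l : List (Fin r)) (i : Fin r) (x : Hecke r q Q) :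
    (l.map (leftOp q Q)).prod (rightOp q Q i x) = rightOp q Q i ((l.map (leftOp q Q)).prod x) := by
  induction l with
  | nil => rfl
  | cons j l ih =>
    rw [List.map_cons, List.prod_cons, Module.End.mul_apply, ih, leftOp_rightOp]; rfl

theorem opOf_comm (y : Hecke r q Q) (i : Fin r) (x : Hecke r q Q) :
    opOf q Q y (rightOp q Q i x) = rightOp q Q i (opOf q Q y x) := by
  suffices h : LinearMap.applyₗ (rightOp q Q i x) ∘ₗ opOf q Q =
      rightOp q Q i ∘ₗ LinearMap.applyₗ x ∘ₗ opOf q Q from LinearMap.congr_fun h y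
  refine (basis q Q).ext fun w => ?_
  rw [basis_apply, LinearMap.comp_apply, LinearMap.comp_apply, LinearMap.comp_apply, opOf_T]
  exact word_comm q Q _ i x

theorem opOf_opOf (x y : Hecke r q Q) : opOf q Q (opOf q Q x y) = opOf q Q x * opOf q Q y :=
  op_ext q Q (opOf_comm q Q _) (fun i z => by
    rw [Module.End.mul_apply, opOf_comm, opOf_comm]; rfl) (by
    rw [opOf_one, Module.End.mul_apply, opOf_one])

theorem opOf_T_one : opOf q Q (T q Q (1 : SignedPerm r)) = 1 :=
  op_ext q Q (opOf_comm q Q _) (fun _ _ => rfl) (by rw [opOf_one]; rfl)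

noncomputable instance : Mul (Hecke r q Q) := ⟨fun x y => opOf q Q x y⟩
noncomputable instance : One (Hecke r q Q) := ⟨T q Q 1⟩

theorem mul_def (x y : Hecke r q Q) : x * y = opOf q Q x y := rfl
theorem one_def : (1 : Hecke r q Q) = T q Q 1 := rfl

noncomputable instance : Ring (Hecke r q Q) :=
  { (inferInstance : AddCommGroup (Hecke r q Q)) with
    mul := (· * ·)
    one := 1
    mul_assoc := fun x y z => by simp only [mul_def, opOf_opOf]; rfl
    one_mul := fun x => by rw [mul_def, one_def, opOf_T_one]; rfl
    mul_one := fun x => by rw [mul_def, one_def, opOf_one]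
    left_distrib := fun x y z => by simp only [mul_def, map_add]
    right_distrib := fun x y z => by simp only [mul_def, map_add, LinearMap.add_apply]
    zero_mul := fun x => by simp only [mul_def, _root_.map_zero, LinearMap.zero_apply]
    mul_zero := fun x => by simp only [mul_def, _root_.map_zero] }

noncomputable instance : Algebra R (Hecke r q Q) :=
  Algebra.ofModule (fun a x y => by simp only [mul_def, map_smul, LinearMap.smul_apply])
    (fun a x y => by simp only [mul_def, map_smul])

theorem opOf_gen (i : Fin r) : opOf q Q (T q Q (gen i)) = leftOp q Q i :=
  op_ext q Q (opOf_comm q Q _) (leftOp_rightOp q Q i) (by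
    have h : (1 : SignedPerm r).len < (gen i * 1).len := by
      rw [len_gt_iff]; exact lo_lt_hi i
    rw [opOf_one, leftOp_T, if_pos h, mul_one])

/-- If `w = v_1 ⋯ v_l` is a reduced expression then `T_w = T_{v_1} ⋯ T_{v_l}`. -/
theorem T_reduced {l : List (Fin r)} {w : SignedPerm r} (h : w.IsReduced l) :
    T q Q w = (l.map fun i => T q Q (gen i)).prod := by
  have key : ∀ l : List (Fin r), (l.map fun i => T q Q (gen i)).prod =
      (l.map (leftOp q Q)).prod (T q Q 1) := by
    intro l
    induction l with
    | nil => rfl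
    | cons i l ih => rw [List.map_cons, List.prod_cons, ih, mul_def, opOf_gen]; rfl
  rw [key, word_T q Q h]

/-- The quadratic relations. -/
theorem T_gen_sq (i : Fin r) : T q Q (gen i) * T q Q (gen i) =
    algebraMap R _ (heckeParam q Q i) + algebraMap R _ ((heckeParam q Q i : R) - 1) * T q Q (gen i) := by
  have h : ¬ (gen i).len < (gen i * gen i).len := by
    rw [gen_mul_self, len_one]; omega
  rw [mul_def, opOf_gen, leftOp_T, if_neg h, gen_mul_self, Algebra.algebraMap_eq_smul_one,
    Algebra.algebraMap_eq_smul_one, smul_one_mul, one_def]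

end Hecke

end HeckeAlgebra

namespace QqSchur

open SignedPerm Hecke

section Elements

variable {R : Type*} [CommRing R] (q Q : Rˣ) (r : ℕ)

/-- The generator `s_i` of `W_r` for `0 ≤ i ≤ r - 1` (and `1` for other `i`, which do not occur). -/
def s (i : ℕ) : SignedPerm r := if h : i < r then gen ⟨i, h⟩ else 1

/-- `s_{i,j}` is `s_i s_{i+1} ⋯ s_{j-1}` if `i ≤ j`, and `s_{i-1} s_{i-2} ⋯ s_j` if `i > j`. -/
def sProd (i j : ℕ) : SignedPerm r :=
  if i ≤ j then ((List.range' i (j - i)).map (s r)).prod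
  else ((List.range' j (i - j)).reverse.map (s r)).prod

/-- `w_{a,r-a} = (s_{1,r})^a`. -/
def wShift (a : ℕ) : SignedPerm r := sProd r 1 r ^ a

/-- `u_a^+ = ∏_{i=1}^a (q^{i-1} + T_{i,1} T_0 T_{1,i})`. -/
noncomputable def uPlus (a : ℕ) : Hecke r q Q :=
  ((List.range' 1 a).map fun i => algebraMap R (Hecke r q Q) ((q : R) ^ (i - 1)) +
    T q Q (sProd r i 1) * T q Q (s r 0) * T q Q (sProd r 1 i)).prod

/-- `u_a^- = ∏_{i=1}^a (Q q^{i-1} - T_{i,1} T_0 T_{1,i})`. -/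
noncomputable def uMinus (a : ℕ) : Hecke r q Q :=
  ((List.range' 1 a).map fun i => algebraMap R (Hecke r q Q) ((Q : R) * (q : R) ^ (i - 1)) -
    T q Q (sProd r i 1) * T q Q (s r 0) * T q Q (sProd r 1 i)).prod

end Elements

/-- The set `Λ(n,r)` of bicompositions of `r` with `n` parts in total: pairs of compositions
(finite sequences of non-negative integers) with `n` entries altogether, of total sum `r`. The
components are `comp 0` and `comp 1`. -/
@[ext] structure Bicomp (n r : ℕ) where
  comp : Fin 2 → List ℕ
  parts : (comp 0).length + (comp 1).length = n
  size : (comp 0).sum + (comp 1).sum = r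

noncomputable instance (n r : ℕ) : DecidableEq (Bicomp n r) := Classical.decEq _

section Tableaux

variable {n r : ℕ} (la : Bicomp n r)

/-- `la` is an `a`-bicomposition of `r` for `a = la.a`. -/
def Bicomp.a : ℕ := (la.comp 0).sum

/-- `r - a` for an `a`-bicomposition. -/
def Bicomp.b : ℕ := (la.comp 1).sum

/-- The crosses of the diagram: component, row, column. -/
abbrev Cell : Type :=
  Σ k : Fin 2, Σ i : Fin (la.comp k).length, Fin ((la.comp k).get i)

/-- The position of a cell: component, row, column. -/
def Cell.comp {la : Bicomp n r} (c : Cell la) : ℕ := c.1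
/-- See `Cell.comp`. -/
def Cell.row {la : Bicomp n r} (c : Cell la) : ℕ := c.2.1
/-- See `Cell.comp`. -/
def Cell.col {la : Bicomp n r} (c : Cell la) : ℕ := c.2.2

/-- The filling that numbers the cells `1, 2, …, r` in the lexicographic order of the keys. -/
def fill (key : Cell la → ℕ ×ₗ ℕ ×ₗ ℕ) (c : Cell la) : ℤ :=
  (Finset.univ.filter fun d => key d ≤ key c).card

/-- `t^λ`: `1, …, a` by rows in the first component, then `a+1, …, r` by rows in the second. -/
def tRow : Cell la → ℤ := fill la fun c => toLex (c.comp, toLex (c.row, c.col))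

/-- `t̂^λ`: `1, …, r-a` by rows in the second component, then `r-a+1, …, r` by rows in the
first. -/
def tRowHat : Cell la → ℤ := fill la fun c => toLex (1 - c.comp, toLex (c.row, c.col))

/-- `t̂_λ`: `1, …, r-a` by columns in the second component, then `r-a+1, …, r` by columns in the
first. -/
def tColHat : Cell la → ℤ := fill la fun c => toLex (1 - c.comp, toLex (c.col, c.row))

/-- `w` stabilizes the rows of the bitableau `t`. -/
def StabRows (t : Cell la → ℤ) (w : SignedPerm r) : Prop :=
  ∀ c, ∃ d, d.comp = c.comp ∧ d.row = c.row ∧ w (t c) = t d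

/-- `w` stabilizes the columns of the bitableau `t`. -/
def StabCols (t : Cell la → ℤ) (w : SignedPerm r) : Prop :=
  ∀ c, ∃ d, d.comp = c.comp ∧ d.col = c.col ∧ w (t c) = t d

/-- The bitableau `t` is row standard: entries increase along rows, and those of the first
component are positive. -/
def RowStandard (t : Cell la → ℤ) : Prop :=
  (∀ c d : Cell la, c.comp = d.comp → c.row = d.row → c.col < d.col → t c < t d) ∧
    ∀ c : Cell la, c.comp = 0 → 0 < t c

variable {la}

theorem Cell.ext_pos {c d : Cell la} (h1 : c.comp = d.comp) (h2 : c.row = d.row)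
    (h3 : c.col = d.col) : c = d := by
  obtain ⟨k, i, j⟩ := c
  obtain ⟨k', i', j'⟩ := d
  obtain rfl : k = k' := Fin.ext h1
  obtain rfl : i = i' := Fin.ext h2
  obtain rfl : j = j' := Fin.ext h3
  rfl

theorem card_cell : Fintype.card (Cell la) = r := by
  have h : ∀ l : List ℕ, ∑ i : Fin l.length, l[(i : ℕ)] = l.sum := fun l => by
    rw [← List.sum_ofFn, List.ofFn_getElem]
  simp only [Fintype.card_sigma, Fintype.card_fin, Fin.sum_univ_two, List.get_eq_getElem, h]
  exact la.size

theorem fill_injective {key : Cell la → ℕ ×ₗ ℕ ×ₗ ℕ} (hk : Function.Injective key) :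
    Function.Injective (fill la key) := by
  have mono : ∀ c d, key c < key d → fill la key c < fill la key d := by
    intro c d h
    unfold fill
    rw [Nat.cast_lt]
    refine Finset.card_lt_card (Finset.ssubset_iff_subset_ne.mpr ⟨?_, fun he => ?_⟩)
    · intro x hx
      simp only [Finset.mem_filter, Finset.mem_univ, true_and] at hx ⊢
      exact hx.trans h.le
    · have : d ∈ Finset.univ.filter fun x => key x ≤ key d := by simp
      rw [← he] at this
      simp only [Finset.mem_filter, Finset.mem_univ, true_and] at this
      exact absurd this (not_le.mpr h)
  intro c d h
  rcases lt_trichotomy (key c) (key d) with hc | hc | hc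
  · exact absurd h (mono _ _ hc).ne
  · exact hk hc
  · exact absurd h (mono _ _ hc).ne'

theorem fill_mem (key : Cell la → ℕ ×ₗ ℕ ×ₗ ℕ) (c : Cell la) :
    1 ≤ fill la key c ∧ fill la key c ≤ r := by
  unfold fill
  constructor
  · have : 0 < (Finset.univ.filter fun d => key d ≤ key c).card :=
      Finset.card_pos.mpr ⟨c, by simp⟩
    omega
  · have := Finset.card_le_univ (Finset.univ.filter fun d => key d ≤ key c)
    rw [card_cell] at this
    exact_mod_cast this

/-- A bitableau whose entries are exactly `1, …, r`. -/
def IsFilling (t : Cell la → ℤ) : Prop :=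
  Function.Injective t ∧ ∀ z : ℤ, (∃ c, t c = z) ↔ 1 ≤ z ∧ z ≤ r

theorem isFilling_fill {key : Cell la → ℕ ×ₗ ℕ ×ₗ ℕ} (hk : Function.Injective key) :
    IsFilling (fill la key) := by
  refine ⟨fill_injective hk, fun z => ⟨fun ⟨c, hc⟩ => hc ▸ fill_mem key c, fun hz => ?_⟩⟩
  have h : Finset.univ.image (fill la key) = Finset.Icc (1 : ℤ) r := by
    refine Finset.eq_of_subset_of_card_le (fun x hx => ?_) ?_
    · obtain ⟨c, -, rfl⟩ := Finset.mem_image.mp hx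
      exact Finset.mem_Icc.mpr (fill_mem key c)
    · rw [Finset.card_image_of_injective _ (fill_injective hk), Finset.card_univ, card_cell]
      simp
  rw [← Finset.mem_Icc, ← h] at hz
  obtain ⟨c, -, hc⟩ := Finset.mem_image.mp hz
  exact ⟨c, hc⟩

theorem isFilling_tRow (la : Bicomp n r) : IsFilling (tRow la) :=
  isFilling_fill fun c d h => by
    simp only [EmbeddingLike.apply_eq_iff_eq, Prod.mk.injEq] at h
    exact Cell.ext_pos h.1 h.2.1 h.2.2

theorem isFilling_tRowHat (la : Bicomp n r) : IsFilling (tRowHat la) :=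
  isFilling_fill fun c d h => by
    simp only [EmbeddingLike.apply_eq_iff_eq, Prod.mk.injEq] at h
    have h1 : c.comp < 2 := c.1.2
    have h2 : d.comp < 2 := d.1.2
    exact Cell.ext_pos (by omega) h.2.1 h.2.2

theorem isFilling_tColHat (la : Bicomp n r) : IsFilling (tColHat la) :=
  isFilling_fill fun c d h => by
    simp only [EmbeddingLike.apply_eq_iff_eq, Prod.mk.injEq] at h
    have h1 : c.comp < 2 := c.1.2
    have h2 : d.comp < 2 := d.1.2
    exact Cell.ext_pos (by omega) h.2.2 h.2.1

open Classical in
/-- The function on `ℤ` that replaces the entries of `t` by those of `u`. -/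
noncomputable def replaceFun (t u : Cell la → ℤ) (z : ℤ) : ℤ :=
  if h : ∃ c, t c = z then u h.choose
  else if h : ∃ c, t c = -z then -u h.choose else z

theorem replaceFun_pos {t : Cell la → ℤ} (ht : Function.Injective t) (u : Cell la → ℤ)
    (c : Cell la) : replaceFun t u (t c) = u c := by
  have h : ∃ d, t d = t c := ⟨c, rfl⟩
  rw [replaceFun, dif_pos h, ht h.choose_spec]

theorem replaceFun_neg {t : Cell la → ℤ} (ht : IsFilling t) (u : Cell la → ℤ)
    (c : Cell la) : replaceFun t u (-t c) = -u c := by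
  have h0 := (ht.2 (t c)).mp ⟨c, rfl⟩
  have h1 : ¬ ∃ d, t d = -t c := fun hd => by
    have := (ht.2 _).mp hd
    omega
  have h : ∃ d, t d = - -t c := ⟨c, by simp⟩
  rw [replaceFun, dif_neg h1, dif_pos h]
  have := h.choose_spec.trans (neg_neg _)
  rw [ht.1 this]

theorem replaceFun_other {t : Cell la → ℤ} (ht : IsFilling t) (u : Cell la → ℤ) {z : ℤ}
    (hz : ¬ (1 ≤ z ∧ z ≤ r)) (hz' : ¬ (1 ≤ -z ∧ -z ≤ r)) : replaceFun t u z = z := by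
  rw [replaceFun, dif_neg (mt (ht.2 z).mp hz), dif_neg (mt (ht.2 (-z)).mp hz')]

theorem replaceFun_replaceFun {t u : Cell la → ℤ} (ht : IsFilling t) (hu : IsFilling u) (z : ℤ) :
    replaceFun u t (replaceFun t u z) = z := by
  by_cases h : 1 ≤ z ∧ z ≤ r
  · obtain ⟨c, rfl⟩ := (ht.2 z).mpr h
    rw [replaceFun_pos ht.1, replaceFun_pos hu.1]
  by_cases h' : 1 ≤ -z ∧ -z ≤ r
  · obtain ⟨c, hc⟩ := (ht.2 (-z)).mpr h'
    obtain rfl : z = -t c := by omega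
    rw [replaceFun_neg ht, replaceFun_neg hu]
  · rw [replaceFun_other ht u h h', replaceFun_other hu t h h']

theorem replaceFun_map_neg {t u : Cell la → ℤ} (ht : IsFilling t) (z : ℤ) :
    replaceFun t u (-z) = -replaceFun t u z := by
  by_cases h : 1 ≤ z ∧ z ≤ r
  · obtain ⟨c, rfl⟩ := (ht.2 z).mpr h
    rw [replaceFun_pos ht.1, replaceFun_neg ht]
  by_cases h' : 1 ≤ -z ∧ -z ≤ r
  · obtain ⟨c, hc⟩ := (ht.2 (-z)).mpr h'
    obtain rfl : z = -t c := by omega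
    rw [replaceFun_neg ht, neg_neg, neg_neg, replaceFun_pos ht.1]
  · rw [replaceFun_other ht u h h', replaceFun_other ht u h' (by rwa [neg_neg])]

theorem exists_transition {t u : Cell la → ℤ} (ht : IsFilling t) (hu : IsFilling u) :
    ∃! w : SignedPerm r, ∀ c, w (t c) = u c := by
  refine ⟨⟨⟨replaceFun t u, replaceFun u t, replaceFun_replaceFun ht hu,
    replaceFun_replaceFun hu ht⟩, replaceFun_map_neg ht, fun z hz => ?_⟩,
    fun c => replaceFun_pos ht.1 u c, fun w hw => ext_apply fun z => ?_⟩
  · rw [lt_abs] at hz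
    exact replaceFun_other ht u (by omega) (by omega)
  · change w z = replaceFun t u z
    by_cases h : 1 ≤ z ∧ z ≤ r
    · obtain ⟨c, rfl⟩ := (ht.2 z).mpr h
      rw [replaceFun_pos ht.1, hw]
    by_cases h' : 1 ≤ -z ∧ -z ≤ r
    · obtain ⟨c, hc⟩ := (ht.2 (-z)).mpr h'
      obtain rfl : z = -t c := by omega
      rw [replaceFun_neg ht, SignedPerm.map_neg, hw]
    · rw [replaceFun_other ht u h h']
      by_cases h0 : z = 0
      · rw [h0, SignedPerm.map_zero]
      · exact w.map_of_lt (by rw [lt_abs]; omega)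

/-- `π̂_λ`, the element of `W_r` with `t̂^λ π̂_λ = t̂_λ`. -/
noncomputable def piHat (la : Bicomp n r) : SignedPerm r :=
  (exists_transition (isFilling_tRowHat la) (isFilling_tColHat la)).choose

theorem piHat_spec (la : Bicomp n r) (c : Cell la) : piHat la (tRowHat la c) = tColHat la c :=
  (exists_transition (isFilling_tRowHat la) (isFilling_tColHat la)).choose_spec.1 c

/-- The bicomposition `ω = ((-),(1^r))`, with `n - r` zero parts appended to `(1^r)`. -/
def omegaBi {n r : ℕ} (hn : r ≤ n) : Bicomp n r where
  comp := ![[], List.replicate r 1 ++ List.replicate (n - r) 0]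
  parts := by simp; omega
  size := by simp

end Tableaux

section Schur

variable {R : Type*} [CommRing R] (q Q : Rˣ) {n r : ℕ}

open Classical in
/-- `x_λ = ∑ T_w`, over the `w` that stabilize the rows of `t^λ`. -/
noncomputable def xElt (la : Bicomp n r) : Hecke r q Q :=
  ∑ w : SignedPerm r with StabRows la (tRow la) w, T q Q w

open Classical in
/-- `ŷ_λ = ∑ (-q)^{-ℓ(w)} T_w`, over the `w` that stabilize the columns of `t̂_λ`. -/
noncomputable def yHat (la : Bicomp n r) : Hecke r q Q :=
  ∑ w : SignedPerm r with StabCols la (tColHat la) w,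
    (((-q)⁻¹ ^ w.len : Rˣ) : R) • T q Q w

/-- The right ideal `M^λ = u_a^+ x_λ H`. -/
noncomputable def permModule (la : Bicomp n r) : Submodule (Hecke r q Q)ᵐᵒᵖ (Hecke r q Q) :=
  Submodule.span _ {uPlus q Q r la.a * xElt q Q la}

theorem mem_permModule (la : Bicomp n r) (h : Hecke r q Q) :
    uPlus q Q r la.a * xElt q Q la * h ∈ permModule q Q la :=
  Submodule.smul_mem _ (MulOpposite.op h) (Submodule.mem_span_singleton_self _)

/-- The element `u_a^+ x_λ h` of `M^λ`. -/
noncomputable def permElt (la : Bicomp n r) (h : Hecke r q Q) : permModule q Q la :=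
  ⟨uPlus q Q r la.a * xElt q Q la * h, mem_permModule q Q la h⟩

/-- `(Q,q)`-tensor space `E = ⨁_{λ ∈ Λ(n,r)} M^λ`, a right `H`-module. -/
abbrev TensorSpace (n r : ℕ) {R : Type*} [CommRing R] (q Q : Rˣ) : Type _ :=
  DirectSum (Bicomp n r) fun la => permModule q Q la

/-- The `(Q,q)`-Schur algebra `S = End_H(E)`. -/
abbrev SchurAlgebra (n r : ℕ) {R : Type*} [CommRing R] (q Q : Rˣ) : Type _ :=
  Module.End (Hecke r q Q)ᵐᵒᵖ (TensorSpace n r q Q)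

/-- The element `u_a^+ x_λ h` of `M^λ`, as an element of `E`. -/
noncomputable def inTensor (la : Bicomp n r) (h : Hecke r q Q) : TensorSpace n r q Q :=
  DirectSum.lof (Hecke r q Q)ᵐᵒᵖ (Bicomp n r) (fun la => permModule q Q la) la (permElt q Q la h)

/-- The bitabloid `{t^λ w} = u_a^+ x_λ T_w`, where `t^λ w` is row standard. -/
noncomputable def tabloid (la : Bicomp n r) (w : SignedPerm r) : TensorSpace n r q Q :=
  inTensor q Q la (T q Q w)

/-- The defining property of the bilinear form `⟨ , ⟩` on `E`: distinct bitabloids are orthogonal,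
and `⟨{t},{t}⟩ = q_w` if `t = t^λ w` is row standard. -/
def IsTensorForm (B : LinearMap.BilinForm R (TensorSpace n r q Q)) : Prop :=
  ∀ (la mu : Bicomp n r) (v w : SignedPerm r),
    RowStandard la (fun c => v (tRow la c)) → RowStandard mu (fun c => w (tRow mu c)) →
    ((la = mu ∧ v = w) → B (tabloid q Q la v) (tabloid q Q mu w) = (qLen q Q w : R)) ∧
    (¬ (la = mu ∧ v = w) → B (tabloid q Q la v) (tabloid q Q mu w) = 0)

/-- `z_λ = u_a^+ x_λ h_{a,r-a} T_{π̂_λ} u_{r-a}^- ŷ_λ`, an element of `M^λ ⊆ E`. -/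
noncomputable def zElt (la : Bicomp n r) : TensorSpace n r q Q :=
  inTensor q Q la (T q Q (wShift r la.a) * T q Q (piHat la) * uMinus q Q r la.b * yHat q Q la)

/-- The Weyl module `W^λ = S z_λ`. -/
noncomputable def weylModule (la : Bicomp n r) :
    Submodule (SchurAlgebra n r q Q) (TensorSpace n r q Q) :=
  Submodule.span _ {zElt q Q la}

variable (hn : r ≤ n)

/-- An element `h` of `H = M^ω`, as an element of `E`; note that `u_0^+ x_ω = 1`. -/
noncomputable def ofHecke (h : Hecke r q Q) : TensorSpace n r q Q :=
  inTensor q Q (omegaBi hn) h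

/-- `u_{r-a}^- ŷ_λ ∈ H = M^ω ⊆ E`. -/
noncomputable def lGen (la : Bicomp n r) : TensorSpace n r q Q :=
  ofHecke q Q hn (uMinus q Q r la.b * yHat q Q la)

/-- `L^λ = S u_{r-a}^- ŷ_λ`. -/
noncomputable def lModule (la : Bicomp n r) :
    Submodule (SchurAlgebra n r q Q) (TensorSpace n r q Q) :=
  Submodule.span _ {lGen q Q hn la}

/-- The generator `u_{r-a}^- ŷ_λ` as an element of `L^λ`. -/
noncomputable def lGen' (la : Bicomp n r) : lModule q Q hn la :=
  ⟨lGen q Q hn la, Submodule.mem_span_singleton_self _⟩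

/-- `C` is obtained by contracting the form `B` on `E`:
`≪ s₁ u_{r-a}^- ŷ_λ , s₂ u_{r-a}^- ŷ_λ ≫ = ⟨ s₁ φ_{ω,ω} , s₂ u_{r-a}^- ŷ_λ ⟩`, where `S φ_{ω,ω}` is
identified with `E` through `s φ_{ω,ω} ↦ s(1)`, with `1 ∈ H = M^ω`. -/
def IsContractedForm (la : Bicomp n r) (B : LinearMap.BilinForm R (TensorSpace n r q Q))
    (C : LinearMap.BilinForm R (lModule q Q hn la)) : Prop :=
  ∀ s₁ s₂ : SchurAlgebra n r q Q,
    C (s₁ • lGen' q Q hn la) (s₂ • lGen' q Q hn la) =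
      B (s₁ • ofHecke q Q hn 1) (s₂ • lGen q Q hn la)

theorem omegaBi_part (k : Fin 2) (i : Fin ((omegaBi hn).comp k).length) :
    ((omegaBi hn).comp k).get i ≤ 1 := by
  have h : ((omegaBi hn).comp k).get i ∈ (omegaBi hn).comp k := List.get_mem _ _
  revert h
  generalize ((omegaBi hn).comp k).get i = m
  intro h
  fin_cases k
  · simp [omegaBi] at h
  · simp [omegaBi] at h
    omega

theorem stabRows_omega (w : SignedPerm r) :
    StabRows (omegaBi hn) (tRow (omegaBi hn)) w ↔ w = 1 := by
  constructor
  · intro h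
    have h1 : ∀ c, w (tRow (omegaBi hn) c) = tRow (omegaBi hn) c := by
      intro c
      obtain ⟨d, hd1, hd2, hd3⟩ := h c
      have hcol : ∀ e : Cell (omegaBi hn), e.col = 0 := fun e => by
        have h1 : e.col < ((omegaBi hn).comp e.1).get e.2.1 := e.2.2.2
        have := omegaBi_part hn e.1 e.2.1
        omega
      have : d = c := Cell.ext_pos hd1 hd2 (by rw [hcol, hcol])
      rw [hd3, this]
    have hu := exists_transition (isFilling_tRow (omegaBi hn)) (isFilling_tRow (omegaBi hn))
    exact hu.unique h1 (fun _ => rfl)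
  · rintro rfl c
    exact ⟨c, rfl, rfl, rfl⟩

/-- `u_0^+ x_ω = 1`, so that `M^ω = H`. -/
theorem omega_generator : uPlus q Q r (omegaBi hn).a * xElt q Q (omegaBi hn) = 1 := by
  have h1 : (omegaBi hn).a = 0 := by simp [omegaBi, Bicomp.a]
  rw [h1, uPlus, List.range'_zero, List.map_nil, List.prod_nil, one_mul, xElt]
  simp only [stabRows_omega]
  rw [Finset.filter_eq' Finset.univ (1 : SignedPerm r), if_pos (Finset.mem_univ _),
    Finset.sum_singleton]
  rfl

theorem permModule_omega : permModule q Q (omegaBi hn) = ⊤ := by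
  rw [eq_top_iff]
  intro h _
  have := mem_permModule q Q (omegaBi hn) h
  rwa [omega_generator, one_mul] at this

/-- The map `φ_{λ,ω} ∈ S`: premultiplication of `H = M^ω` by `u_a^+ x_λ`, and zero on `M^μ` for
`μ ≠ ω`. -/
noncomputable def phi (la : Bicomp n r) : SchurAlgebra n r q Q :=
  DirectSum.lof (Hecke r q Q)ᵐᵒᵖ (Bicomp n r) (fun la => permModule q Q la) la ∘ₗ
    ({ toFun := fun m => permElt q Q la (m : Hecke r q Q)
       map_add' := fun _ _ => Subtype.ext (mul_add _ _ _)
       map_smul' := fun _ _ => Subtype.ext (mul_assoc _ _ _).symm } :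
      permModule q Q (omegaBi hn) →ₗ[(Hecke r q Q)ᵐᵒᵖ] permModule q Q la) ∘ₗ
    DirectSum.component (Hecke r q Q)ᵐᵒᵖ (Bicomp n r) (fun la => permModule q Q la) (omegaBi hn)

theorem phi_ofHecke (la : Bicomp n r) (h : Hecke r q Q) :
    phi q Q hn la • ofHecke q Q hn h = inTensor q Q la h := by
  change phi q Q hn la (ofHecke q Q hn h) = _
  unfold phi ofHecke inTensor
  rw [LinearMap.comp_apply, LinearMap.comp_apply, DirectSum.component.lof_self]
  congr 1
  apply Subtype.ext
  change _ * (_ * _) = _ * _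
  rw [omega_generator, one_mul]

/-- `W^λ ⊆ L^λ`. -/
theorem weylModule_le (la : Bicomp n r) : weylModule q Q la ≤ lModule q Q hn la := by
  rw [weylModule, Submodule.span_singleton_le_iff_mem]
  -- left multiplication by `h_{a,r-a} T_{π̂}` on the component `M^ω = H` of `E`
  let m : permModule q Q (omegaBi hn) →ₗ[(Hecke r q Q)ᵐᵒᵖ] permModule q Q (omegaBi hn) :=
    { toFun := fun x => permElt q Q (omegaBi hn)
        (T q Q (wShift r la.a) * T q Q (piHat la) * (x : Hecke r q Q))
      map_add' := fun x y => Subtype.ext (by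
        change _ * (_ * (_ + _)) = _ * _ + _ * _
        rw [mul_add, mul_add])
      map_smul' := fun h x => Subtype.ext (by
        change _ * (_ * (_ * _)) = (_ * _) * _
        simp only [mul_assoc, RingHom.id_apply]) }
  let t : SchurAlgebra n r q Q :=
    DirectSum.lof (Hecke r q Q)ᵐᵒᵖ (Bicomp n r) (fun la => permModule q Q la) (omegaBi hn) ∘ₗ m ∘ₗ
    DirectSum.component (Hecke r q Q)ᵐᵒᵖ (Bicomp n r) (fun la => permModule q Q la) (omegaBi hn)
  have ht : ∀ h, t • ofHecke q Q hn h =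
      ofHecke q Q hn (T q Q (wShift r la.a) * T q Q (piHat la) * h) := by
    intro h
    change t (ofHecke q Q hn h) = _
    unfold ofHecke inTensor
    rw [LinearMap.comp_apply, LinearMap.comp_apply, DirectSum.component.lof_self]
    congr 1
    apply Subtype.ext
    change _ * (_ * (_ * _)) = _ * (_ * _)
    rw [omega_generator, one_mul, one_mul, one_mul]
  have : zElt q Q la = phi q Q hn la • t • lGen q Q hn la := by
    rw [lGen, ht, phi_ofHecke, zElt]
    simp only [mul_assoc]
  rw [this]
  exact Submodule.smul_mem _ _ (Submodule.smul_mem _ _ (Submodule.mem_span_singleton_self _))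

end Schur

end QqSchur

/-!
The theorem is a version of James's submodule theorem, and its proof has three ingredients.

*The form on tensor space.* On the Hecke algebra `H` put `(T_v, T_w) = q_w` if `v = w` and `0`
otherwise; for this form the anti-involution `T_w ↦ T_{w⁻¹}` gives adjoints of left and of right
multiplications (`heckeForm_mul_left`, `heckeForm_mul_right`). The generator `x = u_a^+ x_λ` of
`M^λ` is fixed by the anti-involution, so `⟨x h, x k⟩ = q^{-a(a-1)/2} (x h, k)` is well defined on
`M^λ = x H`. It has the prescribed values on bitabloids because, for `w` positive on `1, …, a`, the
only term `T_v` of `u_a^+ T_w` with `v` positive on `1, …, a` is `q^{a(a-1)/2} T_w`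
(`coord_uGen_mul`), and it is unique because the bitabloids span (`exists_rowStandard`). By
construction `⟨e h, f⟩ = ⟨e, f h*⟩` for `h ∈ H`, and the form is non-degenerate. Hence homomorphisms
`M^λ → E` have adjoints `E → M^λ`, which are homomorphisms too (`exists_adjoint`). Moreover
`y = u_{r-a}^- ŷ_λ` is fixed by the anti-involution, so `⟨s₁(1), s₂ y⟩ = ⟨s₁ y, s₂(1)⟩`, and the
contracted form is well defined.

*The space `x H y` is spanned by `z_λ`* (`exists_smul_eq`). By induction on `ℓ(w)`, the product
`x T_w y` is a multiple of `z_λ`. If `w` has a negative value on `1, …, a`, or `w⁻¹` on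
`1, …, r-a`, or `t^λ w` is not row increasing, or `t̂_λ w⁻¹` is not column increasing, then `x T_w`
or `T_w y` can be rewritten with shorter elements. Otherwise, if `w` maps some element of
`1, …, a` into `1, …, r-a`, then `u_a^+ T_w u_{r-a}^- = 0` because `(1 + T_0)(Q - T_0) = 0`
(`uPlus_mul_T_mul_uMinus`); if `w` carries two entries of a row of `t^λ` to entries of one column
of `t̂_λ`, then the product vanishes because `(1 + T_i)(1 - q⁻¹ T_i) = 0`; and if neither happens,
counting columns shows that `w = w_{a,r-a} π̂_λ` (`cell_perm_eq_id`).

*The dichotomy* (`submodule_dichotomy`). An element of `U ⊆ L^λ` has the form `e y` with `e ∈ E`, so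
a homomorphism `E → M^λ` maps it into `x H y`, the line of `z_λ`. If some homomorphism is non-zero
on `U`, then `z_λ ∈ U`. If not, let `t y = z_λ` with `t(1) = x k`; then
`≪s z_λ, u≫ = ⟨s(x k), u⟩ = ⟨x k, s* u⟩ = 0` for `u ∈ U`, where `s*` is the adjoint of the
restriction of `s` to `M^λ`.

All commutation relations in `H` are instances of `T_gen_mul_T_of_map`, so the braid relations are
never used separately.
-/

namespace QqSchur

open SignedPerm Hecke

/-! ### The anti-involution and the canonical form of the Hecke algebra -/

section Basics

variable {R : Type*} [CommRing R] (q Q : Rˣ) {r : ℕ}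

theorem T_induction {p : Hecke r q Q → Prop} (hT : ∀ w, p (T q Q w))
    (hadd : ∀ x y, p x → p y → p (x + y)) (hsmul : ∀ (a : R) x, p x → p (a • x))
    (x : Hecke r q Q) : p x := by
  have h0 : p 0 := by simpa using hsmul 0 _ (hT 1)
  have hx : x ∈ Submodule.span R (Set.range (basis q Q : SignedPerm r → Hecke r q Q)) := by
    rw [Module.Basis.span_eq]; trivial
  induction hx using Submodule.span_induction with
  | mem x h => obtain ⟨w, rfl⟩ := h; exact hT w
  | zero => exact h0
  | add x y _ _ hx hy => exact hadd x y hx hy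
  | smul a x _ hx => exact hsmul a x hx

theorem mul_T_gen (x : Hecke r q Q) (i : Fin r) : x * T q Q (gen i) = rightOp q Q i x := by
  have h := opOf_comm q Q x i (T q Q 1)
  rw [opOf_one, rightOp_T, one_mul, if_pos (by
    rw [len_one]
    have := (len_gt_iff i 1).mpr (lo_lt_hi i)
    rw [mul_one] at this
    omega)] at h
  exact h

theorem T_gen_mul (x : Hecke r q Q) (i : Fin r) : T q Q (gen i) * x = leftOp q Q i x := by
  rw [mul_def, opOf_gen]

theorem T_gen_mul_T {i : Fin r} {w : SignedPerm r} (h : w (lo i) < w (hi i)) :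
    T q Q (gen i) * T q Q w = T q Q (gen i * w) := by
  rw [T_gen_mul, leftOp_T, if_pos ((len_gt_iff i w).mpr h)]

theorem T_mul_T_gen {i : Fin r} {w : SignedPerm r} (h : w⁻¹ (lo i) < w⁻¹ (hi i)) :
    T q Q w * T q Q (gen i) = T q Q (w * gen i) := by
  rw [mul_T_gen, rightOp_T, if_pos ((len_mul_gen_gt_iff w i).mpr h)]

theorem T_one : T q Q (1 : SignedPerm r) = 1 := rfl

theorem T_eq_gen_mul {i : Fin r} {w : SignedPerm r} (h : w (hi i) < w (lo i)) :
    T q Q w = T q Q (gen i) * T q Q (gen i * w) := by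
  rw [T_gen_mul_T, gen_mul_cancel]
  simpa [gen_lo, gen_hi] using h

/-- If `v` carries the pair exchanged by `s_i` to the pair exchanged by `s_j`, in the same order,
then `T_i T_v = T_v T_j`. All commutation relations that are needed are of this form. -/
theorem T_gen_mul_T_of_map {i j : Fin r} {v : SignedPerm r} (h1 : v (lo i) = lo j)
    (h2 : v (hi i) = hi j) : T q Q (gen i) * T q Q v = T q Q v * T q Q (gen j) := by
  rw [T_gen_mul_T, T_mul_T_gen, conj_of_map (Or.inl ⟨h1, h2⟩)]
  · rw [← h1, ← h2, inv_apply_self, inv_apply_self]; exact lo_lt_hi i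
  · rw [h1, h2]; exact lo_lt_hi j

theorem qLen_gen_mul {i : Fin r} {w : SignedPerm r} (h : w.len < (gen i * w).len) :
    qLen q Q (gen i * w) = heckeParam q Q i * qLen q Q w := by
  have h1 := redWord_spec w
  have h2 : IsReduced (i :: w.redWord) (gen i * w) := by
    refine ⟨by rw [List.map_cons, List.prod_cons, h1.1], ?_⟩
    have := len_gen_mul_le i w
    rw [List.length_cons, h1.2]
    omega
  rw [qLen_eq q Q h2, List.map_cons, List.prod_cons, qLen_eq q Q h1]

theorem qLen_inv (w : SignedPerm r) : qLen q Q w⁻¹ = qLen q Q w := by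
  have h1 := redWord_spec w
  have h2 : IsReduced w.redWord.reverse w⁻¹ := by
    refine ⟨?_, by rw [List.length_reverse, h1.2, len_inv]⟩
    conv_rhs => rw [← h1.1]
    rw [List.prod_inv_reverse, List.map_reverse, List.map_map]
    congr 2
    exact List.map_congr_left fun i _ => (gen_inv i).symm
  rw [qLen_eq q Q h2, qLen_eq q Q h1, List.map_reverse, List.prod_reverse]

/-- The anti-involution of the Hecke algebra with `T_w ↦ T_{w⁻¹}`, as a linear map. -/
noncomputable def heckeStar : Hecke r q Q →ₗ[R] Hecke r q Q :=
  (basis q Q).constr R fun w => T q Q w⁻¹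

@[simp] theorem heckeStar_T (w : SignedPerm r) : heckeStar q Q (T q Q w) = T q Q w⁻¹ := by
  rw [← basis_apply, heckeStar, Module.Basis.constr_basis]

@[simp] theorem heckeStar_heckeStar (x : Hecke r q Q) : heckeStar q Q (heckeStar q Q x) = x := by
  induction x using T_induction with
  | hT w => simp
  | hadd x y hx hy => rw [map_add, map_add, hx, hy]
  | hsmul a x hx => rw [map_smul, map_smul, hx]

@[simp] theorem heckeStar_one : heckeStar q Q (1 : Hecke r q Q) = 1 := by
  rw [← T_one, heckeStar_T, inv_one]

@[simp] theorem heckeStar_algebraMap (c : R) :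
    heckeStar q Q (algebraMap R (Hecke r q Q) c) = algebraMap R (Hecke r q Q) c := by
  rw [Algebra.algebraMap_eq_smul_one, map_smul, heckeStar_one]

theorem heckeStar_gen_mul (i : Fin r) (x : Hecke r q Q) :
    heckeStar q Q (T q Q (gen i) * x) = heckeStar q Q x * T q Q (gen i) := by
  induction x using T_induction with
  | hT w =>
    have h : w⁻¹.len < (w⁻¹ * gen i).len ↔ w.len < (gen i * w).len := by
      rw [len_inv, ← len_inv (w⁻¹ * gen i), mul_inv_rev, inv_inv, gen_inv]
    rw [T_gen_mul, leftOp_T, heckeStar_T, mul_T_gen, rightOp_T]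
    simp only [h]
    split_ifs
    · simp
    · simp
  | hadd x y hx hy => rw [mul_add, map_add, hx, hy, map_add, add_mul]
  | hsmul a x hx => rw [mul_smul_comm, map_smul, hx, map_smul, smul_mul_assoc]

/-- Induction on an element of the Hecke algebra by multiplying by generators on the left. -/
theorem T_left_induction {p : Hecke r q Q → Prop} (h1 : p 1)
    (hgen : ∀ i x, p x → p (T q Q (gen i) * x))
    (hadd : ∀ x y, p x → p y → p (x + y)) (hsmul : ∀ (a : R) x, p x → p (a • x))
    (x : Hecke r q Q) : p x := by
  refine T_induction q Q (fun w => ?_) hadd hsmul x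
  rw [T_reduced q Q (redWord_spec w)]
  induction w.redWord with
  | nil => exact h1
  | cons i l ih => rw [List.map_cons, List.prod_cons]; exact hgen i _ ih

theorem heckeStar_mul (x y : Hecke r q Q) :
    heckeStar q Q (x * y) = heckeStar q Q y * heckeStar q Q x := by
  induction x using T_left_induction with
  | h1 => simp
  | hgen i x hx => rw [mul_assoc, heckeStar_gen_mul, hx, heckeStar_gen_mul, mul_assoc]
  | hadd x z hx hz => rw [add_mul, map_add, hx, hz, map_add, mul_add]
  | hsmul a x hx => rw [smul_mul_assoc, map_smul, hx, map_smul, mul_smul_comm]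

/-- The bilinear form on the Hecke algebra in which the `T_w` are orthogonal and `(T_w, T_w)` is
`q_w`. -/
noncomputable def heckeForm : Hecke r q Q →ₗ[R] Hecke r q Q →ₗ[R] R :=
  (basis q Q).constr R fun w => (qLen q Q w : R) • (basis q Q).coord w

theorem heckeForm_T (w : SignedPerm r) (y : Hecke r q Q) :
    heckeForm q Q (T q Q w) y = (qLen q Q w : R) * (basis q Q).coord w y := by
  rw [← basis_apply, heckeForm, Module.Basis.constr_basis]; rfl

theorem coord_T (v w : SignedPerm r) :
    (basis q Q).coord v (T q Q w) = if v = w then 1 else 0 := by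
  rw [← basis_apply, Module.Basis.coord_apply, Module.Basis.repr_self, Finsupp.single_apply]
  simp only [eq_comm]

theorem heckeForm_T_T (v w : SignedPerm r) :
    heckeForm q Q (T q Q v) (T q Q w) = if v = w then (qLen q Q v : R) else 0 := by
  rw [heckeForm_T, coord_T]; split_ifs <;> simp

theorem heckeForm_comm (x y : Hecke r q Q) : heckeForm q Q x y = heckeForm q Q y x := by
  induction x using T_induction with
  | hT v =>
    induction y using T_induction with
    | hT w =>
      rw [heckeForm_T_T, heckeForm_T_T]
      by_cases h : v = w
      · rw [h]
      · rw [if_neg h, if_neg (Ne.symm h)]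
    | hadd x y hx hy => simp only [map_add, LinearMap.add_apply, hx, hy]
    | hsmul a x hx => simp only [map_smul, LinearMap.smul_apply, hx]
  | hadd x y hx hy => simp only [map_add, LinearMap.add_apply, hx, hy]
  | hsmul a x hx => simp only [map_smul, LinearMap.smul_apply, hx]

theorem heckeForm_nondeg {x : Hecke r q Q} (h : ∀ y, heckeForm q Q y x = 0) : x = 0 := by
  refine (basis q Q).ext_elem fun w => ?_
  have := h (T q Q w)
  rw [heckeForm_T, Units.mul_right_eq_zero] at this
  rw [_root_.map_zero]
  exact this

theorem heckeForm_star (x y : Hecke r q Q) :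
    heckeForm q Q (heckeStar q Q x) (heckeStar q Q y) = heckeForm q Q x y := by
  induction x using T_induction with
  | hT v =>
    induction y using T_induction with
    | hT w => simp only [heckeStar_T, heckeForm_T_T, inv_inj, qLen_inv]
    | hadd x y hx hy => simp only [map_add, hx, hy]
    | hsmul a x hx => simp only [map_smul, hx]
  | hadd x y hx hy => simp only [map_add, LinearMap.add_apply, hx, hy]
  | hsmul a x hx => simp only [map_smul, LinearMap.smul_apply, hx]

theorem heckeForm_gen_mul (i : Fin r) (x y : Hecke r q Q) :
    heckeForm q Q (T q Q (gen i) * x) y = heckeForm q Q x (T q Q (gen i) * y) := by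
  induction x using T_induction with
  | hadd x y hx hy => simp only [mul_add, map_add, LinearMap.add_apply, hx, hy]
  | hsmul a x hx => simp only [mul_smul_comm, map_smul, LinearMap.smul_apply, hx]
  | hT v =>
  induction y using T_induction with
  | hadd x y hx hy => simp only [mul_add, map_add, hx, hy]
  | hsmul a x hx => simp only [mul_smul_comm, map_smul, hx]
  | hT w =>
  have hinj : gen i * v = w ↔ v = gen i * w :=
    ⟨fun h => by rw [← h, gen_mul_cancel], fun h => by rw [h, gen_mul_cancel]⟩
  rw [T_gen_mul, T_gen_mul, leftOp_T, leftOp_T]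
  by_cases hvw : v = gen i * w
  · subst hvw
    have hne : (gen i * w) ≠ w := fun h => by
      have := congrArg (fun u : SignedPerm r => u (w⁻¹ 1)) h
      have h2 := congrArg (fun u => u * w⁻¹) h
      simp only [mul_assoc, mul_inv_cancel, mul_one] at h2
      have h3 := gen_lo i
      rw [h2, one_apply] at h3
      exact (lo_lt_hi i).ne h3
    rw [gen_mul_cancel]
    by_cases h : w.len < (gen i * w).len
    · have h' : ¬ (gen i * w).len < w.len := by omega
      rw [if_neg h', if_pos h]
      simp only [map_add, map_smul, heckeForm_T_T, if_pos, if_neg hne, mul_zero, add_zero,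
        LinearMap.add_apply, LinearMap.smul_apply, qLen_gen_mul q Q h, Units.val_mul, smul_eq_mul]
    · have h' : (gen i * w).len < (gen i * (gen i * w)).len := by
        rw [gen_mul_cancel]
        have := (len_gt_iff i w).not.mp h
        refine len_lt_of_desc (lt_of_le_of_ne (not_lt.mp this) fun hc => ?_)
        exact (lo_lt_hi i).ne' (w.injective hc)
      have hq := qLen_gen_mul q Q h'
      rw [gen_mul_cancel] at hq h'
      rw [if_pos h', if_neg h]
      simp only [map_add, map_smul, heckeForm_T_T, if_pos, if_neg hne, mul_zero, add_zero, hq,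
        Units.val_mul, smul_eq_mul]
  · have h1 : ¬ gen i * v = w := fun h => hvw (hinj.mp h)
    by_cases hw : v = w
    · subst hw
      rw [heckeForm_comm]
    · split_ifs <;> simp only [map_add, map_smul, LinearMap.add_apply, LinearMap.smul_apply,
        heckeForm_T_T, if_neg h1, if_neg hvw, if_neg hw, smul_zero, add_zero]

theorem heckeForm_mul_left (h x y : Hecke r q Q) :
    heckeForm q Q (h * x) y = heckeForm q Q x (heckeStar q Q h * y) := by
  induction h using T_left_induction generalizing y with
  | h1 => simp
  | hgen i h hh => rw [mul_assoc, heckeForm_gen_mul, hh, heckeStar_gen_mul, mul_assoc]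
  | hadd g h hg hh => simp only [add_mul, map_add, LinearMap.add_apply, hg, hh]
  | hsmul a h hh => simp only [smul_mul_assoc, map_smul, LinearMap.smul_apply, hh]

theorem heckeForm_mul_right (h x y : Hecke r q Q) :
    heckeForm q Q (x * h) y = heckeForm q Q x (y * heckeStar q Q h) := by
  rw [← heckeForm_star, heckeStar_mul, heckeForm_mul_left, ← heckeForm_star q Q _ (_ * _)]
  simp only [heckeStar_mul, heckeStar_heckeStar]

/-- The span of the `T_w` for which `P w` holds. -/
noncomputable def spanT (P : SignedPerm r → Prop) : Submodule R (Hecke r q Q) :=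
  Submodule.span R (T q Q '' {w | P w})

variable {q Q} {P P' : SignedPerm r → Prop}

theorem T_mem_spanT {w : SignedPerm r} (h : P w) : T q Q w ∈ spanT q Q P :=
  Submodule.subset_span ⟨w, h, rfl⟩

theorem map_mem_of_mem_spanT {M : Type*} [AddCommMonoid M] [Module R M] (f : Hecke r q Q →ₗ[R] M)
    (N : Submodule R M) (h : ∀ w, P w → f (T q Q w) ∈ N) {x : Hecke r q Q}
    (hx : x ∈ spanT q Q P) : f x ∈ N := by
  have : spanT q Q P ≤ N.comap f := by
    rw [spanT, Submodule.span_le]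
    rintro _ ⟨w, hw, rfl⟩
    exact h w hw
  exact this hx

theorem spanT_mono (h : ∀ w, P w → P' w) : spanT q Q P ≤ spanT q Q P' :=
  Submodule.span_mono (Set.image_mono h)

theorem gen_mul_mem_spanT {i : Fin r} (h : ∀ w, P w → P' (gen i * w))
    (h' : ∀ w, P w → w (hi i) < w (lo i) → P' w) {x : Hecke r q Q}
    (hx : x ∈ spanT q Q P) : T q Q (gen i) * x ∈ spanT q Q P' := by
  refine map_mem_of_mem_spanT (LinearMap.mulLeft R (T q Q (gen i))) _ (fun w hw => ?_) hx
  rw [LinearMap.mulLeft_apply]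
  by_cases hc : w (lo i) < w (hi i)
  · rw [T_gen_mul_T q Q hc]
    exact T_mem_spanT (h w hw)
  · have hd : w (hi i) < w (lo i) :=
      lt_of_le_of_ne (not_lt.mp hc) fun he => (lo_lt_hi i).ne' (w.injective he)
    rw [T_gen_mul, leftOp_T, if_neg ((len_gt_iff i w).not.mpr hc)]
    exact Submodule.add_mem _ (Submodule.smul_mem _ _ (T_mem_spanT (h w hw)))
      (Submodule.smul_mem _ _ (T_mem_spanT (h' w hw hd)))

theorem coord_of_mem_spanT {x : Hecke r q Q} (hx : x ∈ spanT q Q P) {v : SignedPerm r}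
    (hv : ¬ P v) : (basis q Q).coord v x = 0 := by
  refine (Submodule.mem_bot R).mp (map_mem_of_mem_spanT ((basis q Q).coord v) ⊥ (fun w hw => ?_) hx)
  rw [coord_T, if_neg (show ¬ v = w from fun he => hv (he ▸ hw))]
  exact Submodule.zero_mem _

theorem star_mem_spanT_len {k : ℕ} {x : Hecke r q Q} (hx : x ∈ spanT q Q fun w => w.len < k) :
    heckeStar q Q x ∈ spanT q Q fun w => w.len < k := by
  refine map_mem_of_mem_spanT (heckeStar q Q) _ (fun w hw => ?_) hx
  rw [heckeStar_T]
  exact T_mem_spanT (by rwa [len_inv])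

end Basics

/-! ### The elements `u_a^+` and `u_a^-` -/

section UElements

variable {r : ℕ}

theorem s_eq_gen {i : ℕ} (h : i < r) : s r i = gen ⟨i, h⟩ := dif_pos h

theorem lo_of_pos {i : Fin r} (h : 1 ≤ (i : ℕ)) : lo i = i := if_neg (by omega)

theorem lo_of_zero {i : Fin r} (h : (i : ℕ) = 0) : lo i = -1 := if_pos h

theorem hi_of_zero {i : Fin r} (h : (i : ℕ) = 0) : hi i = 1 := by simp [hi, h]

theorem hi_eq (i : Fin r) : hi i = i + 1 := rfl

theorem gen_apply_of_ne {i : Fin r} {z : ℤ} (h1 : |z| ≠ i) (h2 : |z| ≠ i + 1) : gen i z = z := by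
  rw [gen_apply]
  unfold lo hi
  split_ifs <;> grind

theorem gen_zero_apply {i : Fin r} (h : (i : ℕ) = 0) (z : ℤ) :
    gen i z = if z = 1 ∨ z = -1 then -z else z := by
  rw [gen_apply, lo_of_zero h, hi_of_zero h]
  split_ifs <;> omega

theorem gen_pos_apply {i : Fin r} (h : 1 ≤ (i : ℕ)) (z : ℤ) :
    gen i z = if z = i then (i : ℤ) + 1 else if z = i + 1 then (i : ℤ) else
      if z = -i then -((i : ℤ) + 1) else if z = -(i + 1) then -(i : ℤ) else z := by
  rw [gen_apply, lo_of_pos h, hi_eq]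

/-- The sign change of `k + 1`, as a product of generators. -/
def signChange (r : ℕ) : ℕ → SignedPerm r
  | 0 => s r 0
  | k + 1 => s r (k + 1) * signChange r k * s r (k + 1)

theorem signChange_apply {k : ℕ} (hk : k < r) (z : ℤ) :
    signChange r k z = if z = k + 1 ∨ z = -(k + 1) then -z else z := by
  induction k generalizing z with
  | zero => rw [signChange, s_eq_gen hk, gen_zero_apply rfl]; simp
  | succ k ih =>
    rw [signChange, s_eq_gen hk, mul_apply, mul_apply, ih (by omega)]
    simp only [gen_pos_apply (i := ⟨k + 1, hk⟩) (by simp)]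
    push_cast
    split_ifs <;> omega

theorem signChange_inv {k : ℕ} (hk : k < r) : (signChange r k)⁻¹ = signChange r k := by
  refine inv_eq_of_mul_eq_one_left (ext_apply fun z => ?_)
  rw [mul_apply, signChange_apply hk, signChange_apply hk, one_apply]
  split_ifs <;> omega

variable {R : Type*} [CommRing R] (q Q : Rˣ)

/-- `T_{k+2,1} T_0 T_{1,k+2} = T_{k+1} (T_{k+1,1} T_0 T_{1,k+1}) T_{k+1}`, where `T_i = T_{s_i}`. -/
theorem T_signChange_succ {k : ℕ} (hk : k + 1 < r) : T q Q (signChange r (k + 1)) =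
    T q Q (gen ⟨k + 1, hk⟩) * T q Q (signChange r k) * T q Q (gen ⟨k + 1, hk⟩) := by
  have hlo : lo (⟨k + 1, hk⟩ : Fin r) = k + 1 := by rw [lo_of_pos (by simp)]; simp
  have hhi : hi (⟨k + 1, hk⟩ : Fin r) = k + 2 := by rw [hi_eq]; push_cast; ring
  have h1 := signChange_apply (r := r) (k := k) (by omega)
  rw [mul_assoc, T_mul_T_gen, T_gen_mul_T, signChange, s_eq_gen hk, mul_assoc]
  · rw [mul_apply, mul_apply, hlo, hhi, h1, h1, if_pos (by omega), if_neg (by omega),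
      gen_pos_apply (by simp), gen_pos_apply (by simp)]
    push_cast
    split_ifs <;> omega
  · rw [signChange_inv (by omega), hlo, hhi, h1, h1]
    split_ifs <;> omega

theorem sProd_succ_one (k : ℕ) : sProd r (k + 2) 1 = s r (k + 1) * sProd r (k + 1) 1 := by
  have h : ∀ k, sProd r (k + 1) 1 = ((List.range' 1 k).reverse.map (s r)).prod := by
    intro k
    unfold sProd
    split_ifs with h
    · have : k = 0 := by omega
      subst this; simp
    · simp
  rw [h, h, List.range'_1_concat, List.reverse_append, List.reverse_singleton, List.map_append,
    List.prod_append]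
  simp [add_comm]

theorem sProd_one_succ (k : ℕ) : sProd r 1 (k + 2) = sProd r 1 (k + 1) * s r (k + 1) := by
  unfold sProd
  rw [if_pos (by omega), if_pos (by omega)]
  have h1 : k + 2 - 1 = k + 1 := rfl
  have h2 : k + 1 - 1 = k := rfl
  rw [h1, h2, List.range'_1_concat, List.map_append, List.prod_append]
  simp [add_comm]

theorem sProd_one_one : sProd r 1 1 = 1 := by simp [sProd]

theorem sProd_apply {k : ℕ} (hk : k < r) : sProd r (k + 1) 1 (k + 1) = 1 ∧
    ∀ z : ℤ, (k : ℤ) + 1 < z → sProd r (k + 1) 1 z = z := by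
  induction k with
  | zero => rw [sProd_one_one]; simp
  | succ k ih =>
    obtain ⟨h1, h2⟩ := ih (by omega)
    rw [sProd_succ_one, s_eq_gen hk]
    refine ⟨?_, fun z hz => ?_⟩
    · rw [mul_apply, gen_pos_apply (by simp), if_neg (by simp), if_pos (by simp)]
      push_cast
      exact h1
    · push_cast at hz
      rw [mul_apply, gen_pos_apply (by simp)]
      push_cast
      split_ifs <;> first | omega | exact h2 z (by omega)

theorem sProd_inv {k : ℕ} (hk : k < r) : (sProd r 1 (k + 1))⁻¹ = sProd r (k + 1) 1 := by
  induction k with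
  | zero => rw [sProd_one_one, inv_one]
  | succ k ih =>
    rw [sProd_one_succ, mul_inv_rev, ih (by omega), sProd_succ_one, s_eq_gen hk, gen_inv]

theorem T_sProd_mul {k : ℕ} (hk : k < r) :
    T q Q (sProd r (k + 1) 1) * T q Q (s r 0) * T q Q (sProd r 1 (k + 1)) =
      T q Q (signChange r k) := by
  induction k with
  | zero => rw [sProd_one_one, T_one, one_mul, mul_one, signChange]
  | succ k ih =>
    have hlo : lo (⟨k + 1, hk⟩ : Fin r) = k + 1 := by rw [lo_of_pos (by simp)]; simp
    have hhi : hi (⟨k + 1, hk⟩ : Fin r) = k + 2 := by rw [hi_eq]; push_cast; ring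
    obtain ⟨h1, h2⟩ := sProd_apply (r := r) (k := k) (by omega)
    have h3 := h2 (k + 2) (by omega)
    rw [T_signChange_succ q Q hk, ← ih (by omega), sProd_succ_one, sProd_one_succ, s_eq_gen hk,
      ← T_gen_mul_T, ← T_mul_T_gen]
    · simp only [mul_assoc]
    · rw [sProd_inv (by omega), hlo, hhi, h1, h3]
      omega
    · rw [hlo, hhi, h1, h3]
      omega

theorem gen_commute_signChange {i : Fin r} {k : ℕ} (hk : k < r)
    (h : (i : ℕ) < k ∨ k + 1 < i) : Commute (T q Q (gen i)) (T q Q (signChange r k)) := by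
  refine T_gen_mul_T_of_map q Q ?_ ?_
  · rw [signChange_apply hk, lo]
    split_ifs <;> omega
  · rw [signChange_apply hk, hi]
    split_ifs <;> omega

theorem signChange_commute {i k : ℕ} (hik : i < k) (hk : k < r) :
    Commute (T q Q (signChange r i)) (T q Q (signChange r k)) := by
  induction i with
  | zero => rw [signChange, s_eq_gen (by omega)]; exact gen_commute_signChange q Q hk (Or.inl hik)
  | succ i ih =>
    rw [T_signChange_succ q Q (by omega)]
    have := gen_commute_signChange q Q (i := ⟨i + 1, by omega⟩) hk (Or.inl hik)
    exact (this.mul_left (ih (by omega))).mul_left this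

/-- The product `∏_{i=1}^a (c q^{i-1} + e T_{i,1} T_0 T_{1,i})`, which is `u_a^+` for `c = e = 1`
and `u_a^-` for `c = Q`, `e = -1`. -/
noncomputable def uGen (r : ℕ) (c e : R) : ℕ → Hecke r q Q
  | 0 => 1
  | a + 1 => uGen r c e a *
      (algebraMap R _ (c * (q : R) ^ a) + e • T q Q (signChange r a))

theorem uPlus_eq {a : ℕ} (ha : a ≤ r) : uPlus q Q r a = uGen q Q r 1 1 a := by
  induction a with
  | zero => rfl
  | succ a ih =>
    rw [uGen, ← ih (by omega), uPlus, uPlus, List.range'_1_concat, List.map_append,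
      List.prod_append]
    simp only [List.map_cons, List.map_nil, List.prod_singleton, add_comm 1 a,
      T_sProd_mul q Q (show a < r by omega), Nat.add_sub_cancel, one_mul, one_smul]

theorem uMinus_eq {a : ℕ} (ha : a ≤ r) : uMinus q Q r a = uGen q Q r Q (-1) a := by
  induction a with
  | zero => rfl
  | succ a ih =>
    rw [uGen, ← ih (by omega), uMinus, uMinus, List.range'_1_concat, List.map_append,
      List.prod_append]
    simp only [List.map_cons, List.map_nil, List.prod_singleton, add_comm 1 a,
      T_sProd_mul q Q (show a < r by omega), Nat.add_sub_cancel, neg_smul, one_smul, sub_eq_add_neg]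

variable {q Q} {c e : R}

theorem commute_uGen {x : Hecke r q Q} {a : ℕ}
    (h : ∀ k < a, Commute x (T q Q (signChange r k))) : Commute x (uGen q Q r c e a) := by
  induction a with
  | zero => exact Commute.one_right x
  | succ a ih =>
    exact (ih fun k hk => h k (by omega)).mul_right
      ((Algebra.commute_algebraMap_right _ _).add_right ((h a (by omega)).smul_right e))

/-- `T_i` commutes with the product of two adjacent factors of `u_a^±`. -/
theorem gen_commute_pair {k : ℕ} (hk : k + 1 < r) :
    Commute (T q Q (gen ⟨k + 1, hk⟩))
      ((algebraMap R _ (c * (q : R) ^ k) + e • T q Q (signChange r k)) *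
        (algebraMap R _ (c * (q : R) ^ (k + 1)) + e • T q Q (signChange r (k + 1)))) := by
  have hc := signChange_commute q Q (Nat.lt_succ_self k) hk
  have hs := T_signChange_succ q Q hk
  have hq := T_gen_sq q Q (⟨k + 1, hk⟩ : Fin r)
  have hp : heckeParam q Q (⟨k + 1, hk⟩ : Fin r) = q := if_neg (by simp)
  rw [hp] at hq
  set t := T q Q (gen ⟨k + 1, hk⟩)
  set x := T q Q (signChange r k)
  simp only [Algebra.algebraMap_eq_smul_one] at hq
  have h1 : Commute t (t * x * t + (q : R) • x) := by
    have e1 : t * (t * x * t) = (q : R) • (x * t) + ((q : R) - 1) • (t * x * t) := by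
      rw [← mul_assoc, ← mul_assoc, hq]
      simp only [add_mul, smul_mul_assoc, one_mul]
    have e2 : t * x * t * t = (q : R) • (t * x) + ((q : R) - 1) • (t * x * t) := by
      rw [mul_assoc (t * x), hq]
      simp only [mul_add, mul_smul_comm, smul_mul_assoc, mul_one, one_mul]
    rw [Commute, SemiconjBy, mul_add, add_mul, e1, e2, mul_smul_comm, smul_mul_assoc]
    abel
  have h2 : Commute t (x * (t * x * t)) := by
    rw [Nat.succ_eq_add_one, hs] at hc
    rw [Commute, SemiconjBy]
    calc t * (x * (t * x * t)) = t * x * t * x * t := by simp only [mul_assoc]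
      _ = x * (t * x * t) * t := by rw [hc.eq]
  have e : (algebraMap R _ (c * (q : R) ^ k) + e • x) *
      (algebraMap R _ (c * (q : R) ^ (k + 1)) + e • T q Q (signChange r (k + 1))) =
      algebraMap R _ (c * (q : R) ^ k * (c * (q : R) ^ (k + 1))) +
        (e * (c * (q : R) ^ k)) • (t * x * t + (q : R) • x) + (e * e) • (x * (t * x * t)) := by
    rw [hs]
    simp only [Algebra.algebraMap_eq_smul_one, add_mul, mul_add, smul_mul_assoc, mul_smul_comm,
      one_mul, mul_one, pow_succ]
    module
  rw [e]
  exact ((Algebra.commute_algebraMap_right _ _).add_right (h1.smul_right _)).add_right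
    (h2.smul_right _)

theorem gen_commute_uGen {i : Fin r} (hi1 : 1 ≤ (i : ℕ)) {a : ℕ} (ha : a ≤ r) (hia : (i : ℕ) ≠ a) :
    Commute (T q Q (gen i)) (uGen q Q r c e a) := by
  induction a with
  | zero => exact Commute.one_right _
  | succ a ih =>
    by_cases h : (i : ℕ) = a
    · obtain ⟨i, hir⟩ := i
      simp only at h hi1
      subst h
      obtain ⟨k, rfl⟩ : ∃ k, i = k + 1 := ⟨i - 1, by omega⟩
      rw [uGen, uGen, mul_assoc]
      exact (commute_uGen fun j hj => gen_commute_signChange q Q (by omega)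
        (Or.inr (by simp only; omega))).mul_right (gen_commute_pair hir)
    · rw [uGen]
      exact (ih (by omega) h).mul_right ((Algebra.commute_algebraMap_right _ _).add_right
        ((gen_commute_signChange q Q (by omega) (by omega)).smul_right e))

theorem heckeStar_uGen {a : ℕ} (ha : a ≤ r) :
    heckeStar q Q (uGen q Q r c e a) = uGen q Q r c e a := by
  induction a with
  | zero => exact heckeStar_one q Q
  | succ a ih =>
    have h1 : Commute (T q Q (signChange r a)) (uGen q Q r c e a) :=
      commute_uGen fun k hk => (signChange_commute q Q hk (by omega)).symm
    rw [uGen, heckeStar_mul, ih (by omega)]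
    rw [map_add, map_smul, heckeStar_T, signChange_inv (by omega), heckeStar_algebraMap]
    exact ((Algebra.commute_algebraMap_left _ _).add_left (h1.smul_left e)).eq

theorem exists_uGen_eq_mul {a : ℕ} (ha1 : 1 ≤ a) (h : 0 < r) : ∃ x : Hecke r q Q,
    uGen q Q r c e a = (algebraMap R _ c + e • T q Q (gen ⟨0, h⟩)) * x := by
  induction a, ha1 using Nat.le_induction with
  | base => exact ⟨1, by simp [uGen, signChange, s_eq_gen h]⟩
  | succ a ha ih =>
    obtain ⟨x, hx⟩ := ih
    exact ⟨_, by rw [uGen, hx, mul_assoc]⟩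

theorem exists_uGen_eq_mul' {a : ℕ} (ha1 : 1 ≤ a) (ha : a ≤ r) : ∃ x : Hecke r q Q,
    uGen q Q r c e a = x * (algebraMap R _ c + e • T q Q (gen ⟨0, by omega⟩)) := by
  obtain ⟨x, hx⟩ := exists_uGen_eq_mul (q := q) (Q := Q) (c := c) (e := e) ha1 (by omega : 0 < r)
  refine ⟨heckeStar q Q x, ?_⟩
  rw [← heckeStar_uGen ha, hx, heckeStar_mul]
  rw [map_add, map_smul, heckeStar_T, gen_inv, heckeStar_algebraMap]

theorem T_gen_zero_sq (h : 0 < r) : T q Q (gen ⟨0, h⟩) * T q Q (gen ⟨0, h⟩) =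
    (Q : R) • 1 + ((Q : R) - 1) • T q Q (gen ⟨0, h⟩) := by
  rw [T_gen_sq, heckeParam, if_pos rfl, Algebra.algebraMap_eq_smul_one,
    Algebra.algebraMap_eq_smul_one, smul_mul_assoc, one_mul]

theorem uPlus_mul_gen_zero {a : ℕ} (ha1 : 1 ≤ a) (ha : a ≤ r) :
    uPlus q Q r a * T q Q (gen ⟨0, by omega⟩) = (Q : R) • uPlus q Q r a := by
  obtain ⟨x, hx⟩ := exists_uGen_eq_mul' (q := q) (Q := Q) (c := 1) (e := 1) ha1 ha
  rw [uPlus_eq q Q ha, hx, mul_assoc, ← mul_smul_comm]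
  congr 1
  rw [add_mul, smul_mul_assoc, T_gen_zero_sq, map_one, one_mul]
  module

theorem uMinus_mul_gen_zero {a : ℕ} (ha1 : 1 ≤ a) (ha : a ≤ r) :
    uMinus q Q r a * T q Q (gen ⟨0, by omega⟩) = (-1 : R) • uMinus q Q r a := by
  obtain ⟨x, hx⟩ := exists_uGen_eq_mul' (q := q) (Q := Q) (c := (Q : R)) (e := -1) ha1 ha
  rw [uMinus_eq q Q ha, hx, mul_assoc, ← mul_smul_comm]
  congr 1
  rw [add_mul, smul_mul_assoc, T_gen_zero_sq, Algebra.algebraMap_eq_smul_one, smul_mul_assoc,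
    one_mul]
  module

/-- An element `T_w` for which `w` has a negative value at one of `1, …, a` is congruent to a
combination of shorter ones, modulo the annihilator of `u_a^+` or `u_a^-`. -/
theorem exists_short_of_neg {y : Hecke r q Q} {κ : R} {a : ℕ} (ha : a ≤ r)
    (hy : ∀ i : Fin r, 1 ≤ (i : ℕ) → (i : ℕ) < a → Commute (T q Q (gen i)) y)
    (hy0 : ∀ (h : 1 ≤ a), y * T q Q (gen ⟨0, by omega⟩) = κ • y) {j : ℕ} (hj1 : 1 ≤ j)
    (hja : j ≤ a) {w : SignedPerm r} (hw : w j < 0) :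
    ∃ h ∈ spanT q Q fun v => v.len < w.len, y * T q Q w = y * h := by
  induction j, hj1 using Nat.le_induction generalizing w with
  | base =>
    let i : Fin r := ⟨0, by omega⟩
    have hd : w (hi i) < w (lo i) := by
      rw [lo_of_zero rfl, hi_of_zero rfl, map_neg]
      push_cast at hw
      omega
    refine ⟨κ • T q Q (gen i * w), Submodule.smul_mem _ _ (T_mem_spanT (len_lt_of_desc hd)), ?_⟩
    rw [T_eq_gen_mul q Q hd, ← mul_assoc, hy0 hja, smul_mul_assoc, mul_smul_comm]
  | succ j hj ih =>
    by_cases hw' : w j < 0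
    · exact ih (by omega) hw'
    let i : Fin r := ⟨j, by omega⟩
    have hlo : lo i = j := lo_of_pos hj
    have hhi : hi i = j + 1 := rfl
    push_cast at hw
    have hd : w (hi i) < w (lo i) := by rw [hlo, hhi]; omega
    obtain ⟨h, hh, he⟩ := ih (w := gen i * w) (by omega) (by
      rw [mul_apply, ← hlo, gen_lo, hhi]; exact hw)
    refine ⟨T q Q (gen i) * h, gen_mul_mem_spanT (fun v hv => ?_) (fun v hv _ => ?_) hh, ?_⟩
    · have := len_gen_mul_le i v
      have := len_lt_of_desc hd
      omega
    · have := len_lt_of_desc hd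
      omega
    · have hc : T q Q (gen i) * y = y * T q Q (gen i) := hy i hj hja
      rw [T_eq_gen_mul q Q hd, ← mul_assoc, ← hc, mul_assoc, he, ← mul_assoc, hc, mul_assoc]

/-- If `w` is positive on `1, …, m`, then `T_{i,1} T_0 T_{1,i} T_w` is a combination of `T_v` for
which `i` is the only number in `1, …, m` with a negative value (here `i = k + 1`). -/
theorem signChange_mul_mem {k m : ℕ} (hkm : k < m) (hm : m ≤ r) {x : Hecke r q Q}
    (hx : x ∈ spanT q Q fun v => ∀ j : ℕ, 1 ≤ j → j ≤ m → 0 < v j) :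
    T q Q (signChange r k) * x ∈ spanT q Q fun v =>
      v ((k : ℤ) + 1) < 0 ∧ ∀ j : ℕ, 1 ≤ j → j ≤ m → j ≠ k + 1 → 0 < v j := by
  induction k generalizing x with
  | zero =>
    rw [signChange, s_eq_gen (by omega)]
    refine gen_mul_mem_spanT (fun v hv => ?_) (fun v hv hd => ?_) hx
    · refine ⟨?_, fun j h1 h2 h3 => ?_⟩
      · have := hv 1 le_rfl (by omega)
        rw [mul_apply, gen_zero_apply rfl, if_pos (by simp), map_neg]
        push_cast at this ⊢
        simpa using this
      · rw [mul_apply, gen_zero_apply rfl, if_neg (by omega)]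
        exact hv j h1 h2
    · rw [lo_of_zero rfl, hi_of_zero rfl, map_neg] at hd
      have := hv 1 le_rfl (by omega)
      push_cast at this
      omega
  | succ k ih =>
    let i : Fin r := ⟨k + 1, by omega⟩
    have hi1 : 1 ≤ (i : ℕ) := by simp [i]
    have hiv : ((i : ℕ) : ℤ) = k + 1 := by simp [i]
    have hap := fun z => gen_pos_apply hi1 z
    rw [hiv] at hap
    rw [T_signChange_succ q Q (by omega), mul_assoc, mul_assoc]
    have h1 : T q Q (gen i) * x ∈ spanT q Q fun v => ∀ j : ℕ, 1 ≤ j → j ≤ m → 0 < v j := by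
      refine gen_mul_mem_spanT (fun v hv j h1 h2 => ?_) (fun v hv _ => hv) hx
      rw [mul_apply, hap]
      have e1 := hv (k + 1) (by omega) (by omega)
      have e2 := hv (k + 2) (by omega) (by omega)
      have e3 := hv j h1 h2
      push_cast at e1 e2
      rw [add_assoc, one_add_one_eq_two]
      split_ifs <;> first | assumption | omega
    refine gen_mul_mem_spanT (fun v hv => ?_) (fun v hv hd => ?_) (ih (by omega) h1)
    · refine ⟨?_, fun j h1 h2 h3 => ?_⟩
      · rw [mul_apply, hap]
        push_cast
        rw [if_neg (by omega), if_pos rfl]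
        exact hv.1
      · rw [mul_apply, hap]
        have e2 := hv.2 (k + 2) (by omega) (by omega) (by omega)
        push_cast at e2
        by_cases hj : j = k + 1
        · rw [if_pos (by omega), add_assoc]
          exact e2
        · rw [if_neg (by omega), if_neg (by omega), if_neg (by omega), if_neg (by omega)]
          exact hv.2 j h1 h2 hj
    · exfalso
      rw [lo_of_pos hi1, hi_eq, hiv, add_assoc] at hd
      have e2 := hv.2 (k + 2) (by omega) (by omega) (by omega)
      push_cast at e2
      have := hv.1
      norm_num at hd
      omega

theorem uGen_mul_mem {k : ℕ} (hk : k < r) {x : Hecke r q Q}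
    (hx : x ∈ spanT q Q fun v => v ((k : ℤ) + 1) < 0) :
    uGen q Q r c e k * x ∈ spanT q Q fun v => v ((k : ℤ) + 1) < 0 := by
  have hg : ∀ i : Fin r, (i : ℕ) < k → ∀ y ∈ spanT q Q fun v => v ((k : ℤ) + 1) < 0,
      T q Q (gen i) * y ∈ spanT q Q fun v => v ((k : ℤ) + 1) < 0 := by
    intro i hik y hy
    refine gen_mul_mem_spanT (fun v hv => ?_) (fun v hv _ => hv) hy
    rw [mul_apply, gen_apply_of_ne]
    · exact hv
    · rw [abs_of_nonneg (by omega)]; omega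
    · rw [abs_of_nonneg (by omega)]; omega
  have hs : ∀ j < k, ∀ y ∈ spanT q Q fun v => v ((k : ℤ) + 1) < 0,
      T q Q (signChange r j) * y ∈ spanT q Q fun v => v ((k : ℤ) + 1) < 0 := by
    intro j
    induction j with
    | zero => intro h0; rw [signChange, s_eq_gen (by omega)]; exact hg _ h0
    | succ j ih =>
      intro hj y hy
      rw [T_signChange_succ q Q (by omega), mul_assoc, mul_assoc]
      exact hg _ hj _ (ih (by omega) _ (hg _ hj _ hy))
  have hu : ∀ j ≤ k, ∀ y ∈ spanT q Q fun v => v ((k : ℤ) + 1) < 0,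
      uGen q Q r c e j * y ∈ spanT q Q fun v => v ((k : ℤ) + 1) < 0 := by
    intro j
    induction j with
    | zero => intro _ y hy; rwa [uGen, one_mul]
    | succ j ih =>
      intro hj y hy
      rw [uGen, mul_assoc]
      refine ih (by omega) _ ?_
      rw [add_mul, smul_mul_assoc, Algebra.algebraMap_eq_smul_one, smul_mul_assoc, one_mul]
      exact Submodule.add_mem _ (Submodule.smul_mem _ _ hy)
        (Submodule.smul_mem _ _ (hs j hj y hy))
  exact hu k le_rfl x hx

/-- The coefficients of `u_a^+ T_w` at the elements that are positive on `1, …, a`. -/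
theorem coord_uGen_mul {a : ℕ} (ha : a ≤ r) {v w : SignedPerm r}
    (hv : ∀ j : ℕ, 1 ≤ j → j ≤ a → 0 < v j) (hw : ∀ j : ℕ, 1 ≤ j → j ≤ a → 0 < w j) :
    (basis q Q).coord v (uGen q Q r 1 e a * T q Q w) =
      if v = w then ((∏ i ∈ Finset.range a, q ^ i : Rˣ) : R) else 0 := by
  induction a with
  | zero => rw [uGen, one_mul, coord_T]; simp
  | succ a ih =>
    have h1 := uGen_mul_mem (q := q) (Q := Q) (c := 1) (e := e) (k := a) (by omega)
      (spanT_mono (fun _ h => h.1)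
        (signChange_mul_mem (k := a) (m := a + 1) (by omega) ha (T_mem_spanT hw)))
    have h2 := coord_of_mem_spanT h1 (v := v) (by
      have := hv (a + 1) (by omega) le_rfl
      push_cast at this
      omega)
    rw [uGen, mul_assoc, add_mul, smul_mul_assoc, Algebra.algebraMap_eq_smul_one, smul_mul_assoc,
      one_mul, one_mul, mul_add, mul_smul_comm, mul_smul_comm, map_add, map_smul, map_smul, h2,
      smul_zero, add_zero, ih (by omega) (fun j h1 h2 => hv j h1 (by omega))
        (fun j h1 h2 => hw j h1 (by omega)), Finset.prod_range_succ]
    split_ifs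
    · rw [smul_eq_mul, mul_comm]; push_cast; rfl
    · rw [smul_zero]

end UElements

/-! ### Symmetrizers of Young subgroups -/

section Blocks

variable {r : ℕ}

/-- `E` is the relation of lying in the same block, for a decomposition of `{1, …, r}` into
intervals. -/
structure IsBlockRel (r : ℕ) (E : ℤ → ℤ → Prop) : Prop where
  mem : ∀ {i j}, E i j → 1 ≤ i ∧ i ≤ r
  refl : ∀ {i : ℤ}, 1 ≤ i → i ≤ r → E i i
  symm : ∀ {i j}, E i j → E j i
  trans : ∀ {i j k}, E i j → E j k → E i k
  convex : ∀ {i j k}, E i k → i ≤ j → j ≤ k → E i j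

/-- `w` maps every block to itself. -/
def StabBlocks (E : ℤ → ℤ → Prop) (w : SignedPerm r) : Prop :=
  ∀ i : ℤ, 1 ≤ i → i ≤ r → E i (w i)

/-- `w` is increasing on every block. -/
def IncBlocks (E : ℤ → ℤ → Prop) (w : SignedPerm r) : Prop :=
  ∀ i j : ℤ, E i j → i < j → w i < w j

variable {E : ℤ → ℤ → Prop}

theorem StabBlocks.mul (hE : IsBlockRel r E) {v w : SignedPerm r} (hv : StabBlocks E v)
    (hw : StabBlocks E w) : StabBlocks E (v * w) := fun i h1 h2 => by
  have h := hE.mem (hE.symm (hv i h1 h2))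
  exact hE.trans (hv i h1 h2) (hw _ h.1 h.2)

theorem StabBlocks.inv (hE : IsBlockRel r E) {w : SignedPerm r} (hw : StabBlocks E w) :
    StabBlocks E w⁻¹ := fun i h1 h2 => by
  have hb : |w⁻¹ i| ≤ r := w⁻¹.abs_le (by rw [abs_of_nonneg (by omega)]; exact h2)
  have h0 : w⁻¹ i ≠ 0 := w⁻¹.ne_zero (by omega)
  rw [_root_.abs_le] at hb
  by_cases hpos : 0 < w⁻¹ i
  · have := hw (w⁻¹ i) (by omega) hb.2
    rw [apply_inv_self] at this
    exact hE.symm this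
  · have := hE.mem (hE.symm (hw (-w⁻¹ i) (by omega) (by omega)))
    rw [map_neg, apply_inv_self] at this
    omega

theorem stabBlocks_gen (hE : IsBlockRel r E) {i : Fin r} (h1 : 1 ≤ (i : ℕ)) (hi : E i (i + 1)) :
    StabBlocks E (gen i) := fun z hz1 hz2 => by
  rw [gen_pos_apply h1]
  split_ifs with c1 c2
  · rw [c1]; exact hi
  · rw [c2]; exact hE.symm hi
  · omega
  · omega
  · exact hE.refl hz1 hz2

/-- A descent of an element of a Young subgroup lies in the subgroup. -/
theorem StabBlocks.of_desc (hE : IsBlockRel r E) {w : SignedPerm r} (hw : StabBlocks E w)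
    {i : Fin r} (hd : w (hi i) < w (lo i)) : 1 ≤ (i : ℕ) ∧ E i (i + 1) := by
  have hir := i.2
  by_cases h0 : (i : ℕ) = 0
  · rw [lo_of_zero h0, hi_of_zero h0, map_neg] at hd
    have := hE.mem (hE.symm (hw 1 le_rfl (by omega)))
    omega
  · rw [lo_of_pos (by omega), hi_eq] at hd
    refine ⟨by omega, ?_⟩
    have h1 := hw i (by omega) (by omega)
    have h2 := hw (i + 1) (by omega) (by omega)
    by_cases hc : w (i + 1) ≤ i
    · have h3 := hE.symm h2
      exact hE.trans (hE.symm (hE.convex h3 hc (by omega))) h3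
    · exact hE.convex h1 (by omega) (by omega)

theorem exists_desc {w : SignedPerm r} (h : w ≠ 1) : ∃ i : Fin r, w (hi i) < w (lo i) := by
  by_contra hc
  push Not at hc
  exact h (eq_one_of_asc fun i =>
    lt_of_le_of_ne (hc i) fun he => (lo_lt_hi i).ne (w.injective he))

/-- An element that is not increasing on the blocks has a descent inside a block. -/
theorem exists_desc_of_not_inc (hE : IsBlockRel r E) {w : SignedPerm r} (h : ¬ IncBlocks E w) :
    ∃ i : Fin r, 1 ≤ (i : ℕ) ∧ E i (i + 1) ∧ w (hi i) < w (lo i) := by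
  by_contra hc
  push Not at hc
  have key : ∀ (k : ℕ) (i : ℤ), E i (i + k) → w i ≤ w (i + k) := by
    intro k
    induction k with
    | zero => intro i _; simp
    | succ k ih =>
      intro i hik
      have h1 := hE.mem hik
      have h2 := hE.mem (hE.symm hik)
      push_cast at hik h2 ⊢
      have h3 : E i (i + k) := hE.convex hik (by omega) (by omega)
      have h4 := hc ⟨(i + k).toNat, by omega⟩ (by simp only; omega)
      have e : (((i + k).toNat : ℕ) : ℤ) = i + k := Int.toNat_of_nonneg (by omega)
      rw [lo_of_pos (by simp only; omega), hi_eq] at h4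
      simp only [e] at h4
      have := h4 (hE.trans (hE.symm h3) (by rwa [← add_assoc] at hik))
      have := ih i h3
      rw [← add_assoc]
      omega
  refine h fun i j hij hlt => ?_
  obtain ⟨k, rfl⟩ := Int.le.dest hlt.le
  refine lt_of_le_of_ne (key k i hij) fun he => hlt.ne (w.injective he)

/-- Distinct elements that are increasing on the blocks lie in distinct cosets. -/
theorem StabBlocks.eq_one (hE : IsBlockRel r E) {v w : SignedPerm r} (hw : StabBlocks E w)
    (h1 : IncBlocks E v) (h2 : IncBlocks E (w * v)) : w = 1 := by
  by_contra hne
  obtain ⟨i, hi⟩ := exists_desc hne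
  obtain ⟨hi1, hi2⟩ := hw.of_desc hE hi
  rw [lo_of_pos hi1, hi_eq] at hi
  have h3 := hE.mem hi2
  have h4 := hE.mem (hE.symm hi2)
  have h5 := h1 _ _ (hE.trans (hE.trans (hE.symm (hw _ h4.1 h4.2)) (hE.symm hi2))
    (hw _ h3.1 h3.2)) hi
  have h6 := h2 _ _ hi2 (by omega)
  rw [mul_apply, mul_apply] at h6
  omega

variable {R : Type*} [CommRing R] (q Q : Rˣ)

/-- An induction principle for the elements of a Young subgroup. -/
theorem StabBlocks.induction (hE : IsBlockRel r E) {p : SignedPerm r → Prop} (h1 : p 1)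
    (hgen : ∀ (i : Fin r) (w : SignedPerm r), 1 ≤ (i : ℕ) → E i (i + 1) → StabBlocks E w →
      w (lo i) < w (hi i) → p w → p (gen i * w)) {w : SignedPerm r} (hw : StabBlocks E w) :
    p w := by
  obtain ⟨k, hk⟩ : ∃ k, w.len = k := ⟨_, rfl⟩
  induction k using Nat.strong_induction_on generalizing w with
  | _ k ih =>
    by_cases hne : w = 1
    · rw [hne]; exact h1
    obtain ⟨i, hd⟩ := exists_desc hne
    obtain ⟨hi1, hi2⟩ := hw.of_desc hE hd
    have hw' := (stabBlocks_gen hE hi1 hi2).mul hE hw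
    have := hgen i (gen i * w) hi1 hi2 hw' (by simpa [gen_lo, gen_hi] using hd)
      (ih _ (hk ▸ len_lt_of_desc hd) hw' rfl)
    rwa [gen_mul_cancel] at this

theorem StabBlocks.T_mul_T (hE : IsBlockRel r E) {v w : SignedPerm r} (hw : StabBlocks E w)
    (hv : IncBlocks E v) : T q Q w * T q Q v = T q Q (w * v) := by
  refine StabBlocks.induction hE (p := fun w => T q Q w * T q Q v = T q Q (w * v)) ?_ ?_ hw
  · rw [T_one, one_mul, one_mul]
  · intro i w hi1 hi2 hw hlt ih
    rw [← T_gen_mul_T q Q hlt, mul_assoc, ih, T_gen_mul_T, mul_assoc]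
    rw [lo_of_pos hi1, hi_eq] at *
    have h3 := hE.mem hi2
    have h4 := hE.mem (hE.symm hi2)
    exact hv _ _ (hE.trans (hE.symm (hw _ h3.1 h3.2)) (hE.trans hi2 (hw _ h4.1 h4.2))) hlt

theorem StabBlocks.commute (hE : IsBlockRel r E) {y : Hecke r q Q}
    (hy : ∀ i : Fin r, 1 ≤ (i : ℕ) → E i (i + 1) → Commute (T q Q (gen i)) y) {w : SignedPerm r}
    (hw : StabBlocks E w) : Commute (T q Q w) y := by
  refine StabBlocks.induction hE (p := fun w => Commute (T q Q w) y) ?_ ?_ hw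
  · exact Commute.one_left y
  · intro i w hi1 hi2 _ hlt ih
    rw [← T_gen_mul_T q Q hlt]
    exact (hy i hi1 hi2).mul_left ih

open Classical in
/-- The sum of `c ^ ℓ(w) T_w` over the Young subgroup of elements that map every block to itself. -/
noncomputable def blockSum (r : ℕ) (E : ℤ → ℤ → Prop) (c : R) : Hecke r q Q :=
  ∑ w : SignedPerm r with StabBlocks E w, c ^ w.len • T q Q w

variable {q Q} {c : R}

theorem commute_blockSum (hE : IsBlockRel r E) {y : Hecke r q Q}
    (hy : ∀ i : Fin r, 1 ≤ (i : ℕ) → E i (i + 1) → Commute (T q Q (gen i)) y) :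
    Commute (blockSum q Q r E c) y := by
  classical
  refine Commute.sum_left _ _ _ fun w hw => ?_
  exact (StabBlocks.commute q Q hE hy (Finset.mem_filter.mp hw).2).smul_left _

theorem heckeStar_blockSum (hE : IsBlockRel r E) :
    heckeStar q Q (blockSum q Q r E c) = blockSum q Q r E c := by
  classical
  rw [blockSum, map_sum]
  refine Finset.sum_bij (fun w _ => w⁻¹) (fun w hw => ?_) (fun _ _ _ _ h => inv_injective h)
    (fun w hw => ⟨w⁻¹, ?_, inv_inv w⟩) (fun w _ => ?_)
  · rw [Finset.mem_filter] at hw ⊢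
    exact ⟨Finset.mem_univ _, hw.2.inv hE⟩
  · rw [Finset.mem_filter] at hw ⊢
    exact ⟨Finset.mem_univ _, hw.2.inv hE⟩
  · rw [map_smul, heckeStar_T, len_inv]

/-- The symmetrizer of a Young subgroup is divisible by that of each of its generators. -/
theorem exists_blockSum_eq_mul (hE : IsBlockRel r E) {i : Fin r} (hi1 : 1 ≤ (i : ℕ))
    (hi2 : E i (i + 1)) : ∃ x : Hecke r q Q, blockSum q Q r E c = (1 + c • T q Q (gen i)) * x := by
  classical
  refine ⟨∑ w : SignedPerm r with StabBlocks E w ∧ w (lo i) < w (hi i), c ^ w.len • T q Q w, ?_⟩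
  have hg := stabBlocks_gen hE hi1 hi2
  rw [blockSum, ← Finset.sum_filter_add_sum_filter_not _ fun w : SignedPerm r => w (lo i) < w (hi i),
    Finset.filter_filter, Finset.filter_filter, add_mul, one_mul]
  congr 1
  rw [Finset.mul_sum]
  symm
  refine Finset.sum_bij (fun w _ => gen i * w) (fun w hw => ?_)
    (fun _ _ _ _ h => mul_left_cancel h) (fun w hw => ⟨gen i * w, ?_, gen_mul_cancel i w⟩)
    (fun w hw => ?_)
  · simp only [Finset.mem_filter, Finset.mem_univ, true_and] at hw ⊢
    refine ⟨hg.mul hE hw.1, ?_⟩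
    rw [mul_apply, mul_apply, gen_lo, gen_hi]
    exact hw.2.not_gt
  · simp only [Finset.mem_filter, Finset.mem_univ, true_and] at hw ⊢
    refine ⟨hg.mul hE hw.1, ?_⟩
    rw [mul_apply, mul_apply, gen_lo, gen_hi]
    exact lt_of_le_of_ne (not_lt.mp hw.2) fun he => (lo_lt_hi i).ne' (w.injective he)
  · simp only [Finset.mem_filter, Finset.mem_univ, true_and] at hw
    have h1 := (len_gt_iff i w).mpr hw.2
    have h2 := len_gen_mul_le i w
    have h3 : (gen i * w).len = w.len + 1 := by omega
    rw [smul_mul_assoc, mul_smul_comm, T_gen_mul_T q Q hw.2, h3, pow_succ', smul_smul]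

theorem exists_blockSum_eq_mul' (hE : IsBlockRel r E) {i : Fin r} (hi1 : 1 ≤ (i : ℕ))
    (hi2 : E i (i + 1)) : ∃ x : Hecke r q Q, blockSum q Q r E c = x * (1 + c • T q Q (gen i)) := by
  obtain ⟨x, hx⟩ := exists_blockSum_eq_mul (q := q) (Q := Q) (c := c) hE hi1 hi2
  refine ⟨heckeStar q Q x, ?_⟩
  rw [← heckeStar_blockSum hE, hx, heckeStar_mul]
  rw [map_add, map_smul, heckeStar_T, gen_inv, heckeStar_one]

theorem T_gen_pos_sq {i : Fin r} (hi1 : 1 ≤ (i : ℕ)) : T q Q (gen i) * T q Q (gen i) =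
    (q : R) • 1 + ((q : R) - 1) • T q Q (gen i) := by
  rw [T_gen_sq, heckeParam, if_neg (by omega), Algebra.algebraMap_eq_smul_one,
    Algebra.algebraMap_eq_smul_one, smul_mul_assoc, one_mul]

theorem symmetrizer_mul_gen (hE : IsBlockRel r E) {i : Fin r} (hi1 : 1 ≤ (i : ℕ))
    (hi2 : E i (i + 1)) :
    blockSum q Q r E 1 * T q Q (gen i) = (q : R) • blockSum q Q r E 1 := by
  obtain ⟨x, hx⟩ := exists_blockSum_eq_mul' (q := q) (Q := Q) (c := 1) hE hi1 hi2
  rw [hx, mul_assoc, ← mul_smul_comm, add_mul, smul_mul_assoc, T_gen_pos_sq hi1, one_mul]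
  congr 1
  module

theorem gen_mul_antisymmetrizer (hE : IsBlockRel r E) {i : Fin r} (hi1 : 1 ≤ (i : ℕ))
    (hi2 : E i (i + 1)) : T q Q (gen i) * blockSum q Q r E ((-q)⁻¹ : Rˣ) =
      (-1 : R) • blockSum q Q r E ((-q)⁻¹ : Rˣ) := by
  obtain ⟨x, hx⟩ := exists_blockSum_eq_mul (q := q) (Q := Q) (c := ((-q)⁻¹ : Rˣ)) hE hi1 hi2
  rw [hx, ← mul_assoc, ← smul_mul_assoc, mul_add, mul_smul_comm, T_gen_pos_sq hi1, mul_one]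
  congr 1
  have h : (((-q)⁻¹ : Rˣ) : R) * q = -1 := by
    rw [← neg_eq_iff_eq_neg, ← mul_neg, ← Units.val_neg, Units.inv_mul]
  simp only [smul_add, smul_smul, mul_sub, h, mul_one]
  module

/-- `(1 + T_i)(1 - q⁻¹ T_i) = 0`. -/
theorem symm_mul_antisymm {i : Fin r} (hi1 : 1 ≤ (i : ℕ)) :
    (1 + (1 : R) • T q Q (gen i)) * (1 + (((-q)⁻¹ : Rˣ) : R) • T q Q (gen i)) = 0 := by
  have h : (((-q)⁻¹ : Rˣ) : R) * q = -1 := by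
    rw [← neg_eq_iff_eq_neg, ← mul_neg, ← Units.val_neg, Units.inv_mul]
  rw [add_mul, one_mul, one_smul, mul_add, mul_smul_comm, T_gen_pos_sq hi1, mul_one]
  simp only [smul_add, smul_smul, mul_sub, h, mul_one]
  module

end Blocks

/-! ### Rows and columns of bitableaux -/

section Cells

variable {n r : ℕ} {la : Bicomp n r}

theorem fill_lt_iff {key : Cell la → ℕ ×ₗ ℕ ×ₗ ℕ} {c d : Cell la} :
    fill la key c < fill la key d ↔ key c < key d := by
  have mono : ∀ {c d}, key c ≤ key d → fill la key c ≤ fill la key d := fun h => by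
    unfold fill
    rw [Nat.cast_le]
    refine Finset.card_le_card fun x hx => ?_
    simp only [Finset.mem_filter, Finset.mem_univ, true_and] at hx ⊢
    exact hx.trans h
  refine ⟨fun h => not_le.mp fun hc => h.not_ge (mono hc), fun h => ?_⟩
  unfold fill
  rw [Nat.cast_lt]
  refine Finset.card_lt_card (Finset.ssubset_iff_of_subset (fun x hx => ?_) |>.mpr ⟨d, ?_, ?_⟩)
  · simp only [Finset.mem_filter, Finset.mem_univ, true_and] at hx ⊢
    exact hx.trans h.le
  · simp
  · simpa using h

/-- A down-closed set of cells contains the entries up to its cardinality. -/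
theorem fill_le_card_iff {key : Cell la → ℕ ×ₗ ℕ ×ₗ ℕ} {S : Finset (Cell la)}
    (hS : ∀ c d, d ∈ S → key c ≤ key d → c ∈ S) (c : Cell la) :
    fill la key c ≤ S.card ↔ c ∈ S := by
  classical
  unfold fill
  rw [Nat.cast_le]
  constructor
  · intro h
    by_contra hc
    have : insert c S ⊆ Finset.univ.filter fun d => key d ≤ key c := by
      intro d hd
      rw [Finset.mem_filter]
      refine ⟨Finset.mem_univ _, ?_⟩
      rcases Finset.mem_insert.mp hd with rfl | hd
      · exact le_rfl
      · exact le_of_lt (not_le.mp fun hle => hc (hS c d hd hle))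
    have := Finset.card_le_card this
    rw [Finset.card_insert_of_notMem hc] at this
    omega
  · intro h
    refine Finset.card_le_card fun d hd => ?_
    rw [Finset.mem_filter] at hd
    exact hS d c h hd.2

theorem card_comp (la : Bicomp n r) (k : Fin 2) :
    (Finset.univ.filter fun d : Cell la => d.comp = k).card = (la.comp k).sum := by
  have h : (Finset.univ.filter fun d : Cell la => d.comp = k) =
      Finset.univ.map (Function.Embedding.sigmaMk k) := by
    ext ⟨k', i, j⟩
    simp only [Finset.mem_filter, Finset.mem_univ, true_and, Finset.mem_map,
      Function.Embedding.sigmaMk_apply]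
    constructor
    · intro hk
      obtain rfl : k' = k := Fin.ext hk
      exact ⟨_, rfl⟩
    · rintro ⟨⟨i', j'⟩, he⟩
      obtain rfl : k = k' := (Sigma.mk.inj he).1
      rfl
  rw [h, Finset.card_map, Finset.card_univ, Fintype.card_sigma]
  simp only [Fintype.card_fin, List.get_eq_getElem]
  rw [← List.sum_ofFn, List.ofFn_getElem]

theorem comp_lt (c : Cell la) : c.comp < 2 := c.1.2

theorem tRow_le_iff (c : Cell la) : tRow la c ≤ la.a ↔ c.comp = 0 := by
  have h := card_comp la 0
  rw [Bicomp.a, ← h, tRow, fill_le_card_iff, Finset.mem_filter]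
  · simp
  · intro c d hd hle
    simp only [Finset.mem_filter, Finset.mem_univ, true_and, Prod.Lex.toLex_le_toLex] at hd hle ⊢
    simp only [Fin.val_zero] at *
    omega

theorem tColHat_le_iff (c : Cell la) : tColHat la c ≤ la.b ↔ c.comp = 1 := by
  have h := card_comp la 1
  rw [Bicomp.b, ← h, tColHat, fill_le_card_iff, Finset.mem_filter]
  · simp
  · intro c d hd hle
    have := comp_lt c
    simp only [Finset.mem_filter, Finset.mem_univ, true_and, Prod.Lex.toLex_le_toLex] at hd hle ⊢
    simp only [Fin.val_one] at *
    omega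

theorem tRow_lt_iff {c d : Cell la} : tRow la c < tRow la d ↔ c.comp < d.comp ∨
    c.comp = d.comp ∧ (c.row < d.row ∨ c.row = d.row ∧ c.col < d.col) := by
  rw [tRow, fill_lt_iff, Prod.Lex.toLex_lt_toLex, Prod.Lex.toLex_lt_toLex]

theorem tColHat_lt_iff {c d : Cell la} : tColHat la c < tColHat la d ↔ d.comp < c.comp ∨
    c.comp = d.comp ∧ (c.col < d.col ∨ c.col = d.col ∧ c.row < d.row) := by
  have := comp_lt c
  have := comp_lt d
  rw [tColHat, fill_lt_iff, Prod.Lex.toLex_lt_toLex, Prod.Lex.toLex_lt_toLex]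
  simp only
  omega

/-- The shift `w_{a,r-a}` carries `t^λ` to `t̂^λ`. -/
theorem tRowHat_eq (c : Cell la) : tRowHat la c =
    if tRow la c ≤ la.a then tRow la c + la.b else tRow la c - la.a := by
  classical
  have h0 := card_comp la 0
  have h1 := card_comp la 1
  have hc := comp_lt c
  simp only [tRow_le_iff]
  unfold tRowHat tRow fill Bicomp.a Bicomp.b
  split_ifs with h
  · rw [← h1, ← Nat.cast_add, Nat.cast_inj, ← Finset.card_union_of_disjoint]
    · congr 1
      ext d
      have hd := comp_lt d
      simp only [Finset.mem_union, Finset.mem_filter, Finset.mem_univ, true_and,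
        Prod.Lex.toLex_le_toLex, Fin.val_one]
      omega
    · rw [Finset.disjoint_left]
      intro d hd
      simp only [Finset.mem_filter, Finset.mem_univ, true_and,
        Prod.Lex.toLex_le_toLex, Fin.val_one] at hd ⊢
      omega
  · rw [← h0, eq_sub_iff_add_eq, ← Nat.cast_add, Nat.cast_inj, ← Finset.card_union_of_disjoint]
    · congr 1
      ext d
      have hd := comp_lt d
      simp only [Finset.mem_union, Finset.mem_filter, Finset.mem_univ, true_and,
        Prod.Lex.toLex_le_toLex, Fin.val_zero]
      omega
    · rw [Finset.disjoint_left]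
      intro d hd
      simp only [Finset.mem_filter, Finset.mem_univ, true_and,
        Prod.Lex.toLex_le_toLex, Fin.val_zero] at hd ⊢
      omega

/-- The relation of being the entries of two cells of the filling `t` with the same label. -/
def labelRel {γ : Type*} (t : Cell la → ℤ) (β : Cell la → γ) (i j : ℤ) : Prop :=
  ∃ c d, t c = i ∧ t d = j ∧ β c = β d

theorem isBlockRel_labelRel {γ : Type*} {t : Cell la → ℤ} (ht : IsFilling t) {β : Cell la → γ}
    (hβ : ∀ c d e, t c ≤ t d → t d ≤ t e → β c = β e → β c = β d) :
    IsBlockRel r (labelRel t β) where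
  mem := by rintro i j ⟨c, d, rfl, rfl, _⟩; exact (ht.2 _).mp ⟨c, rfl⟩
  refl := by
    intro i h1 h2
    obtain ⟨c, rfl⟩ := (ht.2 i).mpr ⟨h1, h2⟩
    exact ⟨c, c, rfl, rfl, rfl⟩
  symm := by rintro i j ⟨c, d, hc, hd, h⟩; exact ⟨d, c, hd, hc, h.symm⟩
  trans := by
    rintro i j k ⟨c, d, rfl, rfl, h1⟩ ⟨d', e, hd, rfl, h2⟩
    obtain rfl := ht.1 hd
    exact ⟨c, e, rfl, rfl, h1.trans h2⟩
  convex := by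
    rintro i j k ⟨c, e, rfl, rfl, h⟩ h1 h2
    have hc := (ht.2 _).mp ⟨c, rfl⟩
    have he := (ht.2 _).mp ⟨e, rfl⟩
    obtain ⟨d, rfl⟩ := (ht.2 j).mpr ⟨by omega, by omega⟩
    exact ⟨c, d, rfl, rfl, hβ c d e h1 h2 h⟩

variable (la)

/-- The relation of being entries of the same row of `t^λ`. -/
def rowRel : ℤ → ℤ → Prop := labelRel (tRow la) fun c => (c.comp, c.row)

/-- The relation of being entries of the same column of `t̂_λ`. -/
def colRel : ℤ → ℤ → Prop := labelRel (tColHat la) fun c => (c.comp, c.col)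

theorem isBlockRel_rowRel : IsBlockRel r (rowRel la) := by
  refine isBlockRel_labelRel (isFilling_tRow la) fun c d e h1 h2 h => ?_
  rw [← not_lt, tRow_lt_iff] at h1 h2
  rw [Prod.mk.injEq] at h ⊢
  omega

theorem isBlockRel_colRel : IsBlockRel r (colRel la) := by
  refine isBlockRel_labelRel (isFilling_tColHat la) fun c d e h1 h2 h => ?_
  rw [← not_lt, tColHat_lt_iff] at h1 h2
  rw [Prod.mk.injEq] at h ⊢
  omega

variable {la}

theorem rowRel_le_iff {i j : ℤ} (h : rowRel la i j) : i ≤ la.a ↔ j ≤ la.a := by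
  obtain ⟨c, d, rfl, rfl, h⟩ := h
  rw [Prod.mk.injEq] at h
  rw [tRow_le_iff, tRow_le_iff, h.1]

theorem colRel_le_iff {i j : ℤ} (h : colRel la i j) : i ≤ la.b ↔ j ≤ la.b := by
  obtain ⟨c, d, rfl, rfl, h⟩ := h
  rw [Prod.mk.injEq] at h
  rw [tColHat_le_iff, tColHat_le_iff, h.1]

theorem stab_labelRel_iff {γ : Type*} {t : Cell la → ℤ} (ht : IsFilling t) {β : Cell la → γ}
    {w : SignedPerm r} :
    StabBlocks (labelRel t β) w ↔ ∀ c, ∃ d, β d = β c ∧ w (t c) = t d := by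
  constructor
  · intro h c
    have hc := (ht.2 _).mp ⟨c, rfl⟩
    obtain ⟨c', d, h1, h2, h3⟩ := h (t c) hc.1 hc.2
    obtain rfl := ht.1 h1
    exact ⟨d, h3.symm, h2.symm⟩
  · intro h i h1 h2
    obtain ⟨c, rfl⟩ := (ht.2 i).mpr ⟨h1, h2⟩
    obtain ⟨d, hd1, hd2⟩ := h c
    exact ⟨c, d, rfl, hd2.symm, hd1.symm⟩

theorem stabRows_iff {w : SignedPerm r} : StabRows la (tRow la) w ↔ StabBlocks (rowRel la) w := by
  rw [rowRel, stab_labelRel_iff (isFilling_tRow la)]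
  simp only [Prod.mk.injEq, and_assoc, StabRows]

theorem stabCols_iff {w : SignedPerm r} :
    StabCols la (tColHat la) w ↔ StabBlocks (colRel la) w := by
  rw [colRel, stab_labelRel_iff (isFilling_tColHat la)]
  simp only [Prod.mk.injEq, and_assoc, StabCols]

theorem rowStandard_iff {w : SignedPerm r} : RowStandard la (fun c => w (tRow la c)) ↔
    IncBlocks (rowRel la) w ∧ ∀ j : ℕ, 1 ≤ j → j ≤ la.a → 0 < w j := by
  have ht := isFilling_tRow la
  constructor
  · rintro ⟨h1, h2⟩
    refine ⟨?_, fun j hj1 hj2 => ?_⟩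
    · rintro i j ⟨c, d, rfl, rfl, h⟩ hlt
      rw [Prod.mk.injEq] at h
      refine h1 c d h.1 h.2 ?_
      rw [tRow_lt_iff] at hlt
      omega
    · have := la.size
      obtain ⟨c, hc⟩ := (ht.2 j).mpr ⟨by omega, by unfold Bicomp.a at hj2; omega⟩
      have := h2 c ((tRow_le_iff c).mp (by omega))
      simpa only [hc] using this
  · rintro ⟨h1, h2⟩
    refine ⟨fun c d hcd1 hcd2 hlt => ?_, fun c hc => ?_⟩
    · refine h1 _ _ ⟨c, d, rfl, rfl, Prod.ext hcd1 hcd2⟩ ?_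
      rw [tRow_lt_iff]
      omega
    · have h3 := (tRow_le_iff c).mpr hc
      have h4 := (ht.2 _).mp ⟨c, rfl⟩
      have := h2 (tRow la c).toNat (by omega) (by omega)
      rwa [Int.toNat_of_nonneg (by omega)] at this

theorem sProd_one_apply {k : ℕ} (hk : k < r) {z : ℤ} (hz : 1 ≤ z) :
    sProd r 1 (k + 1) z = if z = 1 then (k : ℤ) + 1 else if z ≤ k + 1 then z - 1 else z := by
  induction k with
  | zero => rw [sProd_one_one, one_apply]; split_ifs <;> push_cast at * <;> omega
  | succ k ih =>
    rw [sProd_one_succ, s_eq_gen hk, mul_apply, ih (by omega), gen_pos_apply (by simp)]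
    push_cast
    split_ifs <;> omega

theorem wShift_apply {a : ℕ} (ha : a ≤ r) {z : ℤ} (h1 : 1 ≤ z) (h2 : z ≤ r) :
    wShift r a z = if z ≤ a then z + r - a else z - a := by
  unfold wShift
  induction a with
  | zero => rw [pow_zero, one_apply]; split_ifs <;> push_cast at * <;> omega
  | succ a ih =>
    obtain ⟨k, rfl⟩ : ∃ k, r = k + 1 := ⟨r - 1, by omega⟩
    rw [pow_succ, mul_apply, ih (by omega)]
    rw [sProd_one_apply (by omega) (by split_ifs <;> omega)]
    push_cast at *
    split_ifs <;> omega

theorem a_add_b (la : Bicomp n r) : la.a + la.b = r := la.size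

theorem wShift_tRow (c : Cell la) : wShift r la.a (tRow la c) = tRowHat la c := by
  have h := (isFilling_tRow la).2 (tRow la c) |>.mp ⟨c, rfl⟩
  have := a_add_b la
  rw [wShift_apply (by omega) h.1 h.2, tRowHat_eq]
  split_ifs <;> omega

theorem eq_wShift_mul_piHat {w : SignedPerm r} (h : ∀ c, w (tRow la c) = tColHat la c) :
    w = wShift r la.a * piHat la :=
  (exists_transition (isFilling_tRow la) (isFilling_tColHat la)).unique h fun c => by
    rw [mul_apply, wShift_tRow, piHat_spec]

/-- If two elements of a block of `E` are mapped to the same block of `F`, then so are two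
consecutive ones, to consecutive ones. -/
theorem exists_adjacent {E F : ℤ → ℤ → Prop} (hE : IsBlockRel r E) (hF : IsBlockRel r F)
    {w : SignedPerm r} (h1 : IncBlocks E w) (h2 : IncBlocks F w⁻¹) {x y : ℤ} (hxy : x < y)
    (hxyE : E x y) (hxyF : F (w x) (w y)) :
    E x (x + 1) ∧ F (w x) (w x + 1) ∧ w (x + 1) = w x + 1 := by
  have e1 : E x (x + 1) := hE.convex hxyE (by omega) (by omega)
  have e2 := h1 _ _ e1 (by omega)
  have e3 : w (x + 1) ≤ w y := by
    rcases (show x + 1 = y ∨ x + 1 < y by omega) with h | h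
    · rw [h]
    · exact (h1 _ _ (hE.trans (hE.symm e1) hxyE) h).le
  have e4 : F (w x) (w (x + 1)) := hF.convex hxyF e2.le e3
  have e5 : F (w x) (w x + 1) := hF.convex e4 (by omega) (by omega)
  refine ⟨e1, e5, ?_⟩
  by_contra hne
  have e6 := h2 _ _ e5 (by omega)
  have e7 := h2 _ _ (hF.trans (hF.symm e5) e4) (by omega)
  rw [inv_apply_self] at e6 e7
  omega

theorem exists_left (c : Cell la) (h : 0 < c.col) :
    ∃ d : Cell la, d.comp = c.comp ∧ d.row = c.row ∧ d.col + 1 = c.col := by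
  obtain ⟨k, i, j⟩ := c
  have hj : 0 < (j : ℕ) := h
  exact ⟨⟨k, i, ⟨j - 1, by omega⟩⟩, rfl, rfl, Nat.sub_add_cancel hj⟩

/-- The only permutation of a diagram that preserves the components, respects the row reading and
the column reading, and separates the entries of each row by columns, is the identity: it moves no
cell to the left, hence preserves the columns. -/
theorem cell_perm_eq_id {σ : Cell la → Cell la} (hσ : Function.Bijective σ)
    (hcomp : ∀ c, (σ c).comp = c.comp)
    (hsep : ∀ c d : Cell la, c.comp = d.comp → c.row = d.row → c.col < d.col →
      (σ c).col ≠ (σ d).col)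
    (hrow : ∀ c d : Cell la, c.comp = d.comp → c.row = d.row → c.col < d.col →
      tColHat la (σ c) < tColHat la (σ d))
    (hcol : ∀ c d : Cell la, (σ c).comp = (σ d).comp → (σ c).col = (σ d).col →
      (σ c).row < (σ d).row → tRow la c < tRow la d) (c : Cell la) : σ c = c := by
  have h1 : ∀ (j : ℕ) (c : Cell la), c.col = j → j ≤ (σ c).col := by
    intro j
    induction j with
    | zero => intro c _; exact Nat.zero_le _
    | succ j ih =>
      intro c hc
      obtain ⟨d, hd1, hd2, hd3⟩ := exists_left c (by omega)
      have e1 := hsep d c hd1 hd2 (by omega)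
      have e2 := hrow d c hd1 hd2 (by omega)
      rw [tColHat_lt_iff, hcomp, hcomp] at e2
      have := ih d (by omega)
      omega
  have h2 : ∀ c, (σ c).col = c.col := by
    have hsum : ∑ c : Cell la, c.col = ∑ c, (σ c).col :=
      (hσ.sum_comp fun c : Cell la => c.col).symm
    have := (Finset.sum_eq_sum_iff_of_le fun c _ => h1 _ c rfl).mp hsum
    exact fun c => (this c (Finset.mem_univ c)).symm
  have h3 : ∀ (i : ℕ) (c : Cell la), c.row = i → σ c = c := by
    intro i
    induction i using Nat.strong_induction_on with
    | _ i ih =>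
      intro c hc
      rcases lt_trichotomy (σ c).row c.row with h | h | h
      · exact hσ.1 (ih _ (hc ▸ h) (σ c) rfl)
      · exact Cell.ext_pos (hcomp c) h (h2 c)
      · obtain ⟨d, hd⟩ := hσ.2 c
        have e1 := hcomp d
        have e2 := h2 d
        have e3 := hcol d c (by rw [e1, hcomp, ← e1, hd]) (by rw [e2, h2, ← e2, hd]) (by rwa [hd])
        rw [hd] at e1 e2
        rw [tRow_lt_iff] at e3
        have e4 := ih d.row (by omega) d rfl
        rw [hd] at e4
        rw [← e4] at hd
        exact hd
  exact h3 _ c rfl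

end Cells

/-! ### The generators of the permutation modules -/

section Generators

variable {R : Type*} [CommRing R] {q Q : Rˣ} {n r : ℕ}

theorem a_le (la : Bicomp n r) : la.a ≤ r := by have := a_add_b la; omega

theorem b_le (la : Bicomp n r) : la.b ≤ r := by have := a_add_b la; omega

theorem gen_commute_uPlus {a : ℕ} (ha : a ≤ r) {i : Fin r} (h1 : 1 ≤ (i : ℕ)) (h : (i : ℕ) ≠ a) :
    Commute (T q Q (gen i)) (uPlus q Q r a) := by
  rw [uPlus_eq q Q ha]; exact gen_commute_uGen h1 ha h

theorem gen_commute_uMinus {a : ℕ} (ha : a ≤ r) {i : Fin r} (h1 : 1 ≤ (i : ℕ))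
    (h : (i : ℕ) ≠ a) : Commute (T q Q (gen i)) (uMinus q Q r a) := by
  rw [uMinus_eq q Q ha]; exact gen_commute_uGen h1 ha h

theorem heckeStar_uPlus {a : ℕ} (ha : a ≤ r) :
    heckeStar q Q (uPlus q Q r a) = uPlus q Q r a := by
  rw [uPlus_eq q Q ha, heckeStar_uGen ha]

theorem heckeStar_uMinus {a : ℕ} (ha : a ≤ r) :
    heckeStar q Q (uMinus q Q r a) = uMinus q Q r a := by
  rw [uMinus_eq q Q ha, heckeStar_uGen ha]

variable (q Q) in
theorem xElt_eq (la : Bicomp n r) : xElt q Q la = blockSum q Q r (rowRel la) 1 := by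
  unfold xElt blockSum
  refine Finset.sum_congr (by ext; simp [stabRows_iff]) fun w _ => ?_
  rw [one_pow, one_smul]

variable (q Q) in
theorem yHat_eq (la : Bicomp n r) :
    yHat q Q la = blockSum q Q r (colRel la) ((-q)⁻¹ : Rˣ) := by
  unfold yHat blockSum
  refine Finset.sum_congr (by ext; simp [stabCols_iff]) fun w _ => ?_
  rw [Units.val_pow_eq_pow_val]

variable (la : Bicomp n r)

theorem rowRel_ne_a {i : Fin r} (h : rowRel la i (i + 1)) : (i : ℕ) ≠ la.a := by
  have := rowRel_le_iff h; omega

theorem colRel_ne_b {i : Fin r} (h : colRel la i (i + 1)) : (i : ℕ) ≠ la.b := by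
  have := colRel_le_iff h; omega

theorem xElt_commute_uPlus : Commute (xElt q Q la) (uPlus q Q r la.a) := by
  rw [xElt_eq]
  exact commute_blockSum (isBlockRel_rowRel la) fun i h1 h2 =>
    gen_commute_uPlus (a_le la) h1 (rowRel_ne_a la h2)

theorem yHat_commute_uMinus : Commute (yHat q Q la) (uMinus q Q r la.b) := by
  rw [yHat_eq]
  exact commute_blockSum (isBlockRel_colRel la) fun i h1 h2 =>
    gen_commute_uMinus (b_le la) h1 (colRel_ne_b la h2)

variable (q Q) in
/-- The generator `u_a^+ x_λ` of `M^λ`. -/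
noncomputable def xGen : Hecke r q Q := uPlus q Q r la.a * xElt q Q la

variable (q Q) in
/-- The generator `u_{r-a}^- ŷ_λ` of `L^λ`, as an element of the Hecke algebra. -/
noncomputable def yGen : Hecke r q Q := uMinus q Q r la.b * yHat q Q la

theorem heckeStar_xGen : heckeStar q Q (xGen q Q la) = xGen q Q la := by
  rw [xGen, heckeStar_mul, heckeStar_uPlus (a_le la), xElt_eq,
    heckeStar_blockSum (isBlockRel_rowRel la), ← xElt_eq, (xElt_commute_uPlus la).eq]

theorem heckeStar_yGen : heckeStar q Q (yGen q Q la) = yGen q Q la := by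
  rw [yGen, heckeStar_mul, heckeStar_uMinus (b_le la), yHat_eq,
    heckeStar_blockSum (isBlockRel_colRel la), ← yHat_eq, (yHat_commute_uMinus la).eq]

variable {la}

theorem xGen_mul_gen {i : Fin r} (h1 : 1 ≤ (i : ℕ)) (h2 : rowRel la i (i + 1)) :
    xGen q Q la * T q Q (gen i) = (q : R) • xGen q Q la := by
  rw [xGen, xElt_eq, mul_assoc, symmetrizer_mul_gen (isBlockRel_rowRel la) h1 h2, mul_smul_comm]

theorem gen_mul_yGen {i : Fin r} (h1 : 1 ≤ (i : ℕ)) (h2 : colRel la i (i + 1)) :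
    T q Q (gen i) * yGen q Q la = (-1 : R) • yGen q Q la := by
  rw [yGen, ← mul_assoc, (gen_commute_uMinus (b_le la) h1 (colRel_ne_b la h2)).eq, mul_assoc,
    yHat_eq, gen_mul_antisymmetrizer (isBlockRel_colRel la) h1 h2, mul_smul_comm]

theorem xGen_mul_of_neg {w : SignedPerm r} {j : ℕ} (hj1 : 1 ≤ j) (hja : j ≤ la.a) (hw : w j < 0) :
    ∃ h ∈ spanT q Q fun v => v.len < w.len, xGen q Q la * T q Q w = xGen q Q la * h := by
  obtain ⟨h, hh, he⟩ := exists_short_of_neg (q := q) (Q := Q) (y := uPlus q Q r la.a) (a_le la)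
    (fun i h1 h2 => gen_commute_uPlus (a_le la) h1 h2.ne)
    (fun h1 => uPlus_mul_gen_zero h1 (a_le la)) hj1 hja hw
  refine ⟨h, hh, ?_⟩
  rw [xGen, ← (xElt_commute_uPlus la).eq, mul_assoc, he, mul_assoc]

theorem mul_yGen_of_neg {w : SignedPerm r} {j : ℕ} (hj1 : 1 ≤ j) (hjb : j ≤ la.b)
    (hw : w⁻¹ j < 0) :
    ∃ h ∈ spanT q Q fun v => v.len < w.len, T q Q w * yGen q Q la = h * yGen q Q la := by
  obtain ⟨h, hh, he⟩ := exists_short_of_neg (q := q) (Q := Q) (y := uMinus q Q r la.b) (b_le la)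
    (fun i h1 h2 => gen_commute_uMinus (b_le la) h1 h2.ne)
    (fun h1 => uMinus_mul_gen_zero h1 (b_le la)) hj1 hjb hw
  rw [len_inv] at hh
  refine ⟨heckeStar q Q h, star_mem_spanT_len hh, ?_⟩
  have he' := congrArg (heckeStar q Q) he
  rw [heckeStar_mul, heckeStar_mul, heckeStar_uMinus (b_le la), heckeStar_T, inv_inv] at he'
  rw [yGen, ← mul_assoc, he', mul_assoc]

variable (q Q) in
/-- A submodule that contains every `T_w` modulo shorter ones is everything. -/
theorem eq_top_of_straightening {N : Submodule R (Hecke r q Q)}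
    (hN : ∀ w : SignedPerm r, ∃ h ∈ spanT q Q fun v => v.len < w.len, T q Q w - h ∈ N) :
    N = ⊤ := by
  have key : ∀ (k : ℕ) (w : SignedPerm r), w.len = k → T q Q w ∈ N := by
    intro k
    induction k using Nat.strong_induction_on with
    | _ k ih =>
      intro w hw
      obtain ⟨h, hh, he⟩ := hN w
      have : h ∈ N := map_mem_of_mem_spanT LinearMap.id N (fun v hv => ih _ (hw ▸ hv) v rfl) hh
      simpa using N.add_mem he this
  rw [eq_top_iff]
  intro x _
  exact T_induction q Q (p := fun x => x ∈ N) (fun w => key _ w rfl) (fun _ _ => N.add_mem)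
    (fun a _ => N.smul_mem a) x

variable (la) in
/-- The bitabloids span `M^λ`. -/
theorem exists_rowStandard (h : Hecke r q Q) :
    ∃ k ∈ spanT q Q fun w => RowStandard la (fun c => w (tRow la c)),
      xGen q Q la * h = xGen q Q la * k := by
  have hmem : ∀ h : Hecke r q Q, h ∈ (((spanT q Q fun w => RowStandard la (fun c => w (tRow la c))).map
      (LinearMap.mulLeft R (xGen q Q la))).comap (LinearMap.mulLeft R (xGen q Q la))) ↔
      ∃ k ∈ spanT q Q fun w => RowStandard la (fun c => w (tRow la c)),
        xGen q Q la * h = xGen q Q la * k := by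
    intro h
    rw [Submodule.mem_comap, Submodule.mem_map]
    simp only [LinearMap.mulLeft_apply, eq_comm]
  rw [← hmem, eq_top_of_straightening q Q (N := Submodule.comap _ _) fun w => ?_]
  · exact Submodule.mem_top
  simp only [hmem]
  by_cases h1 : ∀ j : ℕ, 1 ≤ j → j ≤ la.a → 0 < w j
  · by_cases h2 : IncBlocks (rowRel la) w
    · refine ⟨0, Submodule.zero_mem _, _, T_mem_spanT (rowStandard_iff.mpr ⟨h2, h1⟩), ?_⟩
      rw [sub_zero]
    · obtain ⟨i, hi1, hi2, hd⟩ := exists_desc_of_not_inc (isBlockRel_rowRel la) h2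
      refine ⟨(q : R) • T q Q (gen i * w), Submodule.smul_mem _ _ (T_mem_spanT (len_lt_of_desc hd)),
        0, Submodule.zero_mem _, ?_⟩
      rw [T_eq_gen_mul q Q hd, mul_zero, mul_sub, ← mul_assoc, xGen_mul_gen hi1 hi2,
        smul_mul_assoc, mul_smul_comm, sub_self]
  · push Not at h1
    obtain ⟨j, hj1, hja, hj⟩ := h1
    obtain ⟨h, hh, he⟩ := xGen_mul_of_neg (q := q) (Q := Q) hj1 hja
      (lt_of_le_of_ne hj (w.ne_zero (by omega)))
    exact ⟨h, hh, 0, Submodule.zero_mem _, by rw [mul_sub, he, sub_self, mul_zero]⟩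

variable (q) in
/-- The unit `q^{0 + 1 + ⋯ + (a-1)}`. -/
def qScale (a : ℕ) : Rˣ := ∏ i ∈ Finset.range a, q ^ i

/-- The inner products of the bitabloids `u_a^+ x_λ T_v` with the basis elements `T_w`. -/
theorem heckeForm_tabloid {v w : SignedPerm r} (hv : RowStandard la (fun c => v (tRow la c)))
    (hw : RowStandard la (fun c => w (tRow la c))) :
    heckeForm q Q (xGen q Q la * T q Q v) (T q Q w) =
      if v = w then (qScale q la.a : R) * (qLen q Q w : R) else 0 := by
  classical
  rw [rowStandard_iff] at hv hw
  have hE := isBlockRel_rowRel la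
  have hx : xElt q Q la * T q Q v =
      ∑ u : SignedPerm r with StabBlocks (rowRel la) u, T q Q (u * v) := by
    rw [xElt_eq, blockSum, Finset.sum_mul]
    refine Finset.sum_congr (by congr) fun u hu => ?_
    rw [one_pow, one_smul, (Finset.mem_filter.mp hu).2.T_mul_T q Q hE hv.1]
  rw [heckeForm_comm, heckeForm_T, xGen, mul_assoc, hx, Finset.mul_sum, map_sum,
    uPlus_eq q Q (a_le la)]
  have hterm : ∀ u ∈ Finset.univ.filter (fun u : SignedPerm r => StabBlocks (rowRel la) u),
      (basis q Q).coord w (uGen q Q r 1 1 la.a * T q Q (u * v)) =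
        if w = u * v then (qScale q la.a : R) else 0 := by
    intro u hu
    refine coord_uGen_mul (a_le la) hw.2 fun j h1 h2 => ?_
    have hj := (Finset.mem_filter.mp hu).2 j (by omega) (by have := a_le la; omega)
    have h3 := (rowRel_le_iff hj).mp (by omega)
    have h4 := hE.mem (hE.symm hj)
    have := hv.2 (u j).toNat (by omega) (by omega)
    rwa [Int.toNat_of_nonneg (by omega)] at this
  rw [Finset.sum_congr rfl hterm]
  split_ifs with h
  · subst h
    rw [Finset.sum_eq_single 1]
    · rw [one_mul, if_pos rfl, mul_comm]
    · intro u _ hne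
      exact if_neg fun he => hne (by simpa using he)
    · intro hc
      exact absurd (Finset.mem_filter.mpr ⟨Finset.mem_univ _, fun i h1 h2 => hE.refl h1 h2⟩) hc
  · rw [Finset.sum_eq_zero, mul_zero]
    intro u hu
    refine if_neg fun he => h ?_
    have := (Finset.mem_filter.mp hu).2.eq_one hE hv.1 (he ▸ hw.1)
    rw [he, this, one_mul]

/-! ### The one-dimensional space `u_a^+ x_λ H u_{r-a}^- ŷ_λ` -/

/-- The relation of lying in the same block, for the blocks `{1, …, a}` and singletons. -/
def initRel (a r : ℕ) (i j : ℤ) : Prop :=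
  1 ≤ i ∧ i ≤ r ∧ 1 ≤ j ∧ j ≤ r ∧ (i = j ∨ (i ≤ a ∧ j ≤ a))

theorem isBlockRel_init (a r : ℕ) : IsBlockRel r (initRel a r) := by
  constructor <;> unfold initRel <;> intros <;> omega

/-- The relation of lying in the same block, for the blocks `{1, …, b}` and `{b+1, …, r}`. -/
def splitRel (b r : ℕ) (i j : ℤ) : Prop :=
  1 ≤ i ∧ i ≤ r ∧ 1 ≤ j ∧ j ≤ r ∧ (i ≤ b ↔ j ≤ b)

theorem isBlockRel_split (b r : ℕ) : IsBlockRel r (splitRel b r) := by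
  constructor <;> unfold splitRel <;> intros <;> omega

theorem T_eq_mul_gen {i : Fin r} {w : SignedPerm r} (h : w⁻¹ (hi i) < w⁻¹ (lo i)) :
    T q Q w = T q Q (w * gen i) * T q Q (gen i) := by
  have := congrArg (heckeStar q Q) (T_eq_gen_mul q Q h)
  rwa [heckeStar_mul, heckeStar_T, heckeStar_T, heckeStar_T, inv_inv, mul_inv_rev, gen_inv,
    inv_inv] at this

theorem len_mul_gen_lt {i : Fin r} {w : SignedPerm r} (h : w⁻¹ (hi i) < w⁻¹ (lo i)) :
    (w * gen i).len < w.len := by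
  rw [← len_inv, mul_inv_rev, gen_inv, ← len_inv w]
  exact len_lt_of_desc h

theorem gen_pos_bounds {i : Fin r} (h1 : 1 ≤ (i : ℕ)) {a : ℕ} (hia : (i : ℕ) ≠ a) {z : ℤ}
    (hz : 1 ≤ z) : 1 ≤ gen i z ∧ (gen i z ≤ a ↔ z ≤ a) := by
  rw [gen_pos_apply h1]
  split_ifs <;> omega

theorem uPlus_mul_T_mul_uMinus {a b : ℕ} (ha : a ≤ r) (hb : b ≤ r) {w : SignedPerm r}
    (h1 : ∀ j : ℤ, 1 ≤ j → j ≤ a → 0 < w j) (h2 : ∀ j : ℤ, 1 ≤ j → j ≤ b → 0 < w⁻¹ j)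
    (h3 : ∃ j : ℤ, 1 ≤ j ∧ j ≤ a ∧ w j ≤ b) :
    uPlus q Q r a * T q Q w * uMinus q Q r b = 0 := by
  obtain ⟨k, hk⟩ : ∃ k, w.len = k := ⟨_, rfl⟩
  induction k using Nat.strong_induction_on generalizing w with
  | _ k ih =>
  by_cases hc1 : IncBlocks (initRel a r) w
  swap
  · obtain ⟨i, hi1, hi2, hd⟩ := exists_desc_of_not_inc (isBlockRel_init a r) hc1
    have hia : (i : ℕ) ≠ a := by unfold initRel at hi2; omega
    have := ih (gen i * w).len (hk ▸ len_lt_of_desc hd) (w := gen i * w) (fun j hj1 hj2 => ?_)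
      (fun j hj1 hj2 => ?_) ?_ rfl
    · rw [T_eq_gen_mul q Q hd, ← mul_assoc, ← (gen_commute_uPlus ha hi1 hia).eq, mul_assoc,
        mul_assoc, ← mul_assoc (uPlus q Q r a), this, mul_zero]
    · have := gen_pos_bounds hi1 hia hj1
      exact h1 _ this.1 (this.2.mpr hj2)
    · rw [mul_inv_rev, gen_inv, mul_apply]
      have := gen_pos_bounds hi1 hia (h2 j hj1 hj2)
      omega
    · obtain ⟨j, hj1, hj2, hj3⟩ := h3
      have := gen_pos_bounds hi1 hia hj1
      exact ⟨gen i j, this.1, this.2.mpr hj2, by rwa [mul_apply, gen_gen]⟩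
  by_cases hc2 : IncBlocks (initRel b r) w⁻¹
  swap
  · obtain ⟨i, hi1, hi2, hd⟩ := exists_desc_of_not_inc (isBlockRel_init b r) hc2
    have hib : (i : ℕ) ≠ b := by unfold initRel at hi2; omega
    have := ih (w * gen i).len (hk ▸ len_mul_gen_lt hd) (w := w * gen i) (fun j hj1 hj2 => ?_)
      (fun j hj1 hj2 => ?_) ?_ rfl
    · rw [T_eq_mul_gen hd, ← mul_assoc, mul_assoc, (gen_commute_uMinus hb hi1 hib).eq, ← mul_assoc,
        this, zero_mul]
    · have := gen_pos_bounds hi1 hib (h1 j hj1 hj2)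
      rw [mul_apply]
      omega
    · rw [mul_inv_rev, gen_inv, mul_apply]
      have := gen_pos_bounds hi1 hib hj1
      exact h2 _ this.1 (this.2.mpr hj2)
    · obtain ⟨j, hj1, hj2, hj3⟩ := h3
      have := gen_pos_bounds hi1 hib (h1 j hj1 hj2)
      exact ⟨j, hj1, hj2, by rw [mul_apply]; exact this.2.mpr hj3⟩
  -- `w` is now the shortest element of its double coset, and fixes `1`
  obtain ⟨j, hj1, hj2, hj3⟩ := h3
  have e0 := h1 1 le_rfl (by omega)
  have e1 : w 1 ≤ w j := by
    rcases hj1.eq_or_lt with rfl | hlt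
    · exact le_rfl
    · exact (hc1 1 j ⟨by omega, by omega, by omega, by omega, Or.inr ⟨by omega, hj2⟩⟩ hlt).le
  have e2 : w 1 = 1 := by
    by_contra hne
    have e3 := hc2 1 (w 1) ⟨by omega, by omega, by omega, by omega, Or.inr ⟨by omega, by omega⟩⟩
      (by omega)
    rw [inv_apply_self] at e3
    have := h2 1 le_rfl (by omega)
    omega
  have hr : 0 < r := by omega
  have hcomm : T q Q (gen ⟨0, hr⟩) * T q Q w = T q Q w * T q Q (gen ⟨0, hr⟩) :=
    T_gen_mul_T_of_map q Q (by rw [lo_of_zero rfl, map_neg, e2]) (by rw [hi_of_zero rfl, e2])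
  obtain ⟨x, hx⟩ := exists_uGen_eq_mul' (q := q) (Q := Q) (c := 1) (e := 1) (a := a) (by omega) ha
  obtain ⟨y, hy⟩ := exists_uGen_eq_mul (q := q) (Q := Q) (c := (Q : R)) (e := -1) (a := b)
    (by omega) hr
  have hz : (algebraMap R (Hecke r q Q) 1 + (1 : R) • T q Q (gen ⟨0, hr⟩)) *
      (algebraMap R (Hecke r q Q) Q + (-1 : R) • T q Q (gen ⟨0, hr⟩)) = 0 := by
    rw [map_one, one_smul, add_mul, one_mul, mul_add, mul_smul_comm, T_gen_zero_sq,
      Algebra.algebraMap_eq_smul_one, mul_smul_comm, mul_one]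
    module
  have hcomm' : Commute (algebraMap R (Hecke r q Q) 1 + (1 : R) • T q Q (gen ⟨0, hr⟩)) (T q Q w) :=
    (Algebra.commute_algebraMap_left _ _).add_left (Commute.smul_left hcomm _)
  rw [uPlus_eq q Q ha, uMinus_eq q Q hb, hx, hy, mul_assoc x, hcomm'.eq]
  calc _ = x * T q Q w * ((algebraMap R (Hecke r q Q) 1 + (1 : R) • T q Q (gen ⟨0, hr⟩)) *
      (algebraMap R (Hecke r q Q) Q + (-1 : R) • T q Q (gen ⟨0, hr⟩))) * y := by
        simp only [mul_assoc]
    _ = 0 := by rw [hz, mul_zero, zero_mul]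

variable (la) in
theorem T_wShift_mul_T_piHat :
    T q Q (wShift r la.a) * T q Q (piHat la) = T q Q (wShift r la.a * piHat la) := by
  have hab := a_add_b la
  have hE := isBlockRel_split la.b r
  have hstab : StabBlocks (splitRel la.b r) (piHat la) := fun i h1 h2 => by
    obtain ⟨c, rfl⟩ := ((isFilling_tRowHat la).2 i).mpr ⟨h1, h2⟩
    have hc := comp_lt c
    have e1 := ((isFilling_tColHat la).2 _).mp ⟨c, rfl⟩
    have e2 := tColHat_le_iff c
    have e3 := tRow_le_iff c
    have e4 := tRowHat_eq c
    have e5 := ((isFilling_tRow la).2 _).mp ⟨c, rfl⟩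
    rw [piHat_spec]
    unfold splitRel
    split_ifs at e4 <;> omega
  have hinc : IncBlocks (splitRel la.b r) (wShift r la.a)⁻¹ := by
    have hinv : ∀ z : ℤ, 1 ≤ z → z ≤ r → (wShift r la.a)⁻¹ z =
        if z ≤ la.b then z + la.a else z - la.b := by
      intro z h1 h2
      rw [inv_apply, Equiv.symm_apply_eq, wShift_apply (a_le la)] <;> split_ifs <;> omega
    rintro i j ⟨h1, h2, h3, h4, h5⟩ hlt
    rw [hinv i h1 h2, hinv j h3 h4]
    split_ifs <;> omega
  have := congrArg (heckeStar q Q) ((hstab.inv hE).T_mul_T q Q hE hinc)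
  rwa [heckeStar_mul, heckeStar_T, heckeStar_T, heckeStar_T, inv_inv, inv_inv, mul_inv_rev,
    inv_inv, inv_inv] at this

/-- Row and column symmetrizers annihilate each other across `T_w` if `w` carries consecutive
entries of a row of `t^λ` to consecutive entries of a column of `t̂_λ`. -/
theorem xGen_mul_T_mul_yGen_of_adjacent {w : SignedPerm r} {i j : Fin r} (hi1 : 1 ≤ (i : ℕ))
    (hj1 : 1 ≤ (j : ℕ)) (hi2 : rowRel la i (i + 1)) (hj2 : colRel la j (j + 1)) (h1 : w i = j)
    (h2 : w (i + 1) = j + 1) : xGen q Q la * T q Q w * yGen q Q la = 0 := by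
  have hcomm : T q Q (gen i) * T q Q w = T q Q w * T q Q (gen j) :=
    T_gen_mul_T_of_map q Q (by rw [lo_of_pos hi1, lo_of_pos hj1, h1]) (by rw [hi_eq, hi_eq, h2])
  obtain ⟨x, hx⟩ := exists_blockSum_eq_mul' (q := q) (Q := Q) (c := 1)
    (isBlockRel_rowRel la) hi1 hi2
  obtain ⟨y, hy⟩ := exists_blockSum_eq_mul (q := q) (Q := Q) (c := ((-q)⁻¹ : Rˣ))
    (isBlockRel_colRel la) hj1 hj2
  have hu : Commute (uMinus q Q r la.b) (1 + (((-q)⁻¹ : Rˣ) : R) • T q Q (gen j)) :=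
    (Commute.one_right _).add_right
      ((gen_commute_uMinus (b_le la) hj1 (colRel_ne_b la hj2)).symm.smul_right _)
  have hcomm' : (1 + (1 : R) • T q Q (gen i)) * T q Q w =
      T q Q w * (1 + (1 : R) • T q Q (gen j)) := by
    rw [one_smul, one_smul, add_mul, mul_add, hcomm, one_mul, mul_one]
  rw [xGen, yGen, xElt_eq, yHat_eq, hx, hy, ← mul_assoc (uMinus q Q r la.b), hu.eq]
  calc _ = uPlus q Q r la.a * x * ((1 + (1 : R) • T q Q (gen i)) * T q Q w) *
        ((1 + (((-q)⁻¹ : Rˣ) : R) • T q Q (gen j)) * uMinus q Q r la.b * y) := by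
        simp only [mul_assoc]
    _ = uPlus q Q r la.a * x * T q Q w * ((1 + (1 : R) • T q Q (gen j)) *
        (1 + (((-q)⁻¹ : Rˣ) : R) • T q Q (gen j))) * (uMinus q Q r la.b * y) := by
        rw [hcomm']; simp only [mul_assoc]
    _ = 0 := by rw [symm_mul_antisymm hj1, mul_zero, zero_mul]

/-- The case of `exists_smul_eq` where `w` cannot be shortened: `w` is then determined by `λ`, or
the product is zero. -/
theorem eq_or_mul_eq_zero_of_inc {w : SignedPerm r}
    (h1 : ∀ j : ℤ, 1 ≤ j → j ≤ la.a → la.b < w j)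
    (h2 : ∀ j : ℤ, 1 ≤ j → j ≤ la.b → la.a < w⁻¹ j)
    (h3 : IncBlocks (rowRel la) w) (h4 : IncBlocks (colRel la) w⁻¹) :
    w = wShift r la.a * piHat la ∨ xGen q Q la * T q Q w * yGen q Q la = 0 := by
  classical
  have hab := a_add_b la
  have hmap : ∀ z : ℤ, 1 ≤ z → z ≤ r → 1 ≤ w z ∧ w z ≤ r ∧ (w z ≤ la.b ↔ la.a < z) := by
    have habs : ∀ (v : SignedPerm r) (z : ℤ), 1 ≤ z → z ≤ r → v z ≤ r := fun v z hz1 hz2 =>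
      (_root_.abs_le.mp (v.abs_le (by rw [abs_of_nonneg (by omega)]; exact hz2))).2
    have himg : (Finset.Icc (1 : ℤ) la.b).image (fun j => w⁻¹ j) = Finset.Icc ((la.a : ℤ) + 1) r := by
      refine Finset.eq_of_subset_of_card_le (fun z hz => ?_) ?_
      · obtain ⟨j, hj, rfl⟩ := Finset.mem_image.mp hz
        rw [Finset.mem_Icc] at hj ⊢
        have := h2 j hj.1 hj.2
        have := habs w⁻¹ j hj.1 (by omega)
        omega
      · rw [Finset.card_image_of_injective _ w⁻¹.injective, Int.card_Icc, Int.card_Icc]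
        omega
    intro z hz1 hz2
    by_cases hza : z ≤ la.a
    · have := h1 z hz1 hza
      have := habs w z hz1 hz2
      omega
    · have hz : z ∈ Finset.Icc ((la.a : ℤ) + 1) r := Finset.mem_Icc.mpr ⟨by omega, hz2⟩
      rw [← himg] at hz
      obtain ⟨j, hj, rfl⟩ := Finset.mem_image.mp hz
      rw [Finset.mem_Icc] at hj
      rw [apply_inv_self]
      omega
  have hrow := fun c : Cell la => ((isFilling_tRow la).2 _).mp ⟨c, rfl⟩
  have hσ : ∀ c : Cell la, ∃ d, tColHat la d = w (tRow la c) := fun c => by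
    have := hmap _ (hrow c).1 (hrow c).2
    exact ((isFilling_tColHat la).2 _).mpr ⟨this.1, this.2.1⟩
  choose σ hσ using hσ
  have hinj : Function.Injective σ := fun c d h => by
    have := congrArg (tColHat la) h
    rw [hσ, hσ] at this
    exact (isFilling_tRow la).1 (w.injective this)
  have hcomp : ∀ c, (σ c).comp = c.comp := fun c => by
    have e1 := tRow_le_iff c
    have e2 := tColHat_le_iff (σ c)
    have e3 := hmap _ (hrow c).1 (hrow c).2
    have := comp_lt c
    have := comp_lt (σ c)
    rw [hσ] at e2
    omega
  have hlt : ∀ c d : Cell la, c.comp = d.comp → c.row = d.row → c.col < d.col →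
      rowRel la (tRow la c) (tRow la d) ∧ tRow la c < tRow la d := fun c d e1 e2 e3 =>
    ⟨⟨c, d, rfl, rfl, Prod.ext e1 e2⟩, by rw [tRow_lt_iff]; omega⟩
  by_cases hsep : ∀ c d : Cell la, c.comp = d.comp → c.row = d.row → c.col < d.col →
      (σ c).col ≠ (σ d).col
  · left
    refine eq_wShift_mul_piHat fun c => ?_
    rw [← hσ, cell_perm_eq_id (Finite.injective_iff_bijective.mp hinj) hcomp hsep
      (fun c d e1 e2 e3 => ?_) (fun c d e1 e2 e3 => ?_)]
    · rw [hσ, hσ]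
      obtain ⟨e4, e5⟩ := hlt c d e1 e2 e3
      exact h3 _ _ e4 e5
    · have := h4 _ _ (⟨σ c, σ d, rfl, rfl, Prod.ext e1 e2⟩ : colRel la _ _)
        (by rw [tColHat_lt_iff]; omega)
      rwa [hσ, hσ, inv_apply_self, inv_apply_self] at this
  · right
    push Not at hsep
    obtain ⟨c, d, e1, e2, e3, e4⟩ := hsep
    obtain ⟨e5, e6⟩ := hlt c d e1 e2 e3
    have e7 : colRel la (w (tRow la c)) (w (tRow la d)) :=
      ⟨σ c, σ d, hσ c, hσ d, Prod.ext ((hcomp c).trans (e1.trans (hcomp d).symm)) e4⟩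
    obtain ⟨g1, g2, g3⟩ := exists_adjacent (isBlockRel_rowRel la) (isBlockRel_colRel la) h3 h4 e6
      e5 e7
    have g4 := (isBlockRel_rowRel la).mem ((isBlockRel_rowRel la).symm g1)
    have g5 := (isBlockRel_colRel la).mem ((isBlockRel_colRel la).symm g2)
    have g6 := (isBlockRel_rowRel la).mem g1
    have g7 := (isBlockRel_colRel la).mem g2
    have k1 : (((tRow la c).toNat : ℕ) : ℤ) = tRow la c := Int.toNat_of_nonneg (by omega)
    have k2 : (((w (tRow la c)).toNat : ℕ) : ℤ) = w (tRow la c) := Int.toNat_of_nonneg (by omega)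
    refine xGen_mul_T_mul_yGen_of_adjacent (i := ⟨(tRow la c).toNat, by omega⟩)
      (j := ⟨(w (tRow la c)).toNat, by omega⟩) (by simp only; omega) (by simp only; omega)
      ?_ ?_ ?_ ?_
    all_goals simp only [k1, k2]
    · exact g1
    · exact g2
    · exact g3

variable (la) in
/-- The space `u_a^+ x_λ H u_{r-a}^- ŷ_λ` is spanned by `z_λ`. -/
theorem exists_smul_eq (h : Hecke r q Q) : ∃ κ : R, xGen q Q la * h * yGen q Q la =
    κ • (xGen q Q la * T q Q (wShift r la.a * piHat la) * yGen q Q la) := by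
  let f : Hecke r q Q →ₗ[R] Hecke r q Q :=
    LinearMap.mulRight R (yGen q Q la) ∘ₗ LinearMap.mulLeft R (xGen q Q la)
  have hf : ∀ h, f h = xGen q Q la * h * yGen q Q la := fun _ => rfl
  have htop : (Submodule.span R {f (T q Q (wShift r la.a * piHat la))}).comap f = ⊤ := by
    refine eq_top_of_straightening q Q fun w => ?_
    simp only [Submodule.mem_comap, map_sub]
    have hsub : ∀ {h : Hecke r q Q}, h ∈ (spanT q Q fun v => v.len < w.len) →
        f (T q Q w) = f h → ∃ h ∈ spanT q Q fun v => v.len < w.len,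
          f (T q Q w) - f h ∈ Submodule.span R {f (T q Q (wShift r la.a * piHat la))} :=
      fun hh he => ⟨_, hh, by rw [he, sub_self]; exact Submodule.zero_mem _⟩
    by_cases c1 : ∃ j : ℕ, 1 ≤ j ∧ j ≤ la.a ∧ w j < 0
    · obtain ⟨j, hj1, hj2, hj3⟩ := c1
      obtain ⟨h, hh, he⟩ := xGen_mul_of_neg (q := q) (Q := Q) hj1 hj2 hj3
      exact hsub hh (by rw [hf (T q Q w), hf h, he])
    by_cases c2 : ∃ j : ℕ, 1 ≤ j ∧ j ≤ la.b ∧ w⁻¹ j < 0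
    · obtain ⟨j, hj1, hj2, hj3⟩ := c2
      obtain ⟨h, hh, he⟩ := mul_yGen_of_neg (q := q) (Q := Q) hj1 hj2 hj3
      exact hsub hh (by rw [hf (T q Q w), hf h, mul_assoc, he, ← mul_assoc])
    by_cases c3 : IncBlocks (rowRel la) w
    swap
    · obtain ⟨i, hi1, hi2, hd⟩ := exists_desc_of_not_inc (isBlockRel_rowRel la) c3
      refine hsub (Submodule.smul_mem _ (q : R) (T_mem_spanT (len_lt_of_desc hd))) ?_
      rw [map_smul, hf, hf, T_eq_gen_mul q Q hd, ← mul_assoc, xGen_mul_gen hi1 hi2,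
        smul_mul_assoc, smul_mul_assoc]
    by_cases c4 : IncBlocks (colRel la) w⁻¹
    swap
    · obtain ⟨i, hi1, hi2, hd⟩ := exists_desc_of_not_inc (isBlockRel_colRel la) c4
      refine hsub (Submodule.smul_mem _ (-1 : R) (T_mem_spanT (len_mul_gen_lt hd))) ?_
      rw [map_smul, hf, hf, T_eq_mul_gen hd, mul_assoc, mul_assoc (T q Q _),
        gen_mul_yGen hi1 hi2, mul_smul_comm, mul_smul_comm, mul_assoc]
    refine ⟨0, Submodule.zero_mem _, ?_⟩
    rw [_root_.map_zero, sub_zero]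
    have p1 : ∀ j : ℤ, 1 ≤ j → j ≤ la.a → 0 < w j := fun j hj1 hj2 => by
      by_contra hc
      have := w.ne_zero (z := j) (by omega)
      refine c1 ⟨j.toNat, by omega, by omega, ?_⟩
      rw [Int.toNat_of_nonneg (by omega)]
      omega
    have p2 : ∀ j : ℤ, 1 ≤ j → j ≤ la.b → 0 < w⁻¹ j := fun j hj1 hj2 => by
      by_contra hc
      have := w⁻¹.ne_zero (z := j) (by omega)
      refine c2 ⟨j.toNat, by omega, by omega, ?_⟩
      rw [Int.toNat_of_nonneg (by omega)]
      omega
    by_cases c5 : ∃ j : ℤ, 1 ≤ j ∧ j ≤ la.a ∧ w j ≤ la.b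
    · have := uPlus_mul_T_mul_uMinus (q := q) (Q := Q) (a_le la) (b_le la) p1 p2 c5
      have h0 : f (T q Q w) = 0 := by
        rw [hf, xGen, yGen, ← (xElt_commute_uPlus la).eq]
        calc _ = xElt q Q la * (uPlus q Q r la.a * T q Q w * uMinus q Q r la.b) * yHat q Q la := by
              simp only [mul_assoc]
          _ = 0 := by rw [this, mul_zero, zero_mul]
      rw [h0]
      exact Submodule.zero_mem _
    · push Not at c5
      rcases eq_or_mul_eq_zero_of_inc (q := q) (Q := Q) c5 (fun j hj1 hj2 => by
        by_contra hc
        have := c5 (w⁻¹ j) (p2 j hj1 hj2) (by omega)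
        rw [apply_inv_self] at this
        omega) c3 c4 with h | h
      · rw [h]
        exact Submodule.mem_span_singleton_self _
      · rw [hf (T q Q w), h]
        exact Submodule.zero_mem _
  have hh : h ∈ (Submodule.span R {f (T q Q (wShift r la.a * piHat la))}).comap f := by
    rw [htop]; trivial
  obtain ⟨κ, hκ⟩ := Submodule.mem_span_singleton.mp hh
  exact ⟨κ, hκ.symm⟩

end Generators

/-! ### The bilinear form on tensor space -/

section Forms

variable {R : Type*} [Field R] {q Q : Rˣ} {n r : ℕ}

theorem exists_linear_section {K V W : Type*} [Field K] [AddCommMonoid V] [AddCommMonoid W]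
    [Module K V] [Module K W] (f : V →ₗ[K] W) (hf : Function.Surjective f) :
    ∃ g : W →ₗ[K] V, f ∘ₗ g = LinearMap.id := by
  let _ := Module.addCommMonoidToAddCommGroup K (M := W)
  exact f.exists_rightInverse_of_surjective (LinearMap.range_eq_top.mpr hf)

theorem permElt_surjective (la : Bicomp n r) : Function.Surjective (permElt q Q la) := by
  rintro ⟨m, hm⟩
  obtain ⟨h, rfl⟩ := Submodule.mem_span_singleton.mp hm
  exact ⟨h.unop, rfl⟩

theorem coe_permElt (la : Bicomp n r) (h : Hecke r q Q) :
    (permElt q Q la h : Hecke r q Q) = xGen q Q la * h := rfl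

variable (q Q) in
/-- The map `h ↦ u_a^+ x_λ h` from the Hecke algebra onto `M^λ`. -/
noncomputable def permMap (la : Bicomp n r) : Hecke r q Q →ₗ[R] permModule q Q la where
  toFun := permElt q Q la
  map_add' x y := Subtype.ext (mul_add _ x y)
  map_smul' a x := Subtype.ext (mul_smul_comm a _ x)

theorem op_smul_permElt (la : Bicomp n r) (h k : Hecke r q Q) :
    MulOpposite.op k • permElt q Q la h = permElt q Q la (h * k) :=
  Subtype.ext (mul_assoc _ h k)

theorem op_smul_inTensor (la : Bicomp n r) (h k : Hecke r q Q) :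
    MulOpposite.op k • inTensor q Q la h = inTensor q Q la (h * k) := by
  rw [inTensor, inTensor, ← op_smul_permElt, map_smul]

theorem lof_apply_self (la : Bicomp n r) (m : permModule q Q la) :
    (DirectSum.lof (Hecke r q Q)ᵐᵒᵖ (Bicomp n r) (fun la => permModule q Q la) la m :
      TensorSpace n r q Q) la = m :=
  DFinsupp.single_eq_same

theorem inTensor_apply_self (la : Bicomp n r) (h : Hecke r q Q) :
    inTensor q Q la h la = permElt q Q la h := lof_apply_self la _

theorem inTensor_apply_ne {la mu : Bicomp n r} (hne : la ≠ mu) (h : Hecke r q Q) :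
    inTensor q Q la h mu = 0 :=
  DFinsupp.single_eq_of_ne (Ne.symm hne)

theorem inTensor_induction {p : TensorSpace n r q Q → Prop} (h0 : p 0)
    (hadd : ∀ e f, p e → p f → p (e + f)) (hin : ∀ la h, p (inTensor q Q la h))
    (e : TensorSpace n r q Q) : p e := by
  induction e using DirectSum.induction_on with
  | zero => exact h0
  | of la m => obtain ⟨h, rfl⟩ := permElt_surjective la m; exact hin la h
  | add e f he hf => exact hadd e f he hf

theorem smul_inTensor (la : Bicomp n r) (a : R) (h : Hecke r q Q) :
    a • inTensor q Q la h = inTensor q Q la (a • h) := by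
  have : permElt q Q la (a • h) = a • permElt q Q la h := (permMap q Q la).map_smul a h
  rw [inTensor, inTensor, this]
  exact (DirectSum.lof R (Bicomp n r) (fun la => permModule q Q la) la).map_smul a _ |>.symm

variable (q Q) in
/-- There is a form on `M^λ` with `⟨u_a^+ x_λ h, u_a^+ x_λ k⟩ = q^{-a(a-1)/2} (u_a^+ x_λ h, k)`, where
`( , )` is the form on the Hecke algebra. It does not depend on the choice of `k`, since
`(u_a^+ x_λ h, k) = (h, u_a^+ x_λ k)`. -/
theorem exists_permForm (la : Bicomp n r) :
    ∃ F : permModule q Q la →ₗ[R] permModule q Q la →ₗ[R] R,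
      (∀ (m : permModule q Q la) (k : Hecke r q Q), F m (permElt q Q la k) =
        ((qScale q la.a)⁻¹ : Rˣ) * heckeForm q Q (m : Hecke r q Q) k) ∧
      ∀ (h : Hecke r q Q) (m : permModule q Q la), F (permElt q Q la h) m =
        ((qScale q la.a)⁻¹ : Rˣ) * heckeForm q Q h (m : Hecke r q Q) := by
  obtain ⟨σ, hσ⟩ := exists_linear_section (permMap q Q la) (permElt_surjective la)
  have hσ' : ∀ m, xGen q Q la * σ m = m := fun m =>
    congrArg Subtype.val (LinearMap.congr_fun hσ m)
  let i : permModule q Q la →ₗ[R] Hecke r q Q := (permModule q Q la).subtype.restrictScalars R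
  let F : permModule q Q la →ₗ[R] permModule q Q la →ₗ[R] R :=
    (((qScale q la.a)⁻¹ : Rˣ) : R) • ((heckeForm q Q).compl₁₂ i σ)
  have hF : ∀ h m, F (permElt q Q la h) m =
      ((qScale q la.a)⁻¹ : Rˣ) * heckeForm q Q h (m : Hecke r q Q) := by
    intro h m
    change _ * heckeForm q Q (xGen q Q la * h) (σ m) = _
    rw [heckeForm_mul_left, heckeStar_xGen, hσ']
  refine ⟨F, fun m k => ?_, hF⟩
  obtain ⟨h, rfl⟩ := permElt_surjective la m
  rw [hF, coe_permElt, coe_permElt, heckeForm_mul_left, heckeStar_xGen]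

variable (q Q) in
/-- The form on `M^λ` for which the bitabloids are orthogonal. -/
noncomputable def permForm (la : Bicomp n r) : permModule q Q la →ₗ[R] permModule q Q la →ₗ[R] R :=
  (exists_permForm q Q la).choose

theorem permForm_permElt_right {la : Bicomp n r} (m : permModule q Q la) (k : Hecke r q Q) :
    permForm q Q la m (permElt q Q la k) =
      ((qScale q la.a)⁻¹ : Rˣ) * heckeForm q Q (m : Hecke r q Q) k :=
  (exists_permForm q Q la).choose_spec.1 m k

theorem permForm_permElt_left {la : Bicomp n r} (h : Hecke r q Q) (m : permModule q Q la) :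
    permForm q Q la (permElt q Q la h) m =
      ((qScale q la.a)⁻¹ : Rˣ) * heckeForm q Q h (m : Hecke r q Q) :=
  (exists_permForm q Q la).choose_spec.2 h m

theorem permForm_op_smul {la : Bicomp n r} (m m' : permModule q Q la) (k : Hecke r q Q) :
    permForm q Q la (MulOpposite.op k • m) m' =
      permForm q Q la m (MulOpposite.op (heckeStar q Q k) • m') := by
  obtain ⟨h, rfl⟩ := permElt_surjective la m
  rw [op_smul_permElt, permForm_permElt_left, permForm_permElt_left, heckeForm_mul_right]
  rfl

theorem permForm_nondeg {la : Bicomp n r} {m : permModule q Q la}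
    (h : ∀ m', permForm q Q la m' m = 0) : m = 0 := by
  refine Subtype.ext (heckeForm_nondeg q Q fun k => ?_)
  have := h (permElt q Q la k)
  rwa [permForm_permElt_left, Units.mul_right_eq_zero] at this

/-- Every linear functional on `M^λ` is represented by the form. -/
theorem exists_permForm_eq {la : Bicomp n r} (ψ : permModule q Q la →ₗ[R] R) :
    ∃ m', ∀ m, permForm q Q la m m' = ψ m := by
  classical
  let i : permModule q Q la →ₗ[R] Hecke r q Q := (permModule q Q la).subtype.restrictScalars R
  obtain ⟨g, hg⟩ := LinearMap.exists_leftInverse_of_injective i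
    (LinearMap.ker_eq_bot.mpr Subtype.val_injective)
  -- the element of the Hecke algebra that represents an extension of `ψ`
  let y : Hecke r q Q := ∑ w : SignedPerm r,
    ((qLen q Q w)⁻¹ : Rˣ) • ψ (g (T q Q w)) • T q Q w
  have hy : ∀ h, heckeForm q Q h y = ψ (g h) := by
    intro h
    induction h using T_induction with
    | hT v =>
      simp only [y, map_sum]
      rw [Finset.sum_eq_single v]
      · rw [Units.smul_def, map_smul, map_smul, heckeForm_T_T, if_pos rfl, smul_eq_mul, smul_eq_mul,
          mul_comm, mul_assoc, Units.mul_inv, mul_one]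
      · intro w _ hne
        rw [Units.smul_def, map_smul, map_smul, heckeForm_T_T, if_neg (Ne.symm hne), smul_zero,
          smul_zero]
      · intro hc
        exact absurd (Finset.mem_univ _) hc
    | hadd x y hx hy => simp only [map_add, LinearMap.add_apply, hx, hy]
    | hsmul a x hx => simp only [map_smul, LinearMap.smul_apply, hx]
  refine ⟨permElt q Q la ((qScale q la.a : R) • y), fun m => ?_⟩
  rw [permForm_permElt_right, map_smul, hy, smul_eq_mul, ← mul_assoc, Units.inv_mul, one_mul]
  exact congrArg ψ (LinearMap.congr_fun hg m)

variable (q Q n r) in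
/-- The bilinear form on tensor space. -/
noncomputable def tensorForm : LinearMap.BilinForm R (TensorSpace n r q Q) :=
  DirectSum.toModule R (Bicomp n r) _ fun la =>
    (LinearMap.lcomp R R (DirectSum.component R (Bicomp n r) (fun la => permModule q Q la) la)) ∘ₗ
      permForm q Q la

theorem tensorForm_inTensor (la : Bicomp n r) (h : Hecke r q Q) (e : TensorSpace n r q Q) :
    tensorForm q Q n r (inTensor q Q la h) e = permForm q Q la (permElt q Q la h) (e la) := by
  have := DirectSum.toModule_lof R (φ := fun la : Bicomp n r =>
    (LinearMap.lcomp R R (DirectSum.component R (Bicomp n r) (fun la => permModule q Q la) la)) ∘ₗ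
      permForm q Q la) la (permElt q Q la h)
  exact LinearMap.congr_fun this e

theorem isTensorForm_tensorForm : IsTensorForm q Q (tensorForm q Q n r) := by
  intro la mu v w hv hw
  rw [tabloid, tabloid, tensorForm_inTensor]
  constructor
  · rintro ⟨rfl, rfl⟩
    rw [inTensor_apply_self, permForm_permElt_right, coe_permElt, heckeForm_tabloid hv hw,
      if_pos rfl, ← mul_assoc, Units.inv_mul, one_mul]
  · intro hne
    by_cases h : la = mu
    · subst h
      rw [inTensor_apply_self, permForm_permElt_right, coe_permElt, heckeForm_tabloid hv hw,
        if_neg (fun he => hne ⟨rfl, he⟩), mul_zero]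
    · rw [inTensor_apply_ne (Ne.symm h), _root_.map_zero]

theorem IsTensorForm.unique {B B' : LinearMap.BilinForm R (TensorSpace n r q Q)}
    (hB : IsTensorForm q Q B) (hB' : IsTensorForm q Q B') : B = B' := by
  -- replace `h` by a combination of elements `T_w` for which `t^λ w` is row standard
  have hred : ∀ (la : Bicomp n r) (h : Hecke r q Q),
      ∃ k ∈ spanT q Q fun w => RowStandard la (fun c => w (tRow la c)),
        inTensor q Q la h = inTensor q Q la k := fun la h => by
    obtain ⟨k, hk, he⟩ := exists_rowStandard la h
    refine ⟨k, hk, ?_⟩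
    have : permElt q Q la h = permElt q Q la k := Subtype.ext he
    rw [inTensor, inTensor, this]
  let J : ∀ la : Bicomp n r, Hecke r q Q →ₗ[R] TensorSpace n r q Q := fun la =>
    DirectSum.lof R (Bicomp n r) (fun la => permModule q Q la) la ∘ₗ permMap q Q la
  have hJ : ∀ la h, J la h = inTensor q Q la h := fun _ _ => rfl
  refine LinearMap.ext fun e => LinearMap.ext fun f => ?_
  induction e using inTensor_induction with
  | h0 => simp
  | hadd e e' h h' => simp only [map_add, LinearMap.add_apply, h, h']
  | hin la h =>
  induction f using inTensor_induction with
  | h0 => simp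
  | hadd e e' h h' => simp only [map_add, h, h']
  | hin mu k =>
  obtain ⟨h', hh', he⟩ := hred la h
  obtain ⟨k', hk', hf⟩ := hred mu k
  rw [he, hf, ← hJ, ← hJ, ← sub_eq_zero, ← LinearMap.sub_apply, ← LinearMap.sub_apply]
  refine (Submodule.mem_bot R).mp (map_mem_of_mem_spanT
    (((B - B').flip (J mu k')) ∘ₗ J la) ⊥ (fun v hv => ?_) hh')
  refine map_mem_of_mem_spanT (((B - B') (J la (T q Q v))) ∘ₗ J mu) ⊥ (fun w hw => ?_) hk'
  rw [Submodule.mem_bot]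
  change (B - B') (tabloid q Q la v) (tabloid q Q mu w) = 0
  rw [LinearMap.sub_apply, LinearMap.sub_apply, sub_eq_zero]
  by_cases h : la = mu ∧ v = w
  · rw [(hB la mu v w hv hw).1 h, (hB' la mu v w hv hw).1 h]
  · rw [(hB la mu v w hv hw).2 h, (hB' la mu v w hv hw).2 h]

theorem tensorForm_op_smul (e f : TensorSpace n r q Q) (k : Hecke r q Q) :
    tensorForm q Q n r (MulOpposite.op k • e) f =
      tensorForm q Q n r e (MulOpposite.op (heckeStar q Q k) • f) := by
  induction e using inTensor_induction with
  | h0 => simp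
  | hadd e e' h h' => simp only [smul_add, map_add, LinearMap.add_apply, h, h']
  | hin la h =>
    rw [op_smul_inTensor, tensorForm_inTensor, tensorForm_inTensor, ← op_smul_permElt,
      permForm_op_smul]
    rfl

/-- The adjoint of a homomorphism from `M^λ` to tensor space is a homomorphism. -/
theorem exists_adjoint (la : Bicomp n r) (s : SchurAlgebra n r q Q) :
    ∃ f : TensorSpace n r q Q →ₗ[(Hecke r q Q)ᵐᵒᵖ] permModule q Q la, ∀ h e,
      tensorForm q Q n r (s • inTensor q Q la h) e =
        permForm q Q la (permElt q Q la h) (f e) := by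
  let g : permModule q Q la →ₗ[R] TensorSpace n r q Q := (s ∘ₗ
    DirectSum.lof (Hecke r q Q)ᵐᵒᵖ (Bicomp n r) (fun la => permModule q Q la) la).restrictScalars R
  have hgop : ∀ k m, MulOpposite.op k • g m = g (MulOpposite.op k • m) := fun k m =>
    ((s ∘ₗ DirectSum.lof (Hecke r q Q)ᵐᵒᵖ (Bicomp n r) (fun la => permModule q Q la) la).map_smul
      _ m).symm
  choose f hf using fun e => exists_permForm_eq (((tensorForm q Q n r).flip e) ∘ₗ g)
  have hf' : ∀ e m, permForm q Q la m (f e) = tensorForm q Q n r (g m) e := hf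
  have huniq : ∀ m m', (∀ x, permForm q Q la x m = permForm q Q la x m') → m = m' :=
    fun m m' h => sub_eq_zero.mp (permForm_nondeg fun x => by rw [map_sub, h, sub_self])
  refine ⟨⟨⟨f, fun e e' => huniq _ _ fun x => ?_⟩, fun k e => huniq _ _ fun x => ?_⟩, fun h e => ?_⟩
  · rw [map_add, hf', hf', hf', map_add]
  · obtain ⟨k, rfl⟩ : ∃ k', k = MulOpposite.op (heckeStar q Q k') :=
      ⟨heckeStar q Q k.unop, by rw [heckeStar_heckeStar, MulOpposite.op_unop]⟩
    simp only [RingHom.id_apply]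
    rw [hf', ← permForm_op_smul, hf', ← tensorForm_op_smul, hgop]
  · exact (hf' e (permElt q Q la h)).symm

/-! ### The contracted form and the Submodule Theorem -/

variable (hn : r ≤ n) (la : Bicomp n r)

theorem ofHecke_mul (h k : Hecke r q Q) :
    ofHecke q Q hn (h * k) = MulOpposite.op k • ofHecke q Q hn h :=
  (op_smul_inTensor _ h k).symm

theorem smul_lGen (s : SchurAlgebra n r q Q) : s • lGen q Q hn la =
    MulOpposite.op (yGen q Q la) • s • ofHecke q Q hn 1 := by
  have : lGen q Q hn la = MulOpposite.op (yGen q Q la) • ofHecke q Q hn 1 := by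
    rw [← ofHecke_mul, one_mul]; rfl
  rw [this]
  exact LinearMap.map_smul s _ _

/-- The contracted form is well defined: `⟨s₁(1), s₂ y⟩ = ⟨s₁ y, s₂(1)⟩` for
`y = u_{r-a}^- ŷ_λ`. -/
theorem tensorForm_smul_lGen (s₁ s₂ : SchurAlgebra n r q Q) :
    tensorForm q Q n r (s₁ • ofHecke q Q hn 1) (s₂ • lGen q Q hn la) =
      tensorForm q Q n r (s₁ • lGen q Q hn la) (s₂ • ofHecke q Q hn 1) := by
  rw [smul_lGen, smul_lGen, tensorForm_op_smul, heckeStar_yGen]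

theorem exists_smul_lGen' (l : lModule q Q hn la) :
    ∃ s : SchurAlgebra n r q Q, s • lGen' q Q hn la = l := by
  obtain ⟨l, hl⟩ := l
  obtain ⟨s, rfl⟩ := Submodule.mem_span_singleton.mp hl
  exact ⟨s, rfl⟩

theorem existsUnique_contractedForm : ∃! C : LinearMap.BilinForm R (lModule q Q hn la),
    IsContractedForm q Q hn la (tensorForm q Q n r) C := by
  let ev : SchurAlgebra n r q Q →ₗ[R] lModule q Q hn la :=
    { toFun := fun s => s • lGen' q Q hn la
      map_add' := fun s t => add_smul s t _
      map_smul' := fun a s => Subtype.ext rfl }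
  let ev1 : SchurAlgebra n r q Q →ₗ[R] TensorSpace n r q Q :=
    { toFun := fun s => s • ofHecke q Q hn 1
      map_add' := fun s t => add_smul s t _
      map_smul' := fun a s => rfl }
  obtain ⟨σ, hσ⟩ := exists_linear_section ev (exists_smul_lGen' hn la)
  have hσ' : ∀ l, σ l • lGen q Q hn la = l := fun l =>
    congrArg Subtype.val (LinearMap.congr_fun hσ l)
  refine ⟨(tensorForm q Q n r).compl₁₂ (ev1 ∘ₗ σ)
    ((lModule q Q hn la).subtype.restrictScalars R), fun s₁ s₂ => ?_, fun C hC => ?_⟩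
  · change tensorForm q Q n r (σ (s₁ • lGen' q Q hn la) • ofHecke q Q hn 1)
      (s₂ • lGen q Q hn la) = _
    rw [tensorForm_smul_lGen, hσ', tensorForm_smul_lGen]
    rfl
  · refine LinearMap.ext fun l => LinearMap.ext fun l' => ?_
    obtain ⟨s, hs⟩ : ∃ s, s • lGen' q Q hn la = l := exists_smul_lGen' hn la l
    obtain ⟨s', rfl⟩ := exists_smul_lGen' hn la l'
    change _ = tensorForm q Q n r (σ l • ofHecke q Q hn 1) (s' • lGen q Q hn la)
    have hl : l = σ l • lGen' q Q hn la := Subtype.ext (hσ' l).symm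
    conv_lhs => rw [hl]
    exact hC _ _

theorem zElt_eq : zElt q Q la =
    inTensor q Q la (T q Q (wShift r la.a * piHat la) * yGen q Q la) := by
  rw [zElt, yGen, ← T_wShift_mul_T_piHat]
  simp only [mul_assoc]

/-- Homomorphisms from tensor space to `M^λ` map `L^λ` to the line spanned by `z_λ`. -/
theorem exists_lof_eq_smul_zElt
    (f : TensorSpace n r q Q →ₗ[(Hecke r q Q)ᵐᵒᵖ] permModule q Q la) (l : lModule q Q hn la) :
    ∃ κ : R, DirectSum.lof (Hecke r q Q)ᵐᵒᵖ (Bicomp n r) (fun la => permModule q Q la) la (f l) =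
      κ • zElt q Q la := by
  obtain ⟨s, rfl⟩ := exists_smul_lGen' hn la l
  obtain ⟨h, hh⟩ := permElt_surjective la (f (s • ofHecke q Q hn 1))
  obtain ⟨κ, hκ⟩ := exists_smul_eq (q := q) (Q := Q) la h
  refine ⟨κ, ?_⟩
  have h1 : f (s • lGen q Q hn la) = permElt q Q la (h * yGen q Q la) := by
    rw [smul_lGen, map_smul, ← hh, op_smul_permElt]
  have h2 : permElt q Q la (h * yGen q Q la) =
      permElt q Q la (κ • (T q Q (wShift r la.a * piHat la) * yGen q Q la)) := by
    refine Subtype.ext ?_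
    rw [coe_permElt, coe_permElt, ← mul_assoc, hκ, mul_smul_comm, mul_assoc]
  rw [zElt_eq, smul_inTensor]
  change DirectSum.lof (Hecke r q Q)ᵐᵒᵖ (Bicomp n r) (fun la => permModule q Q la) la
    (f (s • lGen q Q hn la)) = _
  rw [h1, h2]
  rfl

/-- `z_λ` is of the form `t u_{r-a}^- ŷ_λ` with `t(1) ∈ M^λ`. -/
theorem exists_smul_lGen_eq_zElt : ∃ (t : SchurAlgebra n r q Q) (k : Hecke r q Q),
    t • lGen q Q hn la = zElt q Q la ∧ t • ofHecke q Q hn 1 = inTensor q Q la k := by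
  let k := T q Q (wShift r la.a * piHat la)
  -- left multiplication by `u_a^+ x_λ k` on the component `M^ω = H`
  let m : permModule q Q (omegaBi hn) →ₗ[(Hecke r q Q)ᵐᵒᵖ] permModule q Q la :=
    { toFun := fun x => permElt q Q la (k * (x : Hecke r q Q))
      map_add' := fun x y => Subtype.ext (by
        rw [Submodule.coe_add, Submodule.coe_add, coe_permElt, mul_add, mul_add]; rfl)
      map_smul' := fun h x => Subtype.ext (by
        change _ * (k * (_ * _)) = _ * (k * _) * _
        simp only [mul_assoc, RingHom.id_apply]) }
  let t : SchurAlgebra n r q Q :=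
    DirectSum.lof (Hecke r q Q)ᵐᵒᵖ (Bicomp n r) (fun la => permModule q Q la) la ∘ₗ m ∘ₗ
    DirectSum.component (Hecke r q Q)ᵐᵒᵖ (Bicomp n r) (fun la => permModule q Q la) (omegaBi hn)
  have ht : ∀ h, t • ofHecke q Q hn h = inTensor q Q la (k * h) := by
    intro h
    change t (ofHecke q Q hn h) = _
    unfold ofHecke inTensor
    rw [LinearMap.comp_apply, LinearMap.comp_apply, DirectSum.component.lof_self]
    congr 1
    apply Subtype.ext
    change _ * (k * (_ * _)) = _ * (k * _)
    rw [omega_generator, one_mul]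
  exact ⟨t, k * 1, by rw [zElt_eq]; exact ht _, ht 1⟩

/-- Either some homomorphism from tensor space to `M^λ` is non-zero on `U`, and then `U` contains a
non-zero multiple of `z_λ`; or all of them vanish on `U`, and then `U` is orthogonal to `W^λ`,
since the adjoints of the maps `M^λ → E` are such homomorphisms. -/
theorem submodule_dichotomy {C : LinearMap.BilinForm R (lModule q Q hn la)}
    (hC : IsContractedForm q Q hn la (tensorForm q Q n r) C)
    (U : Submodule (SchurAlgebra n r q Q) (lModule q Q hn la)) :
    (weylModule q Q la).submoduleOf (lModule q Q hn la) ≤ U ∨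
      U.restrictScalars R ≤ C.orthogonal
        (((weylModule q Q la).submoduleOf (lModule q Q hn la)).restrictScalars R) := by
  by_cases hU : ∃ f : TensorSpace n r q Q →ₗ[(Hecke r q Q)ᵐᵒᵖ] permModule q Q la,
      ∃ u ∈ U, f u ≠ 0
  · left
    obtain ⟨f, u, hu, hfu⟩ := hU
    obtain ⟨κ, hκ⟩ := exists_lof_eq_smul_zElt hn la f u
    have hκ0 : κ ≠ 0 := by
      rintro rfl
      rw [zero_smul R (zElt q Q la)] at hκ
      have := congrArg (fun e : TensorSpace n r q Q => e la) hκ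
      exact hfu ((lof_apply_self la (f u)).symm.trans this)
    let t : SchurAlgebra n r q Q :=
      DirectSum.lof (Hecke r q Q)ᵐᵒᵖ (Bicomp n r) (fun la => permModule q Q la) la ∘ₗ f
    intro x hx
    obtain ⟨s, hs⟩ := Submodule.mem_span_singleton.mp (Submodule.mem_comap.mp hx)
    have hxu : x = s • (κ⁻¹ • (1 : SchurAlgebra n r q Q)) • t • u := by
      refine Subtype.ext ?_
      change (x : TensorSpace n r q Q) = s • (κ⁻¹ • t • (u : TensorSpace n r q Q))
      have : t • (u : TensorSpace n r q Q) = κ • zElt q Q la := hκ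
      rw [this, smul_smul κ⁻¹ κ (zElt q Q la), inv_mul_cancel₀ hκ0, one_smul R (zElt q Q la)]
      exact hs.symm
    rw [hxu]
    exact U.smul_mem _ (U.smul_mem _ (U.smul_mem _ hu))
  · right
    push Not at hU
    intro u hu
    rw [LinearMap.BilinForm.mem_orthogonal_iff]
    intro x hx
    obtain ⟨s, hs⟩ := Submodule.mem_span_singleton.mp (Submodule.mem_comap.mp hx)
    obtain ⟨t, k, ht1, ht2⟩ := exists_smul_lGen_eq_zElt (q := q) (Q := Q) hn la
    obtain ⟨f, hf⟩ := exists_adjoint la s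
    have hx' : x = (s * t) • lGen' q Q hn la := Subtype.ext (by
      change (x : TensorSpace n r q Q) = s • t • lGen q Q hn la
      rw [ht1]
      exact hs.symm)
    obtain ⟨s', hs'⟩ := exists_smul_lGen' hn la u
    have hu0 := hU f u hu
    rw [← hs'] at hu0
    change C x u = 0
    rw [hx', ← hs', hC, mul_smul, ht2, hf]
    change permForm q Q la _ (f ((s' • lGen' q Q hn la : lModule q Q hn la) :
      TensorSpace n r q Q)) = 0
    rw [hu0, _root_.map_zero]

end Forms
end QqSchur

theorem mainTheorem5 {R : Type*} [Field R] (q Q : Rˣ) (n r : ℕ) (hn : r ≤ n)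
    (la : QqSchur.Bicomp n r) :
    (∃! B : LinearMap.BilinForm R (QqSchur.TensorSpace n r q Q), QqSchur.IsTensorForm q Q B) ∧
    ∀ B : LinearMap.BilinForm R (QqSchur.TensorSpace n r q Q), QqSchur.IsTensorForm q Q B →
      (∃! C : LinearMap.BilinForm R (QqSchur.lModule q Q hn la),
        QqSchur.IsContractedForm q Q hn la B C) ∧
      ∀ C : LinearMap.BilinForm R (QqSchur.lModule q Q hn la),
        QqSchur.IsContractedForm q Q hn la B C →
        ∀ U : Submodule (QqSchur.SchurAlgebra n r q Q) (QqSchur.lModule q Q hn la),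
          (QqSchur.weylModule q Q la).submoduleOf (QqSchur.lModule q Q hn la) ≤ U ∨
          U.restrictScalars R ≤ C.orthogonal
            (((QqSchur.weylModule q Q la).submoduleOf
              (QqSchur.lModule q Q hn la)).restrictScalars R) := by
  have hB := QqSchur.isTensorForm_tensorForm (q := q) (Q := Q) (n := n) (r := r)
  refine ⟨⟨_, hB, fun B' hB' => hB'.unique hB⟩, fun B hB' => ?_⟩
  obtain rfl := hB'.unique hB
  exact ⟨QqSchur.existsUnique_contractedForm hn la, fun C hC U =>
    QqSchur.submodule_dichotomy hn la hC U⟩
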